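/- **Setting.** Let $\mathcal T$ and $M$ be smooth manifolds of dimensions $m$ and $n$, and let $E^*=J^{1*}(\mathcal T,M)\to\mathcal T\times M$ be the dual 1-jet bundle, with fibre $\mathrm{Hom}(T_xM,T_t\mathcal T)$ over $(t,x)$. Charts $(t^a)$ of $\mathcal T$ and $(x^i)$ of $M$ induce coordinates $(t^a,x^i,p_i^a)$ on $E^*$ (the indices $a,b,c,d,e,f$ run over $1,\dots,m$ and $i,j,k,l,p,r$ over $1,\dots,n$; repeated indices are summed). Let $N=(\underset1N{}^{(a)}_{(i)b},\underset2N{}^{(a)}_{(i)j})$ be a smooth nonlinear connection on $E^*$, i.e. local functions on the coordinate domains with $$\underset1{\tilde N}{}^{(b)}_{(j)c}\tfrac{\partial\tilde t^c}{\partial t^a}=\underset1N{}^{(c)}_{(k)a}\tfrac{\partial\tilde t^b}{\partial t^c}\tfrac{\partial x^k}{\partial\tilde x^j}-\tfrac{\partial\tilde p^b_j}{\partial t^a},\qquad \underset2{\tilde N}{}^{(b)}_{(j)k}\tfrac{\partial\tilde x^k}{\partial x^i}=\underset2N{}^{(c)}_{(k)i}\tfrac{\partial\tilde t^b}{\partial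 t^c}\tfrac{\partial x^k}{\partial\tilde x^j}-\tfrac{\partial\tilde p^b_j}{\partial x^i}.$$ Let $(X_A)$, $A\in\{a,\,i,\,{}^{(a)}_{(i)}\}$, be the adapted basis $\frac{\delta}{\delta t^a}=\frac{\partial}{\partial t^a}-\underset1N{}^{(b)}_{(j)a}\frac{\partial}{\partial p^b_j}$, $\frac{\delta}{\delta x^i}=\frac{\partial}{\partial x^i}-\underset2N{}^{(b)}_{(j)i}\frac{\partial}{\partial p^b_j}$, $\frac{\partial}{\partial p_i^a}$, and $dt^a$, $dx^i$, $\delta p_i^a=dp_i^a+\underset1N{}^{(a)}_{(i)b}dt^b+\underset2N{}^{(a)}_{(i)j}dx^j$ its dual basis. Let $h$ be a semi-Riemannian metric on $\mathcal T$ with Christoffel symbols $\chi^a_{bc}$. Let $D$ be a smooth linear connection on $E^*$ and write $D_{X_C}X_B=\Gamma^F_{BC}X_F$. Assume that $D$ is an *$h$-normal $N$-linear connection of Cartan type*: $D$ is parallel for the three projections of the splitting $\mathrm{Span}\{\frac{\delta}{\delta t^a}\}\oplus\mathrm{Span}\{\frac{\delta}{\delta x^i}\}\oplus\mathrm{Span}\{\frac{\partial}{\partial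 p_i^a}\}$; $\Gamma^a_{bc}=\chi^a_{bc}$, $\Gamma^a_{bi}=0$, $\Gamma^{a}_{b\,{}^{(i)}_{(c)}}=0$; $D\mathbb J=0$ for $\mathbb J=h_{ab}\,\delta p_i^a\otimes dt^b\otimes dx^i$; and, with $H^i_{jk}=\Gamma^i_{jk}$ and $C^{i(k)}_{j(c)}=\Gamma^{i}_{j\,{}^{(k)}_{(c)}}$, one has $H^i_{jk}=H^i_{kj}$ and $C^{i(k)}_{j(c)}=C^{k(i)}_{j(c)}$. **Notation.** Let $\mathbb T$ and $\mathbb R$ be the torsion and the curvature of $D$, with components $\mathbb T(X_C,X_B)=\mathbb T^F_{BC}X_F$ and $\mathbb R(X_C,X_B)X_A=\mathbb R^F_{ABC}X_F$. The torsion d-tensors are $T^r_{aj}$ (the component $\mathbb T^r_{aj}$), $R^{(f)}_{(r)BC}$ with $B,C\in\{a,i\}$, $P^{(f)\,(j)}_{(r)B(b)}$ with $B\in\{a,i\}$ and second index ${}^{(j)}_{(b)}$, and $S^{(f)(i)(j)}_{(r)(a)(b)}$ (the components of $\mathbb T$ along $\frac{\partial}{\partial p_r^f}$). The curvature d-tensors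 are $R^l_{iBC}$, $P^{l\,(k)}_{iB(c)}$, $S^{l(j)(k)}_{i(b)(c)}$ (the components of $\mathbb R(\cdot,\cdot)\frac{\delta}{\delta x^i}$ along $\frac{\delta}{\delta x^l}$), and $R^{(d)(p)}_{(l)(e)BC}$, $P^{(d)(p)\,(k)}_{(l)(e)B(c)}$, $S^{(d)(p)(j)(k)}_{(l)(e)(b)(c)}$ are **minus** the components of $\mathbb R(\cdot,\cdot)\frac{\partial}{\partial p_p^e}$ along $\frac{\partial}{\partial p_l^d}$. Moreover $\chi^d_{abc}=\frac{\delta\chi^d_{ab}}{\delta t^c}-\frac{\delta\chi^d_{ac}}{\delta t^b}+\chi^f_{ab}\chi^d_{fc}-\chi^f_{ac}\chi^d_{fb}$. The symbols ${}_{/b}$, ${}_{|k}$, $|^{(k)}_{(c)}$ are the local covariant derivatives of d-tensors along $\frac{\delta}{\delta t^b}$, $\frac{\delta}{\delta x^k}$, $\frac{\partial}{\partial p_k^c}$ (for instance $S^F_{BC:G}=X_G(S^F_{BC})+S^K_{BC}\Gamma^F_{KG}-S^F_{KC}\Gamma^K_{BG}-S^F_{BK}\Gamma^K_{CG}$). Finally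 $\sum_{\{A,B,C\}}$ is the cyclic sum and $\mathcal A_{\{A,B\}}\{\Phi_{AB}\}=\Phi_{AB}-\Phi_{BA}$ the alternate sum, and in $\mathcal A_{\{a,k\}}$ the exchange carries the types of the indices with it; $\mathcal A_{\{(b)(j),(c)(k)\}}$ exchanges the pairs $(b,j)$ and $(c,k)$, and $\sum_{\{(a)(i),(b)(j),(c)(k)\}}$ permutes the pairs cyclically. **Theorem.** On the domain of all induced coordinates the following thirty local Bianchi identities hold, for all values of the free indices. *First set.* 1. $\sum_{\{a,b,c\}}\chi^d_{abc}=0$. 2. $\mathcal A_{\{a,b\}}\{T^l_{ar}T^r_{bk}-T^l_{ak/b}\}=R^l_{kab}-C^{l(r)}_{k(f)}R^{(f)}_{(r)ab}$. 3. $\mathcal A_{\{j,k\}}\{C^{l(r)}_{k(f)}R^{(f)}_{(r)aj}+R^l_{jak}+T^l_{aj|k}\}=0$. 4. $\sum_{\{i,j,k\}}\{C^{l(r)}_{k(f)}R^{(f)}_{(r)ij}-R^l_{ijk}\}=0$. *Second set.* 5. $\sum_{\{a,b,c\}}\{R^{(d)}_{(l)ab/c}+P^{(d)\,(r)}_{(l)c(f)}R^{(f)}_{(r)ab}\}=0$.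 6. $\mathcal A_{\{a,b\}}\{R^{(d)}_{(l)ak/b}+P^{(d)\,(r)}_{(l)b(f)}R^{(f)}_{(r)ak}+R^{(d)}_{(l)br}T^r_{ak}\}=R^{(d)}_{(l)ab|k}+P^{(d)\,(r)}_{(l)k(f)}R^{(f)}_{(r)ab}$. 7. $\mathcal A_{\{j,k\}}\{R^{(d)}_{(l)aj|k}+P^{(d)\,(r)}_{(l)k(f)}R^{(f)}_{(r)aj}+R^{(d)}_{(l)kr}T^r_{aj}\}=-R^{(d)}_{(l)jk/a}-P^{(d)\,(r)}_{(l)a(f)}R^{(f)}_{(r)jk}$. 8. $\sum_{\{i,j,k\}}\{R^{(d)}_{(l)ij|k}+P^{(d)\,(r)}_{(l)k(f)}R^{(f)}_{(r)ij}\}=0$. *Third set.* 9. $T^l_{ak}|^{(p)}_{(e)}-C^{l(p)}_{r(e)}T^r_{ak}+P^{l\,(p)}_{ka(e)}+C^{l(p)}_{k(e)/a}-C^{l(r)}_{k(f)}P^{(f)\,(p)}_{(r)a(e)}+C^{r(p)}_{k(e)}T^l_{ar}=0$. 10. $\mathcal A_{\{j,k\}}\{C^{l(p)}_{j(e)|k}+C^{l(r)}_{k(f)}P^{(f)\,(p)}_{(r)j(e)}+P^{l\,(p)}_{jk(e)}\}=0$.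 *Fourth set.* 11. $\mathcal A_{\{a,b\}}\{P^{(d)\,(p)}_{(l)a(e)/b}+P^{(d)\,(r)}_{(l)b(f)}P^{(f)\,(p)}_{(r)a(e)}\}=R^{(d)}_{(l)ab}|^{(p)}_{(e)}+R^{(d)(p)}_{(l)(e)ab}+S^{(d)(p)(r)}_{(l)(e)(f)}R^{(f)}_{(r)ab}$. 12. $\mathcal A_{\{a,k\}}\{P^{(d)\,(p)}_{(l)a(e)|k}+P^{(d)\,(r)}_{(l)k(f)}P^{(f)\,(p)}_{(r)a(e)}\}=R^{(d)}_{(l)ak}|^{(p)}_{(e)}+R^{(d)(p)}_{(l)(e)ak}+S^{(d)(p)(r)}_{(l)(e)(f)}R^{(f)}_{(r)ak}+R^{(d)}_{(l)ar}C^{r(p)}_{k(e)}-T^r_{ak}P^{(d)\,(p)}_{(l)r(e)}$. 13. $\mathcal A_{\{j,k\}}\{P^{(d)\,(p)}_{(l)j(e)|k}+P^{(d)\,(r)}_{(l)k(f)}P^{(f)\,(p)}_{(r)j(e)}+R^{(d)}_{(l)kr}C^{r(p)}_{j(e)}\}=R^{(d)}_{(l)jk}|^{(p)}_{(e)}+R^{(d)(p)}_{(l)(e)jk}+S^{(d)(p)(r)}_{(l)(e)(f)}R^{(f)}_{(r)jk}$.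 *Fifth set.* 14. $\mathcal A_{\{(b)(j),(c)(k)\}}\{C^{l(j)}_{i(b)}|^{(k)}_{(c)}+C^{r(k)}_{i(c)}C^{l(j)}_{r(b)}\}=S^{l(j)(k)}_{i(b)(c)}-C^{l(r)}_{i(f)}S^{(f)(j)(k)}_{(r)(b)(c)}$. *Sixth set.* 15. $\mathcal A_{\{(b)(j),(c)(k)\}}\{P^{(d)\,(j)}_{(l)a(b)}|^{(k)}_{(c)}+P^{(f)\,(j)}_{(r)a(b)}S^{(d)(k)(r)}_{(l)(c)(f)}-P^{(d)(j)\,(k)}_{(l)(b)a(c)}\}=-S^{(d)(j)(k)}_{(l)(b)(c)/a}-S^{(f)(j)(k)}_{(r)(b)(c)}P^{(d)\,(r)}_{(l)a(f)}$. 16. $\mathcal A_{\{(b)(j),(c)(k)\}}\{P^{(d)\,(j)}_{(l)i(b)}|^{(k)}_{(c)}+P^{(f)\,(j)}_{(r)i(b)}S^{(d)(k)(r)}_{(l)(c)(f)}-P^{(d)(j)\,(k)}_{(l)(b)i(c)}-C^{r(j)}_{i(b)}P^{(d)\,(k)}_{(l)r(c)}\}=-S^{(d)(j)(k)}_{(l)(b)(c)|i}-S^{(f)(j)(k)}_{(r)(b)(c)}P^{(d)\,(r)}_{(l)i(f)}$.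 *Seventh set.* 17. $\sum_{\{(a)(i),(b)(j),(c)(k)\}}\{S^{(d)(i)(j)}_{(l)(a)(b)}|^{(k)}_{(c)}+S^{(f)(i)(j)}_{(r)(a)(b)}S^{(d)(k)(r)}_{(l)(c)(f)}+S^{(d)(i)(j)(k)}_{(l)(a)(b)(c)}\}=0$. *Eighth set.* 18. $\sum_{\{a,b,c\}}\chi^d_{eab/c}=0$. 19. $\chi^d_{eab|k}=0$. 20. $\chi^d_{eab}|^{(k)}_{(c)}=0$. 21. $\sum_{\{a,b,c\}}\{R^l_{pab/c}+R^{(f)}_{(r)ab}P^{l\,(r)}_{pc(f)}\}=0$. 22. $\mathcal A_{\{a,b\}}\{R^l_{pak/b}+R^{(f)}_{(r)ak}P^{l\,(r)}_{pb(f)}+T^r_{ak}R^l_{pbr}\}=R^l_{pab|k}+R^{(f)}_{(r)ab}P^{l\,(r)}_{pk(f)}$. 23. $\mathcal A_{\{j,k\}}\{R^l_{paj|k}+R^{(f)}_{(r)aj}P^{l\,(r)}_{pk(f)}+T^r_{aj}R^l_{pkr}\}=-R^l_{pjk/a}-R^{(f)}_{(r)jk}P^{l\,(r)}_{pa(f)}$.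 24. $\sum_{\{i,j,k\}}\{R^l_{pij|k}+R^{(f)}_{(r)ij}P^{l\,(r)}_{pk(f)}\}=0$. *Ninth set.* 25. $\mathcal A_{\{a,b\}}\{P^{l\,(p)}_{ia(e)/b}+P^{(f)\,(p)}_{(r)a(e)}P^{l\,(r)}_{ib(f)}\}=R^l_{iab}|^{(p)}_{(e)}+R^{(f)}_{(r)ab}S^{l(p)(r)}_{i(e)(f)}$. 26. $\mathcal A_{\{a,k\}}\{P^{l\,(p)}_{ia(e)|k}+P^{(f)\,(p)}_{(r)a(e)}P^{l\,(r)}_{ik(f)}\}=R^l_{iak}|^{(p)}_{(e)}+R^{(f)}_{(r)ak}S^{l(p)(r)}_{i(e)(f)}+C^{r(p)}_{k(e)}R^l_{iar}-T^r_{ak}P^{l\,(p)}_{ir(e)}$. 27. $\mathcal A_{\{j,k\}}\{P^{l\,(p)}_{ij(e)|k}+P^{(f)\,(p)}_{(r)j(e)}P^{l\,(r)}_{ik(f)}+C^{r(p)}_{j(e)}R^l_{ikr}\}=R^l_{ijk}|^{(p)}_{(e)}+R^{(f)}_{(r)jk}S^{l(p)(r)}_{i(e)(f)}$. *Tenth set.*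 28. $\mathcal A_{\{(b)(j),(c)(k)\}}\{P^{l\,(j)}_{pa(b)}|^{(k)}_{(c)}+P^{(f)\,(j)}_{(r)a(b)}S^{l(k)(r)}_{p(c)(f)}\}=-S^{l(j)(k)}_{p(b)(c)/a}-S^{(f)(j)(k)}_{(r)(b)(c)}P^{l\,(r)}_{pa(f)}$. 29. $\mathcal A_{\{(b)(j),(c)(k)\}}\{P^{l\,(j)}_{pi(b)}|^{(k)}_{(c)}+P^{(f)\,(j)}_{(r)i(b)}S^{l(k)(r)}_{p(c)(f)}-C^{r(j)}_{i(b)}P^{l\,(k)}_{pr(c)}\}=-S^{l(j)(k)}_{p(b)(c)|i}-S^{(f)(j)(k)}_{(r)(b)(c)}P^{l\,(r)}_{pi(f)}$. *Eleventh set.* 30. $\sum_{\{(a)(i),(b)(j),(c)(k)\}}\{S^{l(i)(j)}_{p(a)(b)}|^{(k)}_{(c)}+S^{(f)(i)(j)}_{(r)(a)(b)}S^{l(k)(r)}_{p(c)(f)}\}=0$. -/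

import Mathlib

open scoped Manifold ContDiff Bundle
open Bundle

noncomputable section

namespace DualJet

/-! ## The dual 1-jet bundle -/

/-- The model fibre: linear maps from `ℝⁿ` to `ℝᵐ`, i.e. the polymomenta `p_i^a`. -/
abbrev Fib (m n : ℕ) : Type := EuclideanSpace ℝ (Fin n) →L[ℝ] EuclideanSpace ℝ (Fin m)

/-- The space of the coordinates `(t^a, x^i, p_i^a)`. -/
abbrev Crd (m n : ℕ) : Type :=
  (EuclideanSpace ℝ (Fin m) × EuclideanSpace ℝ (Fin n)) × Fib m n

/-- The model with corners (without boundary) of the dual 1-jet bundle. -/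
abbrev IJ (m n : ℕ) :
    ModelWithCorners ℝ (Crd m n)
      (ModelProd (ModelProd (EuclideanSpace ℝ (Fin m)) (EuclideanSpace ℝ (Fin n))) (Fib m n)) :=
  ((𝓡 m).prod (𝓡 n)).prod 𝓘(ℝ, Fib m n)

/-- The tangent bundle of `T`, pulled back to `T × M`. -/
@[nolint unusedArguments]
def TB (m n : ℕ) (T M : Type*)
    [TopologicalSpace T] [ChartedSpace (EuclideanSpace ℝ (Fin m)) T]
    [TopologicalSpace M] [ChartedSpace (EuclideanSpace ℝ (Fin n)) M] (b : T × M) : Type :=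
  TangentSpace (𝓡 m) b.1

/-- The tangent bundle of `M`, pulled back to `T × M`. -/
@[nolint unusedArguments]
def MB (m n : ℕ) (T M : Type*)
    [TopologicalSpace T] [ChartedSpace (EuclideanSpace ℝ (Fin m)) T]
    [TopologicalSpace M] [ChartedSpace (EuclideanSpace ℝ (Fin n)) M] (b : T × M) : Type :=
  TangentSpace (𝓡 n) b.2

section Bundles

variable (m n : ℕ) (T M : Type*)
  [TopologicalSpace T] [ChartedSpace (EuclideanSpace ℝ (Fin m)) T]
  [TopologicalSpace M] [ChartedSpace (EuclideanSpace ℝ (Fin n)) M]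

/-- The projection `T × M → T` as a smooth map. -/
abbrev prT : C^∞⟮(𝓡 m).prod (𝓡 n), T × M; 𝓡 m, T⟯ := ContMDiffMap.fst

/-- The projection `T × M → M` as a smooth map. -/
abbrev prM : C^∞⟮(𝓡 m).prod (𝓡 n), T × M; 𝓡 n, M⟯ := ContMDiffMap.snd

instance (b : T × M) : AddCommGroup (TB m n T M b) :=
  inferInstanceAs (AddCommGroup (TangentSpace (𝓡 m) b.1))
instance (b : T × M) : Module ℝ (TB m n T M b) :=
  inferInstanceAs (Module ℝ (TangentSpace (𝓡 m) b.1))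
instance (b : T × M) : TopologicalSpace (TB m n T M b) :=
  inferInstanceAs (TopologicalSpace (TangentSpace (𝓡 m) b.1))
instance (b : T × M) : IsTopologicalAddGroup (TB m n T M b) :=
  inferInstanceAs (IsTopologicalAddGroup (TangentSpace (𝓡 m) b.1))
instance (b : T × M) : ContinuousSMul ℝ (TB m n T M b) :=
  inferInstanceAs (ContinuousSMul ℝ (TangentSpace (𝓡 m) b.1))
instance (b : T × M) : AddCommGroup (MB m n T M b) :=
  inferInstanceAs (AddCommGroup (TangentSpace (𝓡 n) b.2))
instance (b : T × M) : Module ℝ (MB m n T M b) :=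
  inferInstanceAs (Module ℝ (TangentSpace (𝓡 n) b.2))
instance (b : T × M) : TopologicalSpace (MB m n T M b) :=
  inferInstanceAs (TopologicalSpace (TangentSpace (𝓡 n) b.2))
instance (b : T × M) : IsTopologicalAddGroup (MB m n T M b) :=
  inferInstanceAs (IsTopologicalAddGroup (TangentSpace (𝓡 n) b.2))
instance (b : T × M) : ContinuousSMul ℝ (MB m n T M b) :=
  inferInstanceAs (ContinuousSMul ℝ (TangentSpace (𝓡 n) b.2))

variable [IsManifold (𝓡 m) ∞ T] [IsManifold (𝓡 n) ∞ M]

instance : TopologicalSpace (TotalSpace (EuclideanSpace ℝ (Fin m)) (TB m n T M)) :=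
  inferInstanceAs (TopologicalSpace (TotalSpace (EuclideanSpace ℝ (Fin m))
    ((prT m n T M) *ᵖ (TangentSpace (𝓡 m) : T → Type _))))
instance : FiberBundle (EuclideanSpace ℝ (Fin m)) (TB m n T M) :=
  inferInstanceAs (FiberBundle (EuclideanSpace ℝ (Fin m))
    ((prT m n T M) *ᵖ (TangentSpace (𝓡 m) : T → Type _)))
instance : VectorBundle ℝ (EuclideanSpace ℝ (Fin m)) (TB m n T M) :=
  inferInstanceAs (VectorBundle ℝ (EuclideanSpace ℝ (Fin m))
    ((prT m n T M) *ᵖ (TangentSpace (𝓡 m) : T → Type _)))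
instance : ContMDiffVectorBundle ∞ (EuclideanSpace ℝ (Fin m)) (TB m n T M)
    ((𝓡 m).prod (𝓡 n)) :=
  inferInstanceAs (ContMDiffVectorBundle ∞ (EuclideanSpace ℝ (Fin m))
    ((prT m n T M) *ᵖ (TangentSpace (𝓡 m) : T → Type _)) ((𝓡 m).prod (𝓡 n)))

instance : TopologicalSpace (TotalSpace (EuclideanSpace ℝ (Fin n)) (MB m n T M)) :=
  inferInstanceAs (TopologicalSpace (TotalSpace (EuclideanSpace ℝ (Fin n))
    ((prM m n T M) *ᵖ (TangentSpace (𝓡 n) : M → Type _))))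
instance : FiberBundle (EuclideanSpace ℝ (Fin n)) (MB m n T M) :=
  inferInstanceAs (FiberBundle (EuclideanSpace ℝ (Fin n))
    ((prM m n T M) *ᵖ (TangentSpace (𝓡 n) : M → Type _)))
instance : VectorBundle ℝ (EuclideanSpace ℝ (Fin n)) (MB m n T M) :=
  inferInstanceAs (VectorBundle ℝ (EuclideanSpace ℝ (Fin n))
    ((prM m n T M) *ᵖ (TangentSpace (𝓡 n) : M → Type _)))
instance : ContMDiffVectorBundle ∞ (EuclideanSpace ℝ (Fin n)) (MB m n T M)
    ((𝓡 m).prod (𝓡 n)) :=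
  inferInstanceAs (ContMDiffVectorBundle ∞ (EuclideanSpace ℝ (Fin n))
    ((prM m n T M) *ᵖ (TangentSpace (𝓡 n) : M → Type _)) ((𝓡 m).prod (𝓡 n)))

/-- The dual 1-jet bundle `E* = J^{1*}(T, M)`: the total space of the vector bundle over `T × M`
whose fibre over `(t, x)` is `T_t T ⊗ T*_x M = Hom(T_x M, T_t T)`. Its topology and its smooth
structure are those of the bundle of linear maps. -/
abbrev E : Type _ :=
  TotalSpace (Fib m n) (fun b : T × M => MB m n T M b →L[ℝ] TB m n T M b)

end Bundles

/-- The indices of the adapted bases: `a`, `i`, or a pair `(a, i)`. -/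
abbrev Idx (m n : ℕ) : Type := Fin m ⊕ Fin n ⊕ (Fin m × Fin n)

/-- The temporal index `a`. -/
abbrev tI {m n : ℕ} (a : Fin m) : Idx m n := Sum.inl a

/-- The spatial index `i`. -/
abbrev xI {m n : ℕ} (i : Fin n) : Idx m n := Sum.inr (Sum.inl i)

/-- The vertical index `(a), (i)`, that of the coordinate `p_i^a`. -/
abbrev vI {m n : ℕ} (a : Fin m) (i : Fin n) : Idx m n := Sum.inr (Sum.inr (a, i))

/-- The standard basis of the coordinate space, numbered by the indices. -/
def stdVec {m n : ℕ} : Idx m n → Crd m n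
  | Sum.inl a => ((EuclideanSpace.single a 1, 0), 0)
  | Sum.inr (Sum.inl i) => ((0, EuclideanSpace.single i 1), 0)
  | Sum.inr (Sum.inr (a, i)) =>
      ((0, 0), (EuclideanSpace.proj i : EuclideanSpace ℝ (Fin n) →L[ℝ] ℝ).smulRight
        (EuclideanSpace.single a (1 : ℝ)))

section Geometry

variable {m n : ℕ} {T M : Type*}
  [TopologicalSpace T] [ChartedSpace (EuclideanSpace ℝ (Fin m)) T]
  [TopologicalSpace M] [ChartedSpace (EuclideanSpace ℝ (Fin n)) M]

/-! ## Induced coordinates -/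

variable (m n T M) in
/-- A pair of smooth charts `(t^a)` of `T` and `(x^i)` of `M`. -/
structure ChartPair where
  /-- the coordinates `t^a` -/
  φ : OpenPartialHomeomorph T (EuclideanSpace ℝ (Fin m))
  /-- the coordinates `x^i` -/
  ψ : OpenPartialHomeomorph M (EuclideanSpace ℝ (Fin n))
  φ_mem : φ ∈ IsManifold.maximalAtlas (𝓡 m) ∞ T
  ψ_mem : ψ ∈ IsManifold.maximalAtlas (𝓡 n) ∞ M

/-- The domain in `E*` of the coordinates induced by a pair of charts. -/
def ChartPair.dom (c : ChartPair m n T M) : Set (E m n T M) :=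
  {e | e.proj.1 ∈ c.φ.source ∧ e.proj.2 ∈ c.ψ.source}

/-- The matrix `p_i^a` of the linear map `e : T_x M → T_t T` in the coordinate bases. -/
def ChartPair.fibre (c : ChartPair m n T M) (e : E m n T M) : Fib m n :=
  ((mfderiv (𝓡 m) (𝓡 m) c.φ e.proj.1 :
      TangentSpace (𝓡 m) e.proj.1 →L[ℝ] EuclideanSpace ℝ (Fin m)).comp
    (show TangentSpace (𝓡 n) e.proj.2 →L[ℝ] TangentSpace (𝓡 m) e.proj.1 from e.snd)).comp
      ((mfderiv (𝓡 n) (𝓡 n) c.ψ e.proj.2 :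
        TangentSpace (𝓡 n) e.proj.2 →L[ℝ] EuclideanSpace ℝ (Fin n)).inverse)

/-- The induced coordinates `(t^a, x^i, p_i^a)` on `E*`. -/
def ChartPair.coord (c : ChartPair m n T M) (e : E m n T M) : Crd m n :=
  ((c.φ e.proj.1, c.ψ e.proj.2), c.fibre e)

/-- The single coordinate functions `t^a`, `x^i`, `p_i^a` on `E*`. -/
def ChartPair.fn (c : ChartPair m n T M) : Idx m n → E m n T M → ℝ
  | Sum.inl a => fun e => c.φ e.proj.1 a
  | Sum.inr (Sum.inl i) => fun e => c.ψ e.proj.2 i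
  | Sum.inr (Sum.inr (a, i)) => fun e => c.fibre e (EuclideanSpace.single i 1) a

variable [IsManifold (𝓡 m) ∞ T] [IsManifold (𝓡 n) ∞ M]

/-- The preferred charts of `T` and `M` at the base point of `e`. -/
def ChartPair.chartAt (e : E m n T M) : ChartPair m n T M :=
  ⟨_root_.chartAt _ e.proj.1, _root_.chartAt _ e.proj.2,
    IsManifold.chart_mem_maximalAtlas _, IsManifold.chart_mem_maximalAtlas _⟩

/-- The induced coordinates of the preferred charts are the chart of the bundle `E*`. -/
theorem ChartPair.coord_chartAt (e0 e : E m n T M) (he : e ∈ (ChartPair.chartAt e0).dom) :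
    (ChartPair.chartAt e0).coord e = extChartAt (IJ m n) e0 e := by
  obtain ⟨h1, h2⟩ := he
  have key := hom_chart (𝕜 := ℝ) (E₁ := MB m n T M) (E₂ := TB m n T M) (HB := ModelProd (EuclideanSpace ℝ (Fin m)) (EuclideanSpace ℝ (Fin n))) e0 e
  have k2 : extChartAt (IJ m n) e0 e = (_root_.chartAt (ModelProd (ModelProd (EuclideanSpace ℝ (Fin m)) (EuclideanSpace ℝ (Fin n))) (Fib m n)) e0 e) := rfl
  rw [k2]
  erw [key]
  refine Prod.ext rfl ?_
  have hx : e.proj ∈ (trivializationAt (EuclideanSpace ℝ (Fin n)) (MB m n T M) e0.proj).baseSet := h2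
  have ht : e.proj ∈ (trivializationAt (EuclideanSpace ℝ (Fin m)) (TB m n T M) e0.proj).baseSet := h1
  show (ChartPair.chartAt e0).fibre e = ContinuousLinearMap.inCoordinates _ _ _ _ _ _ _ _ _
  rw [ContinuousLinearMap.inCoordinates_eq hx ht]
  have kt : mfderiv (𝓡 m) (𝓡 m) (ChartPair.chartAt e0).φ e.proj.1 = (trivializationAt (EuclideanSpace ℝ (Fin m)) (TangentSpace (𝓡 m) : T → Type _) e0.proj.1).continuousLinearMapAt ℝ e.proj.1 := by
    rw [TangentBundle.continuousLinearMapAt_trivializationAt (show e.proj.1 ∈ (_root_.chartAt _ e0.proj.1).source from h1)]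
    rfl
  have kx : mfderiv (𝓡 n) (𝓡 n) (ChartPair.chartAt e0).ψ e.proj.2 = (trivializationAt (EuclideanSpace ℝ (Fin n)) (TangentSpace (𝓡 n) : M → Type _) e0.proj.2).continuousLinearMapAt ℝ e.proj.2 := by
    rw [TangentBundle.continuousLinearMapAt_trivializationAt (show e.proj.2 ∈ (_root_.chartAt _ e0.proj.2).source from h2)]
    rfl
  have kinv : (mfderiv (𝓡 n) (𝓡 n) (ChartPair.chartAt e0).ψ e.proj.2 : TangentSpace (𝓡 n) e.proj.2 →L[ℝ] EuclideanSpace ℝ (Fin n)).inverse = (((trivializationAt (EuclideanSpace ℝ (Fin n)) (TangentSpace (𝓡 n) : M → Type _) e0.proj.2).continuousLinearEquivAt ℝ e.proj.2 h2).symm : EuclideanSpace ℝ (Fin n) →L[ℝ] TangentSpace (𝓡 n) e.proj.2) := by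
    rw [← ContinuousLinearMap.inverse_equiv]
    apply congrArg
    refine kx.trans ?_
    ext v : 1
    exact congrFun (Trivialization.coe_continuousLinearEquivAt_eq _ h2).symm v
  unfold ChartPair.fibre
  refine (congrArg₂ (fun (A : EuclideanSpace ℝ (Fin m) →L[ℝ] EuclideanSpace ℝ (Fin m)) (B : EuclideanSpace ℝ (Fin n) →L[ℝ] EuclideanSpace ℝ (Fin n)) => (A.comp (show EuclideanSpace ℝ (Fin n) →L[ℝ] EuclideanSpace ℝ (Fin m) from e.snd)).comp B) kt kinv).trans ?_
  ext v : 1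
  have e1 := (Trivialization.coe_continuousLinearEquivAt_eq (R:=ℝ) (trivializationAt (EuclideanSpace ℝ (Fin m)) (TangentSpace (𝓡 m) : T → Type _) e0.proj.1) h1)
  have a1 : ∀ w, (trivializationAt (EuclideanSpace ℝ (Fin m)) (TangentSpace (𝓡 m) : T → Type _) e0.proj.1).continuousLinearMapAt ℝ e.proj.1 w = (Trivialization.continuousLinearEquivAt ℝ (trivializationAt (EuclideanSpace ℝ (Fin m)) (TB m n T M) e0.proj) e.proj ht) w := fun w => (congrFun e1 w).symm
  have a2 : ∀ w, ((trivializationAt (EuclideanSpace ℝ (Fin n)) (TangentSpace (𝓡 n) : M → Type _) e0.proj.2).continuousLinearEquivAt ℝ e.proj.2 h2).symm w = (Trivialization.continuousLinearEquivAt ℝ (trivializationAt (EuclideanSpace ℝ (Fin n)) (MB m n T M) e0.proj) e.proj hx).symm w := fun w => by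
    refine (ContinuousLinearEquiv.symm_apply_eq _).mpr ?_
    exact ((Trivialization.continuousLinearEquivAt ℝ (trivializationAt (EuclideanSpace ℝ (Fin n)) (MB m n T M) e0.proj) e.proj hx).apply_symm_apply w).symm
  refine (a1 _).trans ?_
  exact congrArg (fun w => (Trivialization.continuousLinearEquivAt ℝ (trivializationAt (EuclideanSpace ℝ (Fin m)) (TB m n T M) e0.proj) e.proj ht) (e.snd w)) (a2 v)

/-- The derivative of a function on `E*` along a tangent vector. -/
def dir (f : E m n T M → ℝ) (e : E m n T M) (v : TangentSpace (IJ m n) e) : ℝ :=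
  mfderiv (IJ m n) 𝓘(ℝ, ℝ) f e v

/-- The coordinate vector fields `∂/∂t^a`, `∂/∂x^i`, `∂/∂p_i^a` on the coordinate domain. -/
def ChartPair.pd (c : ChartPair m n T M) (A : Idx m n) (e : E m n T M) :
    TangentSpace (IJ m n) e :=
  VectorField.mpullback (IJ m n) 𝓘(ℝ, Crd m n) c.coord (fun _ => stdVec A) e

/-! ## Nonlinear connections and adapted bases -/

variable (m n T M) in
/-- A nonlinear connection on `E*`: for each pair of charts, smooth local functions
`N₁ a i b = N^{(a)}_{(i)b}` and `N₂ a i j = N^{(a)}_{(i)j}` on the coordinate domain, obeying the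
transformation rules under changes of charts. -/
structure NonlinearConnection where
  /-- the temporal components -/
  N₁ : ChartPair m n T M → Fin m → Fin n → Fin m → E m n T M → ℝ
  /-- the spatial components -/
  N₂ : ChartPair m n T M → Fin m → Fin n → Fin n → E m n T M → ℝ
  smooth₁ : ∀ c a i b, ContMDiffOn (IJ m n) 𝓘(ℝ, ℝ) ∞ (N₁ c a i b) c.dom
  smooth₂ : ∀ c a i j, ContMDiffOn (IJ m n) 𝓘(ℝ, ℝ) ∞ (N₂ c a i j) c.dom
  rule₁ : ∀ c c' : ChartPair m n T M, ∀ e ∈ c.dom ∩ c'.dom, ∀ b j a,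
    ∑ d, N₁ c' b j d e * dir (c'.fn (tI d)) e (c.pd (tI a) e) =
      (∑ d, ∑ k, N₁ c d k a e * dir (c'.fn (tI b)) e (c.pd (tI d) e) *
        dir (c.fn (xI k)) e (c'.pd (xI j) e)) -
      dir (c'.fn (vI b j)) e (c.pd (tI a) e)
  rule₂ : ∀ c c' : ChartPair m n T M, ∀ e ∈ c.dom ∩ c'.dom, ∀ b j i,
    ∑ k, N₂ c' b j k e * dir (c'.fn (xI k)) e (c.pd (xI i) e) =
      (∑ d, ∑ k, N₂ c d k i e * dir (c'.fn (tI b)) e (c.pd (tI d) e) *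
        dir (c.fn (xI k)) e (c'.pd (xI j) e)) -
      dir (c'.fn (vI b j)) e (c.pd (xI i) e)

/-- The adapted basis of vector fields: `δ/δt^a`, `δ/δx^i`, `∂/∂p_i^a`. -/
def frame (N : NonlinearConnection m n T M) (c : ChartPair m n T M) :
    Idx m n → (e : E m n T M) → TangentSpace (IJ m n) e
  | Sum.inl a => fun e => c.pd (tI a) e - ∑ b, ∑ j, N.N₁ c b j a e • c.pd (vI b j) e
  | Sum.inr (Sum.inl i) => fun e => c.pd (xI i) e - ∑ b, ∑ j, N.N₂ c b j i e • c.pd (vI b j) e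
  | Sum.inr (Sum.inr (a, i)) => fun e => c.pd (vI a i) e

/-- The adapted basis of covector fields: `dt^a`, `dx^i`,
`δp_i^a = dp_i^a + N^{(a)}_{(i)b} dt^b + N^{(a)}_{(i)j} dx^j`. -/
def coframe (N : NonlinearConnection m n T M) (c : ChartPair m n T M) :
    Idx m n → (e : E m n T M) → TangentSpace (IJ m n) e → ℝ
  | Sum.inl a => fun e v => dir (c.fn (tI a)) e v
  | Sum.inr (Sum.inl i) => fun e v => dir (c.fn (xI i)) e v
  | Sum.inr (Sum.inr (a, i)) => fun e v =>
      dir (c.fn (vI a i)) e v + (∑ b, N.N₁ c a i b e * dir (c.fn (tI b)) e v) +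
        ∑ j, N.N₂ c a i j e * dir (c.fn (xI j)) e v

/-- The projection `h_T` onto the temporal horizontal distribution. -/
def projT (N : NonlinearConnection m n T M) (c : ChartPair m n T M) (e : E m n T M)
    (v : TangentSpace (IJ m n) e) : TangentSpace (IJ m n) e :=
  ∑ a, coframe N c (tI a) e v • frame N c (tI a) e

/-- The projection `h_M` onto the spatial horizontal distribution. -/
def projM (N : NonlinearConnection m n T M) (c : ChartPair m n T M) (e : E m n T M)
    (v : TangentSpace (IJ m n) e) : TangentSpace (IJ m n) e :=
  ∑ i, coframe N c (xI i) e v • frame N c (xI i) e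

/-- The projection `v` onto the vertical distribution. -/
def projV (N : NonlinearConnection m n T M) (c : ChartPair m n T M) (e : E m n T M)
    (v : TangentSpace (IJ m n) e) : TangentSpace (IJ m n) e :=
  ∑ a, ∑ i, coframe N c (vI a i) e v • frame N c (vI a i) e

/-! ## Linear connections -/

variable (m n T M) in
/-- Linear connections on `E*`; `D Y e (X e)` is the value of `D_X Y` at `e`. -/
abbrev LinearConnection : Type _ :=
  CovariantDerivative (IJ m n) (Crd m n) (TangentSpace (IJ m n) : E m n T M → Type _)

/-- A linear connection is smooth if it maps smooth (local) vector fields to smooth ones. -/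
def IsSmooth (D : LinearConnection m n T M) : Prop :=
  ∀ U : Set (E m n T M), IsOpen U → ContMDiffCovariantDerivativeOn (Crd m n) ∞ D.toFun U

/-- The vector field `Y` on `E*` is differentiable at `e`. -/
def DiffAt (Y : (e : E m n T M) → TangentSpace (IJ m n) e) (e : E m n T M) : Prop :=
  MDifferentiableAt (IJ m n) (IJ m n).tangent
    (fun y => (⟨y, Y y⟩ : TangentBundle (IJ m n) (E m n T M))) e

/-- The adapted components of `D`: `D_{X_C} X_B = Γ^F_{BC} X_F`. -/
def conn (N : NonlinearConnection m n T M) (D : LinearConnection m n T M)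
    (c : ChartPair m n T M) (F B C : Idx m n) (e : E m n T M) : ℝ :=
  coframe N c F e (D (frame N c B) e (frame N c C e))

/-- `D` is an `N`-linear connection: `D h_T = 0`, `D h_M = 0`, `D v = 0`. -/
structure IsNLinear (N : NonlinearConnection m n T M) (D : LinearConnection m n T M) : Prop where
  parT : ∀ c : ChartPair m n T M, ∀ e ∈ c.dom, ∀ Y, DiffAt Y e → ∀ w : TangentSpace (IJ m n) e,
    D (fun y => projT N c y (Y y)) e w = projT N c e (D Y e w)
  parM : ∀ c : ChartPair m n T M, ∀ e ∈ c.dom, ∀ Y, DiffAt Y e → ∀ w : TangentSpace (IJ m n) e,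
    D (fun y => projM N c y (Y y)) e w = projM N c e (D Y e w)
  parV : ∀ c : ChartPair m n T M, ∀ e ∈ c.dom, ∀ Y, DiffAt Y e → ∀ w : TangentSpace (IJ m n) e,
    D (fun y => projV N c y (Y y)) e w = projV N c e (D Y e w)

/-! ## The temporal metric -/

variable (m T) in
/-- A semi-Riemannian metric on `T`. -/
structure TemporalMetric where
  /-- the bilinear form on each tangent space -/
  form : ∀ t : T, TangentSpace (𝓡 m) t →L[ℝ] TangentSpace (𝓡 m) t →L[ℝ] ℝ
  symm : ∀ t u v, form t u v = form t v u
  nondegenerate : ∀ t u, (∀ v, form t u v = 0) → u = 0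
  smooth : ContMDiff (𝓡 m) ((𝓡 m).prod
      𝓘(ℝ, EuclideanSpace ℝ (Fin m) →L[ℝ] EuclideanSpace ℝ (Fin m) →L[ℝ] ℝ)) ∞
    (fun t => TotalSpace.mk'
      (EuclideanSpace ℝ (Fin m) →L[ℝ] EuclideanSpace ℝ (Fin m) →L[ℝ] ℝ) t (form t))

/-- The coordinate vector field `∂/∂t^a` on `T`. -/
def ChartPair.pdT (c : ChartPair m n T M) (a : Fin m) (t : T) : TangentSpace (𝓡 m) t :=
  VectorField.mpullback (𝓡 m) (𝓡 m) c.φ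
    (fun _ => (EuclideanSpace.single a 1 : EuclideanSpace ℝ (Fin m))) t

/-- The components `h_{ab}`. -/
def metric (h : TemporalMetric m T) (c : ChartPair m n T M) (a b : Fin m) (t : T) : ℝ :=
  h.form t (c.pdT a t) (c.pdT b t)

/-- The partial derivative `∂h_{ab}/∂t^d`. -/
def metricDeriv (h : TemporalMetric m T) (c : ChartPair m n T M) (a b d : Fin m) (t : T) : ℝ :=
  mfderiv (𝓡 m) 𝓘(ℝ, ℝ) (metric h c a b) t (c.pdT d t)

/-- The Christoffel symbols `χ^a_{bc}` of `h`, as functions on `E*`. -/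
def christoffel (h : TemporalMetric m T) (c : ChartPair m n T M) (a b d : Fin m)
    (e : E m n T M) : ℝ :=
  (1 / 2 : ℝ) * ∑ f, (Matrix.of fun i j => metric h c i j e.proj.1)⁻¹ a f *
    (metricDeriv h c f d b e.proj.1 + metricDeriv h c f b d e.proj.1
      - metricDeriv h c b d f e.proj.1)

/-! ## `h`-normal connections and connections of Cartan type -/

/-- The `h`-normalization d-tensor `𝕁 = h_{ab} δ^i_j δp_i^a ⊗ dt^b ⊗ dx^j`. -/
def normTensor (N : NonlinearConnection m n T M) (h : TemporalMetric m T)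
    (c : ChartPair m n T M) (e : E m n T M) (u v w : TangentSpace (IJ m n) e) : ℝ :=
  ∑ a, ∑ b, ∑ i, metric h c a b e.proj.1 *
    coframe N c (vI a i) e u * coframe N c (tI b) e v * coframe N c (xI i) e w

/-- `D` is an `h`-normal `N`-linear connection: it is `N`-linear, `A^a_{bc} = χ^a_{bc}`,
`H^a_{bi} = 0`, `C^{a(i)}_{b(c)} = 0` and `D𝕁 = 0`. -/
structure IsHNormal (N : NonlinearConnection m n T M) (h : TemporalMetric m T)
    (D : LinearConnection m n T M) : Prop extends IsNLinear N D where
  A_eq : ∀ c : ChartPair m n T M, ∀ e ∈ c.dom, ∀ a b d,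
    conn N D c (tI a) (tI b) (tI d) e = christoffel h c a b d e
  H_eq : ∀ c : ChartPair m n T M, ∀ e ∈ c.dom, ∀ a b i,
    conn N D c (tI a) (tI b) (xI i) e = 0
  C_eq : ∀ c : ChartPair m n T M, ∀ e ∈ c.dom, ∀ a b d i,
    conn N D c (tI a) (tI b) (vI d i) e = 0
  parJ : ∀ c : ChartPair m n T M, ∀ e ∈ c.dom, ∀ Y₁ Y₂ Y₃, DiffAt Y₁ e → DiffAt Y₂ e →
    DiffAt Y₃ e → ∀ w : TangentSpace (IJ m n) e,
    dir (fun y => normTensor N h c y (Y₁ y) (Y₂ y) (Y₃ y)) e w =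
      normTensor N h c e (D Y₁ e w) (Y₂ e) (Y₃ e) +
      normTensor N h c e (Y₁ e) (D Y₂ e w) (Y₃ e) +
      normTensor N h c e (Y₁ e) (Y₂ e) (D Y₃ e w)

/-- `D` is an `h`-normal `N`-linear connection of Cartan type: moreover `H^i_{jk} = H^i_{kj}` and
`C^{i(k)}_{j(a)} = C^{k(i)}_{j(a)}`. -/
structure IsCartan (N : NonlinearConnection m n T M) (h : TemporalMetric m T)
    (D : LinearConnection m n T M) : Prop extends IsHNormal N h D where
  H_symm : ∀ c : ChartPair m n T M, ∀ e ∈ c.dom, ∀ i j k,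
    conn N D c (xI i) (xI j) (xI k) e = conn N D c (xI i) (xI k) (xI j) e
  C_symm : ∀ c : ChartPair m n T M, ∀ e ∈ c.dom, ∀ i j k a,
    conn N D c (xI i) (xI j) (vI a k) e = conn N D c (xI k) (xI j) (vI a i) e

/-! ## Torsion, curvature and local covariant derivatives -/

/-- The adapted components of the torsion: `𝕋(X_C, X_B) = 𝕋^F_{BC} X_F`. -/
def torsion (N : NonlinearConnection m n T M) (D : LinearConnection m n T M)
    (c : ChartPair m n T M) (F B C : Idx m n) (e : E m n T M) : ℝ :=
  coframe N c F e (D.torsion e (frame N c C e) (frame N c B e))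

/-- The curvature `ℝ(X, Y)Z = D_X D_Y Z - D_Y D_X Z - D_{[X, Y]} Z`. -/
def curvatureField (D : LinearConnection m n T M)
    (X Y Z : (e : E m n T M) → TangentSpace (IJ m n) e) (e : E m n T M) :
    TangentSpace (IJ m n) e :=
  D (fun y => D Z y (Y y)) e (X e) - D (fun y => D Z y (X y)) e (Y e)
    - D Z e (VectorField.mlieBracket (IJ m n) X Y e)

/-- The adapted components of the curvature: `ℝ(X_C, X_B)X_A = ℝ^F_{ABC} X_F`. -/
def curvature (N : NonlinearConnection m n T M) (D : LinearConnection m n T M)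
    (c : ChartPair m n T M) (F A B C : Idx m n) (e : E m n T M) : ℝ :=
  coframe N c F e (curvatureField D (frame N c C) (frame N c B) (frame N c A) e)

/-- The local covariant derivative `S^F_{BC:G}` of a d-tensor with components `S^F_{BC}`; it is
`_{/g}`, `_{|s}` or `|_{(g)}^{(s)}` according to the type of the index `G`. -/
def covDeriv₂ (N : NonlinearConnection m n T M) (D : LinearConnection m n T M)
    (c : ChartPair m n T M) (S : Idx m n → Idx m n → Idx m n → E m n T M → ℝ)
    (F B C G : Idx m n) (e : E m n T M) : ℝ :=
  dir (S F B C) e (frame N c G e) + (∑ K, S K B C e * conn N D c F K G e)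
    - (∑ K, S F K C e * conn N D c K B G e) - ∑ K, S F B K e * conn N D c K C G e

/-- The local covariant derivative `S^F_{ABC:G}` of a d-tensor with components `S^F_{ABC}`. -/
def covDeriv₃ (N : NonlinearConnection m n T M) (D : LinearConnection m n T M)
    (c : ChartPair m n T M) (S : Idx m n → Idx m n → Idx m n → Idx m n → E m n T M → ℝ)
    (F A B C G : Idx m n) (e : E m n T M) : ℝ :=
  dir (S F A B C) e (frame N c G e) + (∑ K, S K A B C e * conn N D c F K G e)
    - (∑ K, S F K B C e * conn N D c K A G e) - (∑ K, S F A K C e * conn N D c K B G e)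
    - ∑ K, S F A B K e * conn N D c K C G e

/-- The d-tensor of the connection components `C^{l(r)}_{k(f)}`. -/
def vertTensor (N : NonlinearConnection m n T M) (D : LinearConnection m n T M)
    (c : ChartPair m n T M) : Idx m n → Idx m n → Idx m n → E m n T M → ℝ
  | Sum.inr (Sum.inl l), Sum.inr (Sum.inl k), Sum.inr (Sum.inr (f, r)) =>
      conn N D c (xI l) (xI k) (vI f r)
  | _, _, _ => 0

/-- The curvature `χ^d_{abc}` of the metric `h`, as a d-tensor on `E*`:
`χ^d_{abc} = δχ^d_{ab}/δt^c - δχ^d_{ac}/δt^b + χ^f_{ab} χ^d_{fc} - χ^f_{ac} χ^d_{fb}`. -/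
def metricCurv (N : NonlinearConnection m n T M) (h : TemporalMetric m T)
    (c : ChartPair m n T M) : Idx m n → Idx m n → Idx m n → Idx m n → E m n T M → ℝ
  | Sum.inl d, Sum.inl a, Sum.inl b, Sum.inl g => fun e =>
      dir (christoffel h c d a b) e (frame N c (tI g) e)
        - dir (christoffel h c d a g) e (frame N c (tI b) e)
        + ∑ f, (christoffel h c f a b e * christoffel h c d f g e
          - christoffel h c f a g e * christoffel h c d f b e)
  | _, _, _, _ => 0

end Geometry

/-- The cyclic sum over three indices. -/
def cyc {α : Type*} (f : α → α → α → ℝ) (a b c : α) : ℝ := f a b c + f b c a + f c a b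

/-- The alternate sum over two indices. -/
def alt {α : Type*} (f : α → α → ℝ) (a b : α) : ℝ := f a b - f b a

end DualJet

end

noncomputable section

/-! ## The Bianchi identities as identities between jets of structure functions -/

section Algebra

variable {ι : Type*} [Fintype ι]

/-! Every item is one of the two Bianchi identities of a linear connection with torsion, written in
a non-holonomic frame and specialised to a choice of types (temporal, spatial, vertical) of its free
indices. With cyclic sums over `A, B, C` and summation over `K` they read Σ {R^F_{ABC} - T^F_{AB:C}
- T^K_{AB} T^F_{CK}} = 0, Σ {R^F_{EAB:C} + T^K_{AB} R^F_{ECK}} = 0.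

Let `[X_A, X_B] = w^K_{AB} X_K`. Torsion and curvature are polynomials in the connection
coefficients, the functions `w` and their first derivatives along the frame. Treating these
derivatives as independent variables, the identities are pure algebra once three facts are granted:
`w` is antisymmetric, `w` satisfies the Jacobi identity, and second derivatives commute up to `w`.
This is the content of `first_bianchi_of_jets` and `second_bianchi_of_jets`. The three facts hold
for every smooth frame on an open set, whence `SmoothFrame.first_bianchi` and
`SmoothFrame.second_bianchi`. The adapted basis is such a frame because induced coordinates are
genuine smooth coordinates on `E*` (`contMDiffAt_coord`, `isInvertible_mfderiv_coord`), as
comparison with the bundle charts shows.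

The short form of the thirty identities comes from vanishing components. Parallel projections make
the connection, hence the curvature, block diagonal. The forms `dt^a` and `dx^i` are exact, so
brackets of frame fields are vertical; with the symmetry of the Christoffel symbols and of
`H^i_{jk}` this kills all temporal torsion and most of the spatial torsion. The temporal block of
the curvature is that of `h`, since the Christoffel symbols depend on `t` alone. `BianchiData`
collects these facts at one point, `bianchiData` proves them, and each item then follows by fixing
types and discarding zero blocks. -/

theorem second_bianchi_of_jets (G : ι → Matrix ι ι ℝ) (dG : ι → ι → Matrix ι ι ℝ)
    (ddG : ι → ι → ι → Matrix ι ι ℝ) (w : ι → ι → ι → ℝ) (dw : ι → ι → ι → ι → ℝ)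
    (T : ι → ι → ι → ℝ) (R : ι → ι → Matrix ι ι ℝ) (dR : ι → ι → ι → Matrix ι ι ℝ)
    (hw : ∀ K A B, w K A B = -w K B A)
    (hcomm : ∀ A B C, ddG A B C - ddG B A C = ∑ K, w K A B • dG K C)
    (hjac : ∀ A B C K, (dw C K A B + ∑ L, w L A B * w K C L) +
      (dw A K B C + ∑ L, w L B C * w K A L) + (dw B K C A + ∑ L, w L C A * w K B L) = 0)
    (hT : ∀ K A B, T K A B = G B K A - G A K B - w K B A)
    (hR : ∀ A B, R A B = dG B A - dG A B + G B * G A - G A * G B - ∑ K, w K B A • G K)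
    (hdR : ∀ C A B, dR C A B = ddG C B A - ddG C A B + (dG C B * G A + G B * dG C A)
      - (dG C A * G B + G A * dG C B) - ∑ K, (dw C K B A • G K + w K B A • dG C K))
    (A B C : ι) :
    (dR C A B + G C * R A B - R A B * G C - (∑ K, G C K A • R K B) - (∑ K, G C K B • R A K)
        + ∑ K, T K A B • R C K) +
      (dR A B C + G A * R B C - R B C * G A - (∑ K, G A K B • R K C) - (∑ K, G A K C • R B K)
        + ∑ K, T K B C • R A K) +
      (dR B C A + G B * R C A - R C A * G B - (∑ K, G B K C • R K A) - (∑ K, G B K A • R C K)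
        + ∑ K, T K C A • R B K) = 0 := by
  have hanti : ∀ A B, R A B = -R B A := by
    intro A B
    rw [hR, hR]
    simp only [hw _ B A, neg_smul, Finset.sum_neg_distrib]
    abel
  -- The connection part of the torsion term cancels, in the cyclic sum, the terms that the
  -- covariant derivative contributes for the two lower form indices; `e2` brings those to the same
  -- shape. Only the part with `w` survives, and `key` expands it.
  have e1 : ∀ A B C, (∑ K, T K A B • R C K) =
      (∑ K, G B K A • R C K) - (∑ K, G A K B • R C K) - ∑ K, w K B A • R C K := by
    intro A B C
    simp only [hT, sub_smul, Finset.sum_sub_distrib]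
  have e2 : ∀ A B C, (∑ K, G C K A • R K B) = - ∑ K, G C K A • R B K := by
    intro A B C
    rw [← Finset.sum_neg_distrib]
    refine Finset.sum_congr rfl fun K _ => ?_
    rw [hanti K B, smul_neg]
  have key : ∀ A B C : ι, (∑ K, w K B A • R C K) = (∑ K, w K B A • dG K C)
      - (∑ K, w K B A • dG C K) + (∑ K, w K B A • G K) * G C - G C * (∑ K, w K B A • G K)
      - ∑ L, (∑ K, w K B A * w L K C) • G L := by
    intro A B C
    simp only [hR, smul_add, smul_sub, Finset.sum_add_distrib, Finset.sum_sub_distrib,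
      Finset.sum_mul, Finset.mul_sum, Finset.smul_sum, smul_mul_assoc, mul_smul_comm]
    congr 1
    rw [Finset.sum_comm]
    refine Finset.sum_congr rfl fun L _ => ?_
    rw [Finset.sum_smul]
    exact Finset.sum_congr rfl fun K _ => smul_smul _ _ _
  -- The Jacobi identity for `w` contracted with the connection matrices. The order `B A C` appears
  -- because `R A B` stands for the curvature on `(X_B, X_A)`.
  have jac : (∑ K, dw C K B A • G K) + (∑ K, dw A K C B • G K) + (∑ K, dw B K A C • G K)
      - (∑ L, (∑ K, w K B A * w L K C) • G L) - (∑ L, (∑ K, w K C B * w L K A) • G L)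
      - (∑ L, (∑ K, w K A C * w L K B) • G L) = 0 := by
    simp only [← Finset.sum_add_distrib, ← Finset.sum_sub_distrib, ← add_smul, ← sub_smul]
    refine Finset.sum_eq_zero fun K _ => ?_
    have h := hjac B A C K
    have s : ∀ A B C, (∑ L, w L B A * w K L C) = -∑ L, w L B A * w K C L := by
      intro A B C
      rw [← Finset.sum_neg_distrib]
      exact Finset.sum_congr rfl fun L _ => by rw [hw K L C, mul_neg]
    rw [s, s, s]
    refine smul_eq_zero_of_left ?_ _
    linear_combination h
  have c1 := hcomm C B A
  have c2 := hcomm A C B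
  have c3 := hcomm B A C
  rw [e1, e1, e1, e2 A B C, e2 B C A, e2 C A B, key, key, key, hdR, hdR, hdR]
  simp only [Finset.sum_add_distrib]
  simp only [hR, mul_add, mul_sub, add_mul, sub_mul, mul_assoc]
  -- Second derivatives occur in pairs of opposite order and sign. Exchanging one of each pair
  -- leaves terms `w • dG` that cancel those of `key`; the matrix products cancel among themselves.
  have z1 : ddG C B A = ddG B C A + ∑ K, w K C B • dG K A := by rw [← c1]; abel
  have z2 : ddG A C B = ddG C A B + ∑ K, w K A C • dG K B := by rw [← c2]; abel
  have z3 : ddG B A C = ddG A B C + ∑ K, w K B A • dG K C := by rw [← c3]; abel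
  rw [z1, z2, z3]
  refine Eq.trans ?_ (neg_eq_zero.mpr jac)
  abel

/-- The derivatives of `G` and the products of two factors `G`, or of `G` and `w`, cancel in the
cyclic sum. What remains is exactly the Jacobi identity for `w`. -/
theorem first_bianchi_of_jets (G w : ι → ι → ι → ℝ) (dG dw : ι → ι → ι → ι → ℝ)
    (T : ι → ι → ι → ℝ) (R dT : ι → ι → ι → ι → ℝ)
    (hw : ∀ K A B, w K A B = -w K B A)
    (hjac : ∀ A B C K, (dw C K A B + ∑ L, w L A B * w K C L) +
      (dw A K B C + ∑ L, w L B C * w K A L) + (dw B K C A + ∑ L, w L C A * w K B L) = 0)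
    (hT : ∀ F A B, T F A B = G F A B - G F B A - w F B A)
    (hdT : ∀ C F A B, dT C F A B = dG C F A B - dG C F B A - dw C F B A)
    (hR : ∀ F A B C, R F A B C = dG C F A B - dG B F A C + (∑ K, G K A B * G F K C)
      - (∑ K, G K A C * G F K B) - ∑ K, w K C B * G F A K)
    (F A B C : ι) :
    (R F A B C - (dT C F A B + (∑ K, T K A B * G F K C) - (∑ K, T F K B * G K A C)
        - ∑ K, T F A K * G K B C) - ∑ K, T K A B * T F C K) +
      (R F B C A - (dT A F B C + (∑ K, T K B C * G F K A) - (∑ K, T F K C * G K B A)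
        - ∑ K, T F B K * G K C A) - ∑ K, T K B C * T F A K) +
      (R F C A B - (dT B F C A + (∑ K, T K C A * G F K B) - (∑ K, T F K A * G K C B)
        - ∑ K, T F C K * G K A B) - ∑ K, T K C A * T F B K) = 0 := by
  -- In `t1` to `t4` equal products are written with the same order of factors, so that equal sums
  -- become the same atom for the final `linear_combination`.
  have t1 : ∀ A B C, (∑ K, T K A B * G F K C) = (∑ K, G K A B * G F K C)
      - (∑ K, G K B A * G F K C) - ∑ K, w K B A * G F K C := by
    intro A B C
    simp only [hT, sub_mul, Finset.sum_sub_distrib]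
  have t2 : ∀ A B C, (∑ K, T F K B * G K A C) = (∑ K, G K A C * G F K B)
      - (∑ K, G K A C * G F B K) - ∑ K, G K A C * w F B K := by
    intro A B C
    simp only [hT, ← Finset.sum_sub_distrib]
    exact Finset.sum_congr rfl fun K _ => by ring
  have t3 : ∀ A B C, (∑ K, T F A K * G K B C) = (∑ K, G K B C * G F A K)
      - (∑ K, G K B C * G F K A) + ∑ K, G K B C * w F A K := by
    intro A B C
    simp only [hT, ← Finset.sum_sub_distrib, ← Finset.sum_add_distrib]
    exact Finset.sum_congr rfl fun K _ => by rw [hw F K A]; ring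
  have t4 : ∀ A B C, (∑ K, T K A B * T F C K) = (∑ K, G K A B * G F C K)
      - (∑ K, G K A B * G F K C) + (∑ K, G K A B * w F C K)
      - ((∑ K, G K B A * G F C K) - (∑ K, G K B A * G F K C) + (∑ K, G K B A * w F C K))
      - ((∑ K, w K B A * G F C K) - (∑ K, w K B A * G F K C) + (∑ K, w K B A * w F C K)) := by
    intro A B C
    simp only [hT, ← Finset.sum_sub_distrib, ← Finset.sum_add_distrib]
    exact Finset.sum_congr rfl fun K _ => by rw [hw F K C]; ring
  have h := hjac B A C F
  rw [t1, t1, t1, t2, t2, t2, t3, t3, t3, t4, t4, t4]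
  simp only [hR, hdT]
  linear_combination h

end Algebra

/-! ## Smooth frames over open subsets of a manifold -/

section Fields

open VectorField

variable {V : Type*} [NormedAddCommGroup V] [NormedSpace ℝ V] {H : Type*} [TopologicalSpace H]
  {I : ModelWithCorners ℝ V H} {X : Type*} [TopologicalSpace X] [ChartedSpace H X]

variable (I) in
/-- The derivative of a real function along a tangent vector. -/
def dirDeriv (f : X → ℝ) (x : X) (v : TangentSpace I x) : ℝ := mfderiv I 𝓘(ℝ, ℝ) f x v

theorem dirDeriv_congr {f g : X → ℝ} {x : X} (h : f =ᶠ[nhds x] g) (v : TangentSpace I x) :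
    dirDeriv I f x v = dirDeriv I g x v := by
  have := h.mfderiv_eq (I := I) (I' := 𝓘(ℝ, ℝ))
  exact congrArg (fun L : TangentSpace I x →L[ℝ] ℝ => L v) this

variable {f g : X → ℝ} {x : X}

theorem MDifferentiableAt.add_fun (hf : MDifferentiableAt I 𝓘(ℝ, ℝ) f x)
    (hg : MDifferentiableAt I 𝓘(ℝ, ℝ) g x) :
    MDifferentiableAt I 𝓘(ℝ, ℝ) (fun y => f y + g y) x := hf.add hg

theorem MDifferentiableAt.sub_fun (hf : MDifferentiableAt I 𝓘(ℝ, ℝ) f x)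
    (hg : MDifferentiableAt I 𝓘(ℝ, ℝ) g x) :
    MDifferentiableAt I 𝓘(ℝ, ℝ) (fun y => f y - g y) x := hf.sub hg

theorem dirDeriv_add_fun (hf : MDifferentiableAt I 𝓘(ℝ, ℝ) f x)
    (hg : MDifferentiableAt I 𝓘(ℝ, ℝ) g x) (v : TangentSpace I x) :
    dirDeriv I (fun y => f y + g y) x v = dirDeriv I f x v + dirDeriv I g x v :=
  congrArg (fun L : TangentSpace I x →L[ℝ] ℝ => L v) (mvfderiv_add hf hg)

theorem dirDeriv_sub_fun (hf : MDifferentiableAt I 𝓘(ℝ, ℝ) f x)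
    (hg : MDifferentiableAt I 𝓘(ℝ, ℝ) g x) (v : TangentSpace I x) :
    dirDeriv I (fun y => f y - g y) x v = dirDeriv I f x v - dirDeriv I g x v :=
  congrArg (fun L : TangentSpace I x →L[ℝ] ℝ => L v) (mvfderiv_sub hf hg)

theorem dirDeriv_mul_fun (hf : MDifferentiableAt I 𝓘(ℝ, ℝ) f x)
    (hg : MDifferentiableAt I 𝓘(ℝ, ℝ) g x) (v : TangentSpace I x) :
    dirDeriv I (fun y => f y * g y) x v = dirDeriv I f x v * g x + f x * dirDeriv I g x v := by
  have := congrArg (fun L : TangentSpace I x →L[ℝ] ℝ => L v) (mvfderiv_mul hf hg)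
  refine this.trans ?_
  change f x * _ + g x * _ = _
  rw [add_comm, mul_comm (g x)]
  rfl

theorem dirDeriv_const (c : ℝ) (v : TangentSpace I x) : dirDeriv I (fun _ : X => c) x v = 0 :=
  congrArg (fun L : TangentSpace I x →L[ℝ] ℝ => L v) (mvfderiv_const c)

theorem dirDeriv_sum_fun {κ : Type*} (s : Finset κ) {F : κ → X → ℝ}
    (hF : ∀ k ∈ s, MDifferentiableAt I 𝓘(ℝ, ℝ) (F k) x) (v : TangentSpace I x) :
    dirDeriv I (fun y => ∑ k ∈ s, F k y) x v = ∑ k ∈ s, dirDeriv I (F k) x v := by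
  classical
  have : MDifferentiableAt I 𝓘(ℝ, ℝ) (fun y => ∑ k ∈ s, F k y) x ∧
      dirDeriv I (fun y => ∑ k ∈ s, F k y) x v = ∑ k ∈ s, dirDeriv I (F k) x v := by
    induction s using Finset.induction_on with
    | empty => simpa using ⟨mdifferentiableAt_const, dirDeriv_const (x := x) 0 v⟩
    | insert a s ha ih =>
      obtain ⟨h1, h2⟩ := ih fun k hk => hF k (Finset.mem_insert_of_mem hk)
      have h0 := hF a (Finset.mem_insert_self a s)
      simp only [Finset.sum_insert ha]
      exact ⟨h0.add h1, by rw [dirDeriv_add_fun h0 h1, h2]⟩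
  exact this.2

variable [IsManifold I ∞ X]

variable (I) in
/-- The vector field `Y` is smooth at `x`. -/
def SmoothFieldAt (Y : (x : X) → TangentSpace I x) (x : X) : Prop :=
  ContMDiffAt I I.tangent ∞ (fun y => (⟨y, Y y⟩ : TangentBundle I X)) x

variable {Y Z W : (x : X) → TangentSpace I x}

theorem ContMDiffAt.dirDeriv (hf : ContMDiffAt I 𝓘(ℝ, ℝ) ∞ f x) (hY : SmoothFieldAt I Y x) :
    ContMDiffAt I 𝓘(ℝ, ℝ) ∞ (fun y => _root_.dirDeriv I f y (Y y)) x := by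
  have h1 := hf.mfderiv_const (m := ∞) (by simp)
  have h2 := ContMDiffAt.clm_apply_of_inCoordinates (b₁ := id) (b₂ := f) (v := Y)
    (E₂ := fun y : ℝ => TangentSpace 𝓘(ℝ, ℝ) y) (F₂ := ℝ) (ϕ := fun y => mfderiv I 𝓘(ℝ, ℝ) f y)
    h1 hY hf
  have h3 := (contMDiffAt_totalSpace.1 h2).2
  simpa using! h3

theorem SmoothFieldAt.mdifferentiableAt (hY : SmoothFieldAt I Y x) :
    MDifferentiableAt I I.tangent (fun y => (⟨y, Y y⟩ : TangentBundle I X)) x :=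
  ContMDiffAt.mdifferentiableAt hY (by simp)

variable [CompleteSpace V]

omit [IsManifold I ∞ X] [CompleteSpace V] in
theorem mlieBracket_congr_of_isOpen {U : Set X} (hU : IsOpen U) (hx : x ∈ U)
    {Y' Z' : (x : X) → TangentSpace I x} (hY : ∀ y ∈ U, Y y = Y' y) (hZ : ∀ y ∈ U, Z y = Z' y) :
    mlieBracket I Y Z x = mlieBracket I Y' Z' x :=
  Filter.EventuallyEq.mlieBracket_vectorField_eq
    (Filter.eventuallyEq_of_mem (hU.mem_nhds hx) hY)
    (Filter.eventuallyEq_of_mem (hU.mem_nhds hx) hZ)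

omit [CompleteSpace V] in
theorem SmoothFieldAt.fsmul (hf : ContMDiffAt I 𝓘(ℝ, ℝ) ∞ f x) (hY : SmoothFieldAt I Y x) :
    SmoothFieldAt I (fun y => f y • Y y) x :=
  ContMDiffAt.smul_section hf hY

theorem SmoothFieldAt.mlieBracket (hY : SmoothFieldAt I Y x) (hZ : SmoothFieldAt I Z x) :
    SmoothFieldAt I (mlieBracket I Y Z) x :=
  -- The bracket costs one derivative, which is free at smoothness `∞` because `∞ + 1 = ∞`; over
  -- `ℝ`, `minSmoothness` leaves the order unchanged.
  haveI : IsManifold I ((⊤ : ℕ∞) + 1) X := ‹IsManifold I ∞ X›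
  haveI : IsManifold I (minSmoothness ℝ 3) X := by
    rw [minSmoothness_of_isRCLikeNormedField]; infer_instance
  ContMDiffAt.mlieBracket_vectorField (n := ⊤) (m := ⊤) hY hZ
    (by rw [minSmoothness_of_isRCLikeNormedField]; exact le_rfl)

theorem mlieBracket_smul_right_apply (hf : ContMDiffAt I 𝓘(ℝ, ℝ) ∞ f x)
    (hZ : SmoothFieldAt I Z x) :
    VectorField.mlieBracket I Y (fun y => f y • Z y) x =
      dirDeriv I f x (Y x) • Z x + f x • VectorField.mlieBracket I Y Z x :=
  mlieBracket_smul_right (hf.mdifferentiableAt (by simp)) hZ.mdifferentiableAt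

theorem mlieBracket_jacobi (hY : SmoothFieldAt I Y x) (hZ : SmoothFieldAt I Z x)
    (hW : SmoothFieldAt I W x) :
    VectorField.mlieBracket I Y (VectorField.mlieBracket I Z W) x =
      VectorField.mlieBracket I (VectorField.mlieBracket I Y Z) W x
        + VectorField.mlieBracket I Z (VectorField.mlieBracket I Y W) x := by
  have : IsManifold I (minSmoothness ℝ 3) X := by
    rw [minSmoothness_of_isRCLikeNormedField]; infer_instance
  have h2 : minSmoothness ℝ 2 ≤ ∞ := by
    rw [minSmoothness_of_isRCLikeNormedField]; exact ENat.LEInfty.out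
  exact leibniz_identity_mlieBracket_apply (hY.of_le h2) (hZ.of_le h2) (hW.of_le h2)

/-- The Lie bracket acts on smooth functions as the commutator. -/
theorem dirDeriv_mlieBracket {U : Set X} (hU : IsOpen U)
    (hf : ∀ y ∈ U, ContMDiffAt I 𝓘(ℝ, ℝ) ∞ f y) (hY : ∀ y ∈ U, SmoothFieldAt I Y y)
    (hZ : ∀ y ∈ U, SmoothFieldAt I Z y) (hx : x ∈ U) (hY0 : Y x ≠ 0) :
    dirDeriv I f x (VectorField.mlieBracket I Y Z x) =
      dirDeriv I (fun y => dirDeriv I f y (Z y)) x (Y x) -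
        dirDeriv I (fun y => dirDeriv I f y (Y y)) x (Z x) := by
  have add_right : ∀ {A B C : (x : X) → TangentSpace I x}, SmoothFieldAt I B x →
      SmoothFieldAt I C x → VectorField.mlieBracket I A (fun y => B y + C y) x =
        VectorField.mlieBracket I A B x + VectorField.mlieBracket I A C x := fun hB hC =>
    mlieBracket_add_right hB.mdifferentiableAt hC.mdifferentiableAt
  -- The Jacobi identity for `Y`, `Z`, `f • Y`. Expanded by the Leibniz rule, its terms with a
  -- single derivative of `f` match on both sides, those without derivatives are `f x` times the
  -- identity `J0` for `Y`, `Z`, `Y`, and the rest is the claimed difference times `Y x`. Hence the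
  -- need for `Y x ≠ 0`.
  have J := mlieBracket_jacobi (hY x hx) (hZ x hx) ((hY x hx).fsmul (hf x hx))
  have J0 := mlieBracket_jacobi (hY x hx) (hZ x hx) (hY x hx)
  rw [mlieBracket_congr_of_isOpen (Y' := Y) hU hx (fun _ _ => rfl)
      (fun y hy => mlieBracket_smul_right_apply (hf y hy) (hY y hy)),
    mlieBracket_congr_of_isOpen (Y := Z) (Y' := Z) hU hx (fun _ _ => rfl)
      (fun y hy => mlieBracket_smul_right_apply (Y := Y) (hf y hy) (hY y hy)),
    add_right (.fsmul ((hf x hx).dirDeriv (hZ x hx)) (hY x hx))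
      (((hZ x hx).mlieBracket (hY x hx)).fsmul (hf x hx)),
    add_right (.fsmul ((hf x hx).dirDeriv (hY x hx)) (hY x hx))
      (((hY x hx).mlieBracket (hY x hx)).fsmul (hf x hx)),
    mlieBracket_smul_right_apply ((hf x hx).dirDeriv (hZ x hx)) (hY x hx),
    mlieBracket_smul_right_apply ((hf x hx).dirDeriv (hY x hx)) (hY x hx),
    mlieBracket_smul_right_apply (hf x hx) ((hZ x hx).mlieBracket (hY x hx)),
    mlieBracket_smul_right_apply (hf x hx) ((hY x hx).mlieBracket (hY x hx)),
    mlieBracket_smul_right_apply (hf x hx) (hY x hx)] at J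
  have key : (dirDeriv I f x (VectorField.mlieBracket I Y Z x) -
      (dirDeriv I (fun y => dirDeriv I f y (Z y)) x (Y x) -
        dirDeriv I (fun y => dirDeriv I f y (Y y)) x (Z x))) • Y x = 0 := by
    linear_combination (norm := module) (f x) • J0 - J
  exact sub_eq_zero.1 ((smul_eq_zero.1 key).resolve_right hY0)

end Fields

/-! ### Smooth frames: structure functions, connection coefficients and the Jacobi identity. -/

section Frames

open VectorField

variable {V : Type*} [NormedAddCommGroup V] [NormedSpace ℝ V] {H : Type*} [TopologicalSpace H]
  {I : ModelWithCorners ℝ V H} {X : Type*} [TopologicalSpace X] [ChartedSpace H X]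
  [IsManifold I ∞ X] {ι : Type*} [Fintype ι] [DecidableEq ι] {U : Set X}

variable (I ι U) in
/-- A smooth frame of the tangent bundle over an open set, with its dual coframe. -/
structure SmoothFrame where
  /-- the vector fields of the frame -/
  vec : ι → (x : X) → TangentSpace I x
  /-- the covector fields of the dual coframe -/
  covec : ι → (x : X) → TangentSpace I x →L[ℝ] ℝ
  isOpen : IsOpen U
  smooth_vec : ∀ A, ∀ x ∈ U, SmoothFieldAt I (vec A) x
  smooth_covec : ∀ A Y, ∀ x ∈ U, SmoothFieldAt I Y x →
    ContMDiffAt I 𝓘(ℝ, ℝ) ∞ (fun y => covec A y (Y y)) x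
  covec_vec : ∀ A B, ∀ x ∈ U, covec A x (vec B x) = if A = B then 1 else 0
  sum_covec_smul_vec : ∀ x ∈ U, ∀ v, ∑ A, covec A x v • vec A x = v

variable (I) in
/-- The curvature `D_Y D_Z W - D_Z D_Y W - D_[Y, Z] W`. -/
def curvField (D : CovariantDerivative I V (TangentSpace I : X → Type _))
    (Y Z W : (x : X) → TangentSpace I x) (x : X) : TangentSpace I x :=
  D (fun y => D W y (Z y)) x (Y x) - D (fun y => D W y (Y y)) x (Z x)
    - D W x (mlieBracket I Y Z x)

namespace SmoothFrame

variable (P : SmoothFrame I ι U)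

/-- The structure functions of the frame: `[X_A, X_B] = struc K A B • X_K`. -/
def struc (K A B : ι) (x : X) : ℝ := P.covec K x (mlieBracket I (P.vec A) (P.vec B) x)

/-- The derivative of a function along a field of the frame. -/
def der (A : ι) (f : X → ℝ) (x : X) : ℝ := dirDeriv I f x (P.vec A x)

/-- The coefficients of a connection: `D_{X_C} X_B = coeff F B C • X_F`. -/
def coeff (D : CovariantDerivative I V (TangentSpace I : X → Type _)) (F B C : ι) (x : X) : ℝ :=
  P.covec F x (D (P.vec B) x (P.vec C x))

/-- The components of the curvature. -/
def curv (D : CovariantDerivative I V (TangentSpace I : X → Type _)) (F A B C : ι) (x : X) : ℝ :=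
  P.covec F x (curvField I D (P.vec C) (P.vec B) (P.vec A) x)

variable {x : X} (hx : x ∈ U)
include hx

theorem vec_ne_zero (A : ι) : P.vec A x ≠ 0 := by
  intro h
  have := P.covec_vec A A x hx
  simp [h] at this

theorem smooth_sum {a : ι → X → ℝ} (ha : ∀ K, ContMDiffAt I 𝓘(ℝ, ℝ) ∞ (a K) x) :
    SmoothFieldAt I (fun y => ∑ K, a K y • P.vec K y) x :=
  ContMDiffAt.sum_section fun K _ => (P.smooth_vec K x hx).fsmul (ha K)

theorem smooth_der {f : X → ℝ} (hf : ContMDiffAt I 𝓘(ℝ, ℝ) ∞ f x) (A : ι) :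
    ContMDiffAt I 𝓘(ℝ, ℝ) ∞ (P.der A f) x :=
  hf.dirDeriv (P.smooth_vec A x hx)

omit [DecidableEq ι] [Fintype ι] [IsManifold I ∞ X] in
theorem der_congr [IsManifold I ∞ X] [Fintype ι] [DecidableEq ι] (P : SmoothFrame I ι U)
    {f g : X → ℝ} (h : ∀ y ∈ U, f y = g y) (A : ι) : P.der A f x = P.der A g x :=
  dirDeriv_congr (Filter.eventuallyEq_of_mem (P.isOpen.mem_nhds hx) h) _

omit hx in
theorem der_neg (f : X → ℝ) (A : ι) : P.der A (fun y => -f y) x = -P.der A f x :=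
  congrArg (fun L : TangentSpace I x →L[ℝ] ℝ => L (P.vec A x)) (mvfderiv_neg (g := f))

theorem dirDeriv_eq_sum (f : X → ℝ) (v : TangentSpace I x) :
    dirDeriv I f x v = ∑ K, P.covec K x v * P.der K f x := by
  conv_lhs => rw [← P.sum_covec_smul_vec x hx v]
  rw [dirDeriv, map_sum]
  exact Finset.sum_congr rfl fun K _ => map_smul (mfderiv I 𝓘(ℝ, ℝ) f x) _ _

theorem cov_eq_sum (D : CovariantDerivative I V (TangentSpace I : X → Type _)) (B : ι)
    (v : TangentSpace I x) (F : ι) :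
    P.covec F x (D (P.vec B) x v) = ∑ C, P.covec C x v * P.coeff D F B C x := by
  conv_lhs => rw [← P.sum_covec_smul_vec x hx v]
  simp [coeff, map_sum]

/-- Additivity and the Leibniz rule of `D` are available for two summands and differentiable data,
so the proof adds the frame fields one at a time. -/
theorem cov_sum_smul (D : CovariantDerivative I V (TangentSpace I : X → Type _))
    {a : ι → X → ℝ} (ha : ∀ K, ContMDiffAt I 𝓘(ℝ, ℝ) ∞ (a K) x) (v : TangentSpace I x) :
    D (fun y => ∑ K, a K y • P.vec K y) x v =
      ∑ K, (a K x • D (P.vec K) x v + dirDeriv I (a K) x v • P.vec K x) := by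
  have main : ∀ s : Finset ι, D (fun y => ∑ K ∈ s, a K y • P.vec K y) x v =
      ∑ K ∈ s, (a K x • D (P.vec K) x v + dirDeriv I (a K) x v • P.vec K x) := by
    intro s
    induction s using Finset.induction_on with
    | empty =>
      simp only [Finset.sum_empty]
      exact congrArg (fun L : TangentSpace I x →L[ℝ] TangentSpace I x => L v)
        (congrFun D.zero x)
    | insert A s hA ih =>
      simp only [Finset.sum_insert hA]
      rw [← ih]
      have hA1 := (P.smooth_vec A x hx)
      have h1 : D (fun y => a A y • P.vec A y + ∑ K ∈ s, a K y • P.vec K y) x =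
          D (fun y => a A y • P.vec A y) x + D (fun y => ∑ K ∈ s, a K y • P.vec K y) x :=
        D.isCovariantDerivativeOnUniv.add (hA1.fsmul (ha A)).mdifferentiableAt
          (SmoothFieldAt.mdifferentiableAt
            (ContMDiffAt.sum_section fun K _ => (P.smooth_vec K x hx).fsmul (ha K)))
      have h2 : D (fun y => a A y • P.vec A y) x = a A x • D (P.vec A) x +
          (mvfderiv I (a A) x).smulRight (P.vec A x) :=
        D.isCovariantDerivativeOnUniv.leibniz hA1.mdifferentiableAt
          ((ha A).mdifferentiableAt (by simp))
      rw [h1, h2]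
      rfl
  exact main Finset.univ

-- Connections are local. This permits replacing a field by its frame expansion, which agrees with
-- it only on `U`.
include P in
theorem cov_congr (D : CovariantDerivative I V (TangentSpace I : X → Type _))
    {Y Z : (x : X) → TangentSpace I x} (hY : SmoothFieldAt I Y x) (hZ : SmoothFieldAt I Z x)
    (h : ∀ y ∈ U, Y y = Z y) : D Y x = D Z x :=
  (D.isCovariantDerivativeOn (s := U)).congr_of_eqOn hY.mdifferentiableAt hZ.mdifferentiableAt
    (P.isOpen.mem_nhds hx) h

theorem covec_cov_of_smooth (D : CovariantDerivative I V (TangentSpace I : X → Type _))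
    {Y : (x : X) → TangentSpace I x} (hY : ∀ y ∈ U, SmoothFieldAt I Y y)
    (v : TangentSpace I x) (F : ι) :
    P.covec F x (D Y x v) = dirDeriv I (fun y => P.covec F y (Y y)) x v +
      ∑ K, P.covec K x (Y x) * P.covec F x (D (P.vec K) x v) := by
  have ha : ∀ K, ContMDiffAt I 𝓘(ℝ, ℝ) ∞ (fun y => P.covec K y (Y y)) x :=
    fun K => P.smooth_covec K Y x hx (hY x hx)
  rw [cov_congr P hx D (hY x hx) (P.smooth_sum hx ha)
    (fun y hy => (P.sum_covec_smul_vec y hy (Y y)).symm), P.cov_sum_smul hx D ha]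
  simp [Finset.sum_add_distrib, P.covec_vec _ _ x hx, add_comm]

variable [CompleteSpace V]

theorem smooth_struc (K A B : ι) : ContMDiffAt I 𝓘(ℝ, ℝ) ∞ (P.struc K A B) x :=
  P.smooth_covec K _ x hx ((P.smooth_vec A x hx).mlieBracket (P.smooth_vec B x hx))

omit hx [CompleteSpace V] in
theorem struc_antisymm (K A B : ι) : P.struc K A B x = -P.struc K B A x := by
  unfold struc
  rw [mlieBracket_swap_apply, map_neg]

/-- The nonvanishing required by `dirDeriv_mlieBracket` is automatic for a field of a frame. -/
theorem der_comm {f : X → ℝ} (hf : ∀ y ∈ U, ContMDiffAt I 𝓘(ℝ, ℝ) ∞ f y) (A B : ι) :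
    P.der A (P.der B f) x - P.der B (P.der A f) x = ∑ K, P.struc K A B x * P.der K f x := by
  refine Eq.trans ?_ (dirDeriv_eq_sum P hx f (mlieBracket I (P.vec A) (P.vec B) x))
  exact (dirDeriv_mlieBracket P.isOpen hf (P.smooth_vec A) (P.smooth_vec B) hx
    (P.vec_ne_zero hx A)).symm

/-- Obtained from the frame expansion of `Y` and the Leibniz rule. It serves to compute the
components of iterated brackets, where `Y` is itself a bracket of frame fields. -/
theorem covec_mlieBracket {Y : (x : X) → TangentSpace I x}
    (hY : ∀ y ∈ U, SmoothFieldAt I Y y) (A F : ι) :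
    P.covec F x (mlieBracket I (P.vec A) Y x) =
      P.der A (fun y => P.covec F y (Y y)) x +
        ∑ K, P.covec K x (Y x) * P.struc F A K x := by
  have ha : ∀ K, ContMDiffAt I 𝓘(ℝ, ℝ) ∞ (fun y => P.covec K y (Y y)) x :=
    fun K => P.smooth_covec K Y x hx (hY x hx)
  have main : ∀ s : Finset ι,
      mlieBracket I (P.vec A) (fun y => ∑ K ∈ s, P.covec K y (Y y) • P.vec K y) x =
      ∑ K ∈ s, (P.der A (fun y => P.covec K y (Y y)) x • P.vec K x +
        P.covec K x (Y x) • mlieBracket I (P.vec A) (P.vec K) x) := by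
    intro s
    induction s using Finset.induction_on with
    | empty =>
      simp only [Finset.sum_empty]
      exact congrFun (mlieBracket_zero_right (I := I) (W := P.vec A)) x
    | insert B s hB ih =>
      simp only [Finset.sum_insert hB]
      rw [← ih]
      have hB1 := (P.smooth_vec B x hx)
      have h1 := mlieBracket_add_right (I := I) (V := P.vec A)
        (hB1.fsmul (ha B)).mdifferentiableAt
          (SmoothFieldAt.mdifferentiableAt (I := I)
            (ContMDiffAt.sum_section (s := s) fun K _ => (P.smooth_vec K x hx).fsmul (ha K)))
      refine h1.trans ?_
      rw [mlieBracket_smul_right_apply (ha B) hB1]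
      rfl
  rw [mlieBracket_congr_of_isOpen (Y' := P.vec A) P.isOpen hx (fun _ _ => rfl)
    (fun y hy => (P.sum_covec_smul_vec y hy (Y y)).symm), main]
  simp [Finset.sum_add_distrib, P.covec_vec _ _ x hx, struc]

/-- The `K`-th component of the Jacobi identity for three frame fields; the derivative terms appear
because the structure functions are not constant. -/
theorem struc_jacobi (A B C K : ι) :
    (P.der C (P.struc K A B) x + ∑ L, P.struc L A B x * P.struc K C L x) +
      (P.der A (P.struc K B C) x + ∑ L, P.struc L B C x * P.struc K A L x) +
      (P.der B (P.struc K C A) x + ∑ L, P.struc L C A x * P.struc K B L x) = 0 := by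
  have J := mlieBracket_jacobi (P.smooth_vec C x hx) (P.smooth_vec A x hx) (P.smooth_vec B x hx)
  rw [mlieBracket_swap_apply (V := mlieBracket I (P.vec C) (P.vec A))] at J
  have J' := congrArg (P.covec K x) J
  have sm : ∀ A B, ∀ y ∈ U, SmoothFieldAt I (mlieBracket I (P.vec A) (P.vec B)) y :=
    fun A B y hy => (P.smooth_vec A y hy).mlieBracket (P.smooth_vec B y hy)
  rw [map_add, map_neg, P.covec_mlieBracket hx (sm A B), P.covec_mlieBracket hx (sm C A),
    P.covec_mlieBracket hx (sm C B)] at J'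
  have e1 : P.der A (P.struc K C B) x = -P.der A (P.struc K B C) x := by
    rw [← P.der_neg, P.der_congr hx (fun y _ => P.struc_antisymm K C B)]
  have e2 : (∑ L, P.struc L C B x * P.struc K A L x) =
      -∑ L, P.struc L B C x * P.struc K A L x := by
    rw [← Finset.sum_neg_distrib]
    exact Finset.sum_congr rfl fun L _ => by rw [P.struc_antisymm L C B, neg_mul]
  change P.der C (P.struc K A B) x + (∑ L, P.struc L A B x * P.struc K C L x) =
    -(P.der B (P.struc K C A) x + ∑ L, P.struc L C A x * P.struc K B L x) +
      (P.der A (P.struc K C B) x + ∑ L, P.struc L C B x * P.struc K A L x) at J'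
  rw [e1, e2] at J'
  linear_combination J'

end SmoothFrame

end Frames

/-! ### The two Bianchi identities for a connection with torsion in a smooth frame. -/

section Bianchi

open VectorField

variable {V : Type*} [NormedAddCommGroup V] [NormedSpace ℝ V] {H : Type*} [TopologicalSpace H]
  {I : ModelWithCorners ℝ V H} {X : Type*} [TopologicalSpace X] [ChartedSpace H X]
  [IsManifold I ∞ X] {ι : Type*} [Fintype ι] [DecidableEq ι] {U : Set X}

namespace SmoothFrame

variable (P : SmoothFrame I ι U) (D : CovariantDerivative I V (TangentSpace I : X → Type _))

/-- The connection maps the fields of the frame to smooth fields. -/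
def SmoothConn : Prop :=
  ∀ A C, ∀ x ∈ U, SmoothFieldAt I (fun y => D (P.vec A) y (P.vec C y)) x

/-- The components of the torsion: `T(X_C, X_B) = tor F B C • X_F`. -/
def tor [FiniteDimensional ℝ V] (F B C : ι) (x : X) : ℝ :=
  P.covec F x (D.torsion x (P.vec C x) (P.vec B x))

/-- The local covariant derivative of a tensor with components `S F B C`. -/
def covD₂ (S : ι → ι → ι → X → ℝ) (F B C G : ι) (x : X) : ℝ :=
  P.der G (S F B C) x + (∑ K, S K B C x * P.coeff D F K G x)
    - (∑ K, S F K C x * P.coeff D K B G x) - ∑ K, S F B K x * P.coeff D K C G x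

/-- The local covariant derivative of a tensor with components `S F A B C`. -/
def covD₃ (S : ι → ι → ι → ι → X → ℝ) (F A B C G : ι) (x : X) : ℝ :=
  P.der G (S F A B C) x + (∑ K, S K A B C x * P.coeff D F K G x)
    - (∑ K, S F K B C x * P.coeff D K A G x) - (∑ K, S F A K C x * P.coeff D K B G x)
    - ∑ K, S F A B K x * P.coeff D K C G x

variable {P D} (hD : P.SmoothConn D) {x : X} (hx : x ∈ U)
include hD hx

theorem SmoothConn.coeff (F B C : ι) : ContMDiffAt I 𝓘(ℝ, ℝ) ∞ (P.coeff D F B C) x :=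
  P.smooth_covec F _ x hx (hD B C x hx)

variable [FiniteDimensional ℝ V]

omit hD in
theorem tor_eq (F B C : ι) : P.tor D F B C x =
    P.coeff D F B C x - P.coeff D F C B x - P.struc F C B x := by
  unfold tor
  rw [D.torsion_apply (P.smooth_vec C x hx).mdifferentiableAt
    (P.smooth_vec B x hx).mdifferentiableAt, map_sub, map_sub]
  rfl

omit [FiniteDimensional ℝ V] in
theorem curv_eq (F A B C : ι) : P.curv D F A B C x =
    P.der C (P.coeff D F A B) x - P.der B (P.coeff D F A C) x
      + (∑ K, P.coeff D K A B x * P.coeff D F K C x)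
      - (∑ K, P.coeff D K A C x * P.coeff D F K B x)
      - ∑ K, P.struc K C B x * P.coeff D F A K x := by
  unfold curv curvField
  rw [map_sub, map_sub, P.covec_cov_of_smooth hx D (hD A B), P.covec_cov_of_smooth hx D (hD A C),
    P.cov_eq_sum hx D A (mlieBracket I (P.vec C) (P.vec B) x) F]
  unfold der coeff struc
  ring

theorem der_tor (F B C G : ι) : P.der G (P.tor D F B C) x =
    P.der G (P.coeff D F B C) x - P.der G (P.coeff D F C B) x - P.der G (P.struc F C B) x := by
  have h : ∀ {f : X → ℝ}, ContMDiffAt I 𝓘(ℝ, ℝ) ∞ f x → MDifferentiableAt I 𝓘(ℝ, ℝ) f x :=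
    fun hf => hf.mdifferentiableAt (by simp)
  have : CompleteSpace V := FiniteDimensional.complete ℝ V
  rw [P.der_congr hx (fun y hy => tor_eq (D := D) hy F B C)]
  unfold der
  rw [dirDeriv_sub_fun ((h (hD.coeff hx F B C)).sub_fun (h (hD.coeff hx F C B)))
    (h (P.smooth_struc hx F C B)),
    dirDeriv_sub_fun (h (hD.coeff hx F B C)) (h (hD.coeff hx F C B))]

-- Differentiability comes together with the value because `der_curv` needs both: the former to
-- split a longer sum, the latter to evaluate its pieces.
omit hD [FiniteDimensional ℝ V] hx in
theorem der_sum_mul {a b : ι → X → ℝ} (ha : ∀ K, ContMDiffAt I 𝓘(ℝ, ℝ) ∞ (a K) x)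
    (hb : ∀ K, ContMDiffAt I 𝓘(ℝ, ℝ) ∞ (b K) x) (G : ι) :
    MDifferentiableAt I 𝓘(ℝ, ℝ) (fun y => ∑ K, a K y * b K y) x ∧
    P.der G (fun y => ∑ K, a K y * b K y) x =
      ∑ K, (P.der G (a K) x * b K x + a K x * P.der G (b K) x) := by
  have h : ∀ {f : X → ℝ}, ContMDiffAt I 𝓘(ℝ, ℝ) ∞ f x → MDifferentiableAt I 𝓘(ℝ, ℝ) f x :=
    fun hf => hf.mdifferentiableAt (by simp)
  have hab : ∀ K, ContMDiffAt I 𝓘(ℝ, ℝ) ∞ (fun y => a K y * b K y) x :=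
    fun K => (ha K).mul (hb K)
  refine ⟨h (contMDiffAt_finsetSum fun K _ => hab K), ?_⟩
  unfold der
  rw [dirDeriv_sum_fun _ fun K _ => h (hab K)]
  exact Finset.sum_congr rfl fun K _ => dirDeriv_mul_fun (h (ha K)) (h (hb K)) _

/-- The formula `curv_eq` holds on all of `U`, so it may be differentiated. This supplies the
hypothesis `hdR` of `second_bianchi_of_jets`. -/
theorem der_curv (F A B C G : ι) : P.der G (P.curv D F A B C) x =
    P.der G (P.der C (P.coeff D F A B)) x - P.der G (P.der B (P.coeff D F A C)) x
      + (∑ K, (P.der G (P.coeff D K A B) x * P.coeff D F K C x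
          + P.coeff D K A B x * P.der G (P.coeff D F K C) x))
      - (∑ K, (P.der G (P.coeff D K A C) x * P.coeff D F K B x
          + P.coeff D K A C x * P.der G (P.coeff D F K B) x))
      - ∑ K, (P.der G (P.struc K C B) x * P.coeff D F A K x
          + P.struc K C B x * P.der G (P.coeff D F A K) x) := by
  have : CompleteSpace V := FiniteDimensional.complete ℝ V
  have h : ∀ {f : X → ℝ}, ContMDiffAt I 𝓘(ℝ, ℝ) ∞ f x → MDifferentiableAt I 𝓘(ℝ, ℝ) f x :=
    fun hf => hf.mdifferentiableAt (by simp)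
  have c := fun F B C => hD.coeff hx F B C
  have s1 := der_sum_mul (P := P) (fun K => c K A B) (fun K => c F K C) G
  have s2 := der_sum_mul (P := P) (fun K => c K A C) (fun K => c F K B) G
  have s3 := der_sum_mul (P := P) (fun K => P.smooth_struc hx K C B) (fun K => c F A K) G
  have d1 := h (P.smooth_der hx (c F A B) C)
  have d2 := h (P.smooth_der hx (c F A C) B)
  rw [P.der_congr hx (fun y hy => curv_eq hD hy F A B C), ← s1.2, ← s2.2, ← s3.2]
  unfold der at *
  rw [dirDeriv_sub_fun (((d1.sub_fun d2).add_fun s1.1).sub_fun s2.1) s3.1,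
    dirDeriv_sub_fun ((d1.sub_fun d2).add_fun s1.1) s2.1, dirDeriv_add_fun (d1.sub_fun d2) s1.1,
    dirDeriv_sub_fun d1 d2]

theorem first_bianchi (F A B C : ι) :
    (P.curv D F A B C x - P.covD₂ D (P.tor D) F A B C x
        - ∑ K, P.tor D K A B x * P.tor D F C K x) +
      (P.curv D F B C A x - P.covD₂ D (P.tor D) F B C A x
        - ∑ K, P.tor D K B C x * P.tor D F A K x) +
      (P.curv D F C A B x - P.covD₂ D (P.tor D) F C A B x
        - ∑ K, P.tor D K C A x * P.tor D F B K x) = 0 := by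
  have : CompleteSpace V := FiniteDimensional.complete ℝ V
  exact first_bianchi_of_jets (fun F B C => P.coeff D F B C x) (fun K A B => P.struc K A B x)
    (fun C F A B => P.der C (P.coeff D F A B) x) (fun C K A B => P.der C (P.struc K A B) x)
    (fun F B C => P.tor D F B C x) (fun F A B C => P.curv D F A B C x)
    (fun C F A B => P.der C (P.tor D F A B) x)
    (fun K A B => P.struc_antisymm K A B) (fun A B C K => P.struc_jacobi hx A B C K)
    (fun F A B => tor_eq hx F A B) (fun C F A B => der_tor hD hx F A B C)
    (fun F A B C => curv_eq hD hx F A B C) F A B C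

theorem second_bianchi (F E A B C : ι) :
    (P.covD₃ D (P.curv D) F E A B C x + ∑ K, P.tor D K A B x * P.curv D F E C K x) +
      (P.covD₃ D (P.curv D) F E B C A x + ∑ K, P.tor D K B C x * P.curv D F E A K x) +
      (P.covD₃ D (P.curv D) F E C A B x + ∑ K, P.tor D K C A x * P.curv D F E B K x) = 0 := by
  have : CompleteSpace V := FiniteDimensional.complete ℝ V
  have key := second_bianchi_of_jets
    -- Rows carry the upper index and columns the index of the differentiated frame field, so the
    -- matrix product is the composition in `curv_eq`. The commutator with `G C` then accounts for
    -- the covariant derivative terms of `F` and `E`.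
    (fun C => Matrix.of fun F A => P.coeff D F A C x)
    (fun B C => Matrix.of fun F A => P.der B (P.coeff D F A C) x)
    (fun A B C => Matrix.of fun F E => P.der A (P.der B (P.coeff D F E C)) x)
    (fun K A B => P.struc K A B x) (fun C K A B => P.der C (P.struc K A B) x)
    (fun K A B => P.tor D K A B x) (fun A B => Matrix.of fun F E => P.curv D F E A B x)
    (fun C A B => Matrix.of fun F E => P.der C (P.curv D F E A B) x)
    (fun K A B => P.struc_antisymm K A B)
    (fun A B C => by
      ext F E
      simp only [Matrix.sub_apply, Matrix.of_apply, Matrix.sum_apply, Matrix.smul_apply,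
        smul_eq_mul]
      exact P.der_comm hx (fun y hy => hD.coeff hy F E C) A B)
    (fun A B C K => P.struc_jacobi hx A B C K)
    (fun F A B => tor_eq hx F A B)
    (fun A B => by
      ext F E
      simp only [Matrix.sub_apply, Matrix.add_apply, Matrix.of_apply, Matrix.sum_apply,
        Matrix.smul_apply, Matrix.mul_apply, smul_eq_mul]
      rw [curv_eq hD hx]
      simp only [mul_comm])
    (fun C A B => by
      ext F E
      simp only [Matrix.sub_apply, Matrix.add_apply, Matrix.of_apply, Matrix.sum_apply,
        Matrix.smul_apply, Matrix.mul_apply, smul_eq_mul]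
      rw [der_curv hD hx]
      simp only [Finset.sum_add_distrib, mul_comm]
      ring) A B C
  have k := congrFun (congrFun key F) E
  simp only [Matrix.sub_apply, Matrix.add_apply, Matrix.of_apply, Matrix.sum_apply,
        Matrix.smul_apply, Matrix.mul_apply, smul_eq_mul, Matrix.zero_apply] at k
  unfold covD₃
  simp only [mul_comm] at k ⊢
  linear_combination k

end SmoothFrame

end Bianchi

/-! ### Differentials of charts and of chart transitions. -/

section Charts

variable {k : ℕ} {X : Type*} [TopologicalSpace X] [ChartedSpace (EuclideanSpace ℝ (Fin k)) X]
  {φ φ' : OpenPartialHomeomorph X (EuclideanSpace ℝ (Fin k))}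
  (hφ : φ ∈ IsManifold.maximalAtlas (𝓡 k) ∞ X) (hφ' : φ' ∈ IsManifold.maximalAtlas (𝓡 k) ∞ X)
  {x : X} (hx : x ∈ φ.source) (hx' : x ∈ φ'.source)
include hφ hx

theorem contMDiffAt_of_mem_maximalAtlas' : ContMDiffAt (𝓡 k) (𝓡 k) ∞ φ x :=
  (contMDiffOn_of_mem_maximalAtlas hφ).contMDiffAt (φ.open_source.mem_nhds hx)

theorem contMDiffAt_symm_of_mem_maximalAtlas' : ContMDiffAt (𝓡 k) (𝓡 k) ∞ φ.symm (φ x) :=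
  (contMDiffOn_symm_of_mem_maximalAtlas hφ).contMDiffAt
    (φ.open_target.mem_nhds (φ.map_source hx))

include hφ' hx'

theorem contDiffAt_chart_transition : ContDiffAt ℝ ∞ (φ' ∘ φ.symm) (φ x) := by
  rw [← contMDiffAt_iff_contDiffAt]
  refine ContMDiffAt.comp (φ x) ?_ (contMDiffAt_symm_of_mem_maximalAtlas' hφ hx)
  rw [φ.left_inv hx]
  exact contMDiffAt_of_mem_maximalAtlas' hφ' hx'

/-- The chain rule for `φ' = (φ' ∘ φ.symm) ∘ φ`, an equality valid near `x`. -/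
theorem mfderiv_chart_eq_comp :
    (mfderiv (𝓡 k) (𝓡 k) φ' x : TangentSpace (𝓡 k) x →L[ℝ] EuclideanSpace ℝ (Fin k)) =
      (fderiv ℝ (φ' ∘ φ.symm) (φ x)).comp
        (mfderiv (𝓡 k) (𝓡 k) φ x : TangentSpace (𝓡 k) x →L[ℝ] EuclideanSpace ℝ (Fin k)) := by
  have h1 : φ' =ᶠ[nhds x] (φ' ∘ φ.symm) ∘ φ := by
    filter_upwards [φ.open_source.mem_nhds hx] with y hy
    simp [φ.left_inv hy]
  rw [h1.mfderiv_eq, mfderiv_comp (I' := 𝓡 k) x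
    (((contDiffAt_chart_transition hφ hφ' hx hx').contMDiffAt).mdifferentiableAt (by simp))
    ((contMDiffAt_of_mem_maximalAtlas' hφ hx).mdifferentiableAt (by simp)), mfderiv_eq_fderiv]
  rfl

omit hφ' hx'

theorem isInvertible_mfderiv_chart :
    (mfderiv (𝓡 k) (𝓡 k) φ x :
      TangentSpace (𝓡 k) x →L[ℝ] EuclideanSpace ℝ (Fin k)).IsInvertible := by
  have h : φ.MDifferentiable (𝓡 k) (𝓡 k) :=
    ⟨(contMDiffOn_of_mem_maximalAtlas hφ).mdifferentiableOn (by simp),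
      (contMDiffOn_symm_of_mem_maximalAtlas hφ).mdifferentiableOn (by simp)⟩
  exact ⟨h.mfderiv hx, rfl⟩

end Charts

/-! ### Induced coordinates as smooth coordinates on `E*`. -/

namespace DualJet

variable {m n : ℕ} {T M : Type*}
  [TopologicalSpace T] [ChartedSpace (EuclideanSpace ℝ (Fin m)) T]
  [TopologicalSpace M] [ChartedSpace (EuclideanSpace ℝ (Fin n)) M]

namespace ChartPair

/-- The change of the induced coordinates. -/
def transition (c c' : ChartPair m n T M) (z : Crd m n) : Crd m n :=
  (((c'.φ ∘ c.φ.symm) z.1.1, (c'.ψ ∘ c.ψ.symm) z.1.2),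
    ((fderiv ℝ (c'.φ ∘ c.φ.symm) z.1.1).comp z.2).comp
      (fderiv ℝ (c.ψ ∘ c'.ψ.symm) ((c'.ψ ∘ c.ψ.symm) z.1.2)))

variable [IsManifold (𝓡 m) ∞ T] [IsManifold (𝓡 n) ∞ M]

theorem isOpen_dom (c : ChartPair m n T M) : IsOpen c.dom := by
  have : c.dom = (TotalSpace.proj : E m n T M → T × M) ⁻¹' (c.φ.source ×ˢ c.ψ.source) := rfl
  rw [this]
  exact (c.φ.open_source.prod c.ψ.open_source).preimage (FiberBundle.continuous_proj _ _)

theorem mem_dom_chartAt (e : E m n T M) : e ∈ (ChartPair.chartAt e).dom :=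
  ⟨mem_chart_source _ e.proj.1, mem_chart_source _ e.proj.2⟩

-- The transformation law of the polymomenta: the matrix is multiplied on the left by `∂t'/∂t` and
-- on the right by `∂x/∂x'`.
omit [IsManifold (𝓡 m) ∞ T] [IsManifold (𝓡 n) ∞ M] in
theorem fibre_eq_transition (c c' : ChartPair m n T M) {e : E m n T M} (he : e ∈ c.dom)
    (he' : e ∈ c'.dom) : c'.fibre e = (transition c c' (c.coord e)).2 := by
  have h1 := mfderiv_chart_eq_comp c.φ_mem c'.φ_mem he.1 he'.1
  have h2 := mfderiv_chart_eq_comp c'.ψ_mem c.ψ_mem he'.2 he.2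
  have i1 := isInvertible_mfderiv_chart c.ψ_mem he.2
  have i2 := isInvertible_mfderiv_chart c'.ψ_mem he'.2
  -- Both sides are tested on a vector `dψ' w`, which is general since `dψ'` is onto; each returns
  -- `w`.
  have h3 : (mfderiv (𝓡 n) (𝓡 n) c'.ψ e.proj.2 :
      TangentSpace (𝓡 n) e.proj.2 →L[ℝ] EuclideanSpace ℝ (Fin n)).inverse =
      (mfderiv (𝓡 n) (𝓡 n) c.ψ e.proj.2 :
        TangentSpace (𝓡 n) e.proj.2 →L[ℝ] EuclideanSpace ℝ (Fin n)).inverse.comp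
        (fderiv ℝ (c.ψ ∘ c'.ψ.symm) (c'.ψ e.proj.2)) := by
    ext1 v
    obtain ⟨w, rfl⟩ := i2.surjective v
    rw [i2.inverse_apply_self]
    have := congrArg (fun L : TangentSpace (𝓡 n) e.proj.2 →L[ℝ] EuclideanSpace ℝ (Fin n) => L w) h2
    refine (i1.inverse_apply_self w).symm.trans ?_
    exact congrArg _ this
  unfold fibre transition
  rw [h1, h3]
  simp only [coord, Function.comp_apply, c.ψ.left_inv he.2]
  rfl

omit [IsManifold (𝓡 m) ∞ T] [IsManifold (𝓡 n) ∞ M] in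
theorem coord_eq_transition (c c' : ChartPair m n T M) {e : E m n T M} (he : e ∈ c.dom)
    (he' : e ∈ c'.dom) : c'.coord e = transition c c' (c.coord e) := by
  refine Prod.ext (Prod.ext ?_ ?_) (fibre_eq_transition c c' he he')
  · simp [coord, transition, c.φ.left_inv he.1]
  · simp [coord, transition, c.ψ.left_inv he.2]

omit [IsManifold (𝓡 m) ∞ T] [IsManifold (𝓡 n) ∞ M] in
theorem contDiffAt_transition (c c' : ChartPair m n T M) {e : E m n T M} (he : e ∈ c.dom)
    (he' : e ∈ c'.dom) : ContDiffAt ℝ ∞ (transition c c') (c.coord e) := by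
  have h1 := contDiffAt_chart_transition c.φ_mem c'.φ_mem he.1 he'.1
  have h2 := contDiffAt_chart_transition c.ψ_mem c'.ψ_mem he.2 he'.2
  have h3 := contDiffAt_chart_transition c'.ψ_mem c.ψ_mem he'.2 he.2
  have p1 : ContDiffAt ℝ ∞ (fun z : Crd m n => z.1.1) (c.coord e) :=
    contDiffAt_fst.fst
  have p2 : ContDiffAt ℝ ∞ (fun z : Crd m n => z.1.2) (c.coord e) :=
    contDiffAt_fst.snd
  have q1 : ContDiffAt ℝ ∞ (fun z : Crd m n => (c'.φ ∘ c.φ.symm) z.1.1) (c.coord e) :=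
    ContDiffAt.comp (c.coord e) (g := c'.φ ∘ c.φ.symm) h1 p1
  have q2 : ContDiffAt ℝ ∞ (fun z : Crd m n => (c'.ψ ∘ c.ψ.symm) z.1.2) (c.coord e) :=
    ContDiffAt.comp (c.coord e) (g := c'.ψ ∘ c.ψ.symm) h2 p2
  have r1 : ContDiffAt ℝ ∞ (fun z : Crd m n => fderiv ℝ (c'.φ ∘ c.φ.symm) z.1.1) (c.coord e) :=
    ContDiffAt.comp (c.coord e) (g := fderiv ℝ (c'.φ ∘ c.φ.symm))
      (h1.fderiv_right (by simp)) p1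
  have r2 : ContDiffAt ℝ ∞ (fun z : Crd m n => fderiv ℝ (c.ψ ∘ c'.ψ.symm)
      ((c'.ψ ∘ c.ψ.symm) z.1.2)) (c.coord e) := by
    refine ContDiffAt.comp (c.coord e) (g := fderiv ℝ (c.ψ ∘ c'.ψ.symm)) ?_ q2
    have : (c'.ψ ∘ c.ψ.symm) (c.coord e).1.2 = c'.ψ e.proj.2 := by
      simp [coord, c.ψ.left_inv he.2]
    rw [this]
    exact h3.fderiv_right (by simp)
  exact (q1.prodMk q2).prodMk ((r1.clm_comp contDiffAt_snd).clm_comp r2)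

/-- Near `e` the coordinates of any chart pair are a smooth transition map applied to the bundle
chart at `e`, by `coord_chartAt`. -/
theorem contMDiffAt_coord (c : ChartPair m n T M) {e : E m n T M} (he : e ∈ c.dom) :
    ContMDiffAt (IJ m n) 𝓘(ℝ, Crd m n) ∞ c.coord e := by
  have h0 : ContMDiffAt (IJ m n) 𝓘(ℝ, Crd m n) ∞ (extChartAt (IJ m n) e) e :=
    contMDiffAt_extChartAt
  have h1 := (contDiffAt_transition (ChartPair.chartAt e) c (mem_dom_chartAt e) he).contMDiffAt
  rw [coord_chartAt e e (mem_dom_chartAt e)] at h1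
  refine (h1.comp e h0).congr_of_eventuallyEq ?_
  filter_upwards [c.isOpen_dom.mem_nhds he,
    (ChartPair.chartAt e).isOpen_dom.mem_nhds (mem_dom_chartAt e)] with y hy hy'
  rw [coord_eq_transition _ c hy' hy, coord_chartAt e y hy']
  rfl

/-- Conversely the bundle chart factors through the induced coordinates. Its differential is
injective, hence so is that of `c.coord`. -/
theorem isInvertible_mfderiv_coord (c : ChartPair m n T M) {e : E m n T M} (he : e ∈ c.dom) :
    (mfderiv (IJ m n) 𝓘(ℝ, Crd m n) c.coord e).IsInvertible := by
  have h0 : (mfderiv (IJ m n) 𝓘(ℝ, Crd m n) (extChartAt (IJ m n) e) e).IsInvertible :=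
    isInvertible_mfderiv_extChartAt (mem_extChartAt_source e)
  have h1 := (contDiffAt_transition c (ChartPair.chartAt e) he (mem_dom_chartAt e)).contMDiffAt
  have ev : extChartAt (IJ m n) e =ᶠ[nhds e] transition c (ChartPair.chartAt e) ∘ c.coord := by
    filter_upwards [c.isOpen_dom.mem_nhds he,
      (ChartPair.chartAt e).isOpen_dom.mem_nhds (mem_dom_chartAt e)] with y hy hy'
    rw [← coord_chartAt e y hy', coord_eq_transition c _ hy hy']
    rfl
  rw [ev.mfderiv_eq, mfderiv_comp (I' := 𝓘(ℝ, Crd m n)) e (h1.mdifferentiableAt (by simp))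
    ((c.contMDiffAt_coord he).mdifferentiableAt (by simp))] at h0
  have inj : Function.Injective (mfderiv (IJ m n) 𝓘(ℝ, Crd m n) c.coord e) :=
    Function.Injective.of_comp h0.injective
  -- By definition the tangent space is the model space, so the differential is an injective
  -- endomorphism of a finite-dimensional space.
  let L : Crd m n →L[ℝ] Crd m n := mfderiv (IJ m n) 𝓘(ℝ, Crd m n) c.coord e
  have : L.IsInvertible :=
    ⟨(LinearEquiv.ofInjectiveEndo (L : Crd m n →ₗ[ℝ] Crd m n) inj).toContinuousLinearEquiv, rfl⟩
  exact this

end ChartPair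

end DualJet

/-! ### Linear combinations of tangent vectors and of vector fields. -/

section TangentVectors

variable {V : Type*} [NormedAddCommGroup V] [NormedSpace ℝ V] {H : Type*} [TopologicalSpace H]
  {I : ModelWithCorners ℝ V H} {X : Type*} [TopologicalSpace X] [ChartedSpace H X]
  {ι κ : Type*} [Fintype ι] [Fintype κ]

theorem dirDeriv_sum_smul (f : X → ℝ) {x : X} (a : ι → ℝ) (v : ι → TangentSpace I x) :
    dirDeriv I f x (∑ A, a A • v A) = ∑ A, a A * dirDeriv I f x (v A) := by
  rw [dirDeriv, map_sum]
  exact Finset.sum_congr rfl fun K _ => map_smul (mfderiv I 𝓘(ℝ, ℝ) f x) _ _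

theorem dirDeriv_sub_sum_sum_smul (f : X → ℝ) {x : X} (v : TangentSpace I x) (a : ι → κ → ℝ)
    (w : ι → κ → TangentSpace I x) :
    dirDeriv I f x (v - ∑ A, ∑ B, a A B • w A B) =
      dirDeriv I f x v - ∑ A, ∑ B, a A B * dirDeriv I f x (w A B) := by
  rw [dirDeriv, map_sub, map_sum]
  refine congrArg _ (Finset.sum_congr rfl fun A _ => ?_)
  exact dirDeriv_sum_smul f (a A) (w A)

theorem SmoothFieldAt.sub_sum_sum_smul [IsManifold I ∞ X] {x : X} {Y : (x : X) → TangentSpace I x}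
    {a : ι → κ → X → ℝ} {W : ι → κ → (x : X) → TangentSpace I x} (hY : SmoothFieldAt I Y x)
    (ha : ∀ A B, ContMDiffAt I 𝓘(ℝ, ℝ) ∞ (a A B) x) (hW : ∀ A B, SmoothFieldAt I (W A B) x) :
    SmoothFieldAt I (fun y => Y y - ∑ A, ∑ B, a A B y • W A B y) x :=
  ContMDiffAt.sub_section hY (ContMDiffAt.sum_section fun A _ =>
    ContMDiffAt.sum_section fun B _ => (hW A B).fsmul (ha A B))

/-- An identity between tangent vectors may be checked after an injective differential, where it
becomes one between known vectors of `W`. It is meant for the coordinate map and the standard basis.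
-/
theorem eq_sum_smul_of_mfderiv {W : Type*} [NormedAddCommGroup W] [NormedSpace ℝ W] {Φ : X → W}
    {x : X} (hΦ : Function.Injective (mfderiv I 𝓘(ℝ, W) Φ x)) (s : ι → W)
    (v : ι → TangentSpace I x) (hv : ∀ A, mfderiv I 𝓘(ℝ, W) Φ x (v A) = s A)
    (a : ι → ℝ) (w : TangentSpace I x) (hw : (mfderiv I 𝓘(ℝ, W) Φ x w : W) = ∑ A, a A • s A) :
    ∑ A, a A • v A = w := by
  apply hΦ
  rw [map_sum]
  refine Eq.trans (Finset.sum_congr rfl fun A _ => ?_) hw.symm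
  rw [map_smul, hv]
  rfl

end TangentVectors

/-! ### The adapted basis and its dual as a smooth frame of `E*`. -/

namespace DualJet

variable {m n : ℕ} {T M : Type*}
  [TopologicalSpace T] [ChartedSpace (EuclideanSpace ℝ (Fin m)) T]
  [TopologicalSpace M] [ChartedSpace (EuclideanSpace ℝ (Fin n)) M]

/-- The linear coordinate functions on the coordinate space, dual to `stdVec`. -/
def stdCovec : Idx m n → Crd m n →L[ℝ] ℝ
  | Sum.inl a => (EuclideanSpace.proj a).comp
      ((ContinuousLinearMap.fst ℝ _ _).comp (ContinuousLinearMap.fst ℝ _ _))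
  | Sum.inr (Sum.inl i) => (EuclideanSpace.proj i).comp
      ((ContinuousLinearMap.snd ℝ _ _).comp (ContinuousLinearMap.fst ℝ _ _))
  | Sum.inr (Sum.inr (a, i)) => (EuclideanSpace.proj a).comp
      ((ContinuousLinearMap.apply ℝ _ (EuclideanSpace.single i (1 : ℝ))).comp
        (ContinuousLinearMap.snd ℝ _ _))

theorem stdCovec_stdVec (A B : Idx m n) : stdCovec A (stdVec B) = if A = B then 1 else 0 := by
  rcases A with a | i | ⟨a, i⟩ <;> rcases B with b | j | ⟨b, j⟩ <;>
    simp [stdCovec, stdVec]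
  rcases eq_or_ne j i with h | h
  · subst h; simp
  · simp [h, h.symm]

theorem sum_stdCovec_smul_stdVec (z : Crd m n) : ∑ A, stdCovec A z • stdVec A = z := by
  simp only [Fintype.sum_sum_type, Fintype.sum_prod_type]
  refine Prod.ext (Prod.ext ?_ ?_) ?_
  · ext a
    simp [stdCovec, stdVec, Prod.fst_sum, Pi.single_apply]
  · ext i
    simp [stdCovec, stdVec, Prod.fst_sum, Prod.snd_sum, Pi.single_apply]
  · refine ContinuousLinearMap.coe_injective
      ((EuclideanSpace.basisFun (Fin n) ℝ).toBasis.ext fun i => ?_)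
    ext a
    simp [stdCovec, stdVec, Prod.snd_sum, Pi.single_apply]

namespace ChartPair

theorem fn_eq (c : ChartPair m n T M) (A : Idx m n) : c.fn A = stdCovec A ∘ c.coord := by
  rcases A with a | i | ⟨a, i⟩ <;> rfl

variable [IsManifold (𝓡 m) ∞ T] [IsManifold (𝓡 n) ∞ M]
variable (c : ChartPair m n T M) {e : E m n T M} (he : e ∈ c.dom)
include he

theorem dir_fn (A : Idx m n) (v : TangentSpace (IJ m n) e) :
    dir (c.fn A) e v = stdCovec A (mfderiv (IJ m n) 𝓘(ℝ, Crd m n) c.coord e v) := by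
  unfold dir
  rw [fn_eq, mfderiv_comp (I' := 𝓘(ℝ, Crd m n)) e
    (stdCovec A).differentiableAt.mdifferentiableAt
    ((c.contMDiffAt_coord he).mdifferentiableAt (by simp)), mfderiv_eq_fderiv,
    ContinuousLinearMap.fderiv]
  rfl

theorem mfderiv_coord_pd (A : Idx m n) :
    mfderiv (IJ m n) 𝓘(ℝ, Crd m n) c.coord e (c.pd A e) = stdVec A :=
  (c.isInvertible_mfderiv_coord he).self_apply_inverse (stdVec A)

theorem dir_fn_pd (A B : Idx m n) : dir (c.fn A) e (c.pd B e) = if A = B then 1 else 0 := by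
  rw [c.dir_fn he, c.mfderiv_coord_pd he, stdCovec_stdVec]

theorem sum_dir_fn_smul_pd (v : TangentSpace (IJ m n) e) :
    ∑ A, dir (c.fn A) e v • c.pd A e = v := by
  simp only [c.dir_fn he]
  exact eq_sum_smul_of_mfderiv (c.isInvertible_mfderiv_coord he).injective stdVec _
    (fun A => c.mfderiv_coord_pd he A) _ v (sum_stdCovec_smul_stdVec _).symm

theorem contMDiffAt_fn (A : Idx m n) : ContMDiffAt (IJ m n) 𝓘(ℝ, ℝ) ∞ (c.fn A) e := by
  rw [fn_eq]
  exact (stdCovec A).contDiff.contMDiff.contMDiffAt.comp e (c.contMDiffAt_coord he)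

theorem smoothFieldAt_pd (A : Idx m n) : SmoothFieldAt (IJ m n) (c.pd A) e := by
  refine ContMDiffAt.mpullback_vectorField_preimage (n := ∞) ?_ (c.contMDiffAt_coord he)
    (c.isInvertible_mfderiv_coord he) (by simp)
  exact contMDiffAt_vectorSpace_iff_contDiffAt.2 contDiffAt_const

end ChartPair

variable [IsManifold (𝓡 m) ∞ T] [IsManifold (𝓡 n) ∞ M]

/-- The adapted coframe as a family of continuous linear forms. -/
def covector (N : NonlinearConnection m n T M) (c : ChartPair m n T M) :
    Idx m n → (e : E m n T M) → TangentSpace (IJ m n) e →L[ℝ] ℝ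
  | Sum.inl a => fun e => mvfderiv (IJ m n) (c.fn (tI a)) e
  | Sum.inr (Sum.inl i) => fun e => mvfderiv (IJ m n) (c.fn (xI i)) e
  | Sum.inr (Sum.inr (a, i)) => fun e =>
      mvfderiv (IJ m n) (c.fn (vI a i)) e
        + (∑ b, N.N₁ c a i b e • mvfderiv (IJ m n) (c.fn (tI b)) e)
        + ∑ j, N.N₂ c a i j e • mvfderiv (IJ m n) (c.fn (xI j)) e

theorem covector_apply (N : NonlinearConnection m n T M) (c : ChartPair m n T M) (A : Idx m n)
    (e : E m n T M) (v : TangentSpace (IJ m n) e) : covector N c A e v = coframe N c A e v := by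
  rcases A with a | i | ⟨a, i⟩
  · rfl
  · rfl
  · simp only [covector, add_apply, sum_apply,
      smul_apply, smul_eq_mul]
    rfl

variable (N : NonlinearConnection m n T M) (c : ChartPair m n T M)

theorem dir_frame_tI (f : E m n T M → ℝ) (e : E m n T M) (a : Fin m) :
    dir f e (frame N c (tI a) e) = dir f e (c.pd (tI a) e) -
      ∑ b, ∑ j, N.N₁ c b j a e * dir f e (c.pd (vI b j) e) :=
  dirDeriv_sub_sum_sum_smul f _ _ _

theorem dir_frame_xI (f : E m n T M → ℝ) (e : E m n T M) (i : Fin n) :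
    dir f e (frame N c (xI i) e) = dir f e (c.pd (xI i) e) -
      ∑ b, ∑ j, N.N₂ c b j i e * dir f e (c.pd (vI b j) e) :=
  dirDeriv_sub_sum_sum_smul f _ _ _

theorem dir_frame_vI (f : E m n T M → ℝ) (e : E m n T M) (a : Fin m) (i : Fin n) :
    dir f e (frame N c (vI a i) e) = dir f e (c.pd (vI a i) e) := rfl

variable {e : E m n T M} (he : e ∈ c.dom)
include he

/-- What the nonlinear connection subtracts from `∂/∂t^a` and `∂/∂x^i` is what it adds to `dp_i^a`.
-/
theorem coframe_frame (A B : Idx m n) :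
    coframe N c A e (frame N c B e) = if A = B then 1 else 0 := by
  rcases A with a | i | ⟨a, i⟩ <;> rcases B with b | j | ⟨b, j⟩ <;>
    simp [coframe, dir_frame_tI, dir_frame_xI, dir_frame_vI, c.dir_fn_pd he, ite_and]

theorem sum_coframe_smul_frame (v : TangentSpace (IJ m n) e) :
    ∑ A, coframe N c A e v • frame N c A e = v := by
  -- Both vectors are expanded in the coordinate basis and compared coordinate by coordinate; the
  -- terms with `N.N₁` and `N.N₂` affect only the vertical ones and cancel there.
  refine (c.sum_dir_fn_smul_pd he _).symm.trans (Eq.trans ?_ (c.sum_dir_fn_smul_pd he v))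
  refine Finset.sum_congr rfl fun B _ => congrArg (· • _) ?_
  refine (dirDeriv_sum_smul (c.fn B) _ _).trans ?_
  change ∑ A, coframe N c A e v * dir (c.fn B) e (frame N c A e) = _
  rcases B with b | j | ⟨b, j⟩ <;>
    simp [coframe, Fintype.sum_sum_type, Fintype.sum_prod_type, dir_frame_tI,
      dir_frame_xI, dir_frame_vI, c.dir_fn_pd he, ite_and, mul_comm]

theorem contMDiffAt_N₁ (a : Fin m) (i : Fin n) (b : Fin m) :
    ContMDiffAt (IJ m n) 𝓘(ℝ, ℝ) ∞ (N.N₁ c a i b) e :=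
  (N.smooth₁ c a i b).contMDiffAt (c.isOpen_dom.mem_nhds he)

theorem contMDiffAt_N₂ (a : Fin m) (i j : Fin n) :
    ContMDiffAt (IJ m n) 𝓘(ℝ, ℝ) ∞ (N.N₂ c a i j) e :=
  (N.smooth₂ c a i j).contMDiffAt (c.isOpen_dom.mem_nhds he)

theorem smoothFieldAt_frame (A : Idx m n) : SmoothFieldAt (IJ m n) (frame N c A) e := by
  rcases A with a | i | ⟨a, i⟩
  · exact SmoothFieldAt.sub_sum_sum_smul (c.smoothFieldAt_pd he (tI a))
      (fun b j => contMDiffAt_N₁ N c he b j a) (fun b j => c.smoothFieldAt_pd he (vI b j))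
  · exact SmoothFieldAt.sub_sum_sum_smul (c.smoothFieldAt_pd he (xI i))
      (fun b j => contMDiffAt_N₂ N c he b j i) (fun b j => c.smoothFieldAt_pd he (vI b j))
  · exact c.smoothFieldAt_pd he (vI a i)

theorem contMDiffAt_coframe (A : Idx m n) {Y : (e : E m n T M) → TangentSpace (IJ m n) e}
    (hY : SmoothFieldAt (IJ m n) Y e) :
    ContMDiffAt (IJ m n) 𝓘(ℝ, ℝ) ∞ (fun y => coframe N c A y (Y y)) e := by
  have hd : ∀ A, ContMDiffAt (IJ m n) 𝓘(ℝ, ℝ) ∞ (fun y => dir (c.fn A) y (Y y)) e :=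
    fun A => (c.contMDiffAt_fn he A).dirDeriv hY
  rcases A with a | i | ⟨a, i⟩
  · exact hd (tI a)
  · exact hd (xI i)
  · exact ((hd (vI a i)).add (contMDiffAt_finsetSum fun b _ =>
      (contMDiffAt_N₁ N c he a i b).mul (hd (tI b)))).add (contMDiffAt_finsetSum fun j _ =>
      (contMDiffAt_N₂ N c he a i j).mul (hd (xI j)))

omit he

/-- The adapted frame with its dual coframe. -/
def adapted : SmoothFrame (IJ m n) (Idx m n) c.dom where
  vec := frame N c
  covec := covector N c
  isOpen := c.isOpen_dom
  smooth_vec := fun A _ he => smoothFieldAt_frame N c he A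
  smooth_covec := fun A Y e he hY => by
    simp only [covector_apply]
    exact contMDiffAt_coframe N c he A hY
  covec_vec := fun A B e he => by
    rw [covector_apply]
    exact coframe_frame N c he A B
  sum_covec_smul_vec := fun e he v => by
    simp only [covector_apply]
    exact sum_coframe_smul_frame N c he v

theorem adapted_covec (A : Idx m n) (e : E m n T M) (v : TangentSpace (IJ m n) e) :
    (adapted N c).covec A e v = coframe N c A e v := covector_apply N c A e v

variable (D : LinearConnection m n T M)

theorem adapted_coeff : (adapted N c).coeff D = conn N D c := by
  funext F B C e
  exact adapted_covec N c F e _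

theorem adapted_tor : (adapted N c).tor D = torsion N D c := by
  funext F B C e
  exact adapted_covec N c F e _

theorem adapted_curv : (adapted N c).curv D = curvature N D c := by
  funext F A B C e
  exact adapted_covec N c F e _

theorem adapted_covD₂ : (adapted N c).covD₂ D = covDeriv₂ N D c := by
  funext S F B C G e
  unfold SmoothFrame.covD₂ covDeriv₂
  rw [adapted_coeff]
  rfl

theorem adapted_covD₃ : (adapted N c).covD₃ D = covDeriv₃ N D c := by
  funext S F A B C G e
  unfold SmoothFrame.covD₃ covDeriv₃
  rw [adapted_coeff]
  rfl

-- The form in which smoothness of `D` enters all later computations: it makes the adapted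
-- components of `D` smooth on the coordinate domain.
variable {D} in
theorem adapted_smoothConn (hD : IsSmooth D) : (adapted N c).SmoothConn D := by
  intro A C e he
  have h1 := (hD c.dom c.isOpen_dom).contMDiff (σ := frame N c A)
    (fun y hy => (smoothFieldAt_frame N c hy A).contMDiffWithinAt)
  exact ContMDiffAt.clm_bundle_apply (h1.contMDiffAt (c.isOpen_dom.mem_nhds he))
    (smoothFieldAt_frame N c he C)

end DualJet

namespace DualJet

variable {m n : ℕ} {T M : Type*}
  [TopologicalSpace T] [ChartedSpace (EuclideanSpace ℝ (Fin m)) T] [IsManifold (𝓡 m) ∞ T]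
  [TopologicalSpace M] [ChartedSpace (EuclideanSpace ℝ (Fin n)) M] [IsManifold (𝓡 n) ∞ M]

/-! ## Functions of the temporal coordinates -/

/-- A smooth local section of `E* → T` through `e`: in the bundle chart at `e` the temporal
coordinates vary while `x` and `p` keep their values at `e`. -/
theorem exists_local_section (e : E m n T M) :
    ∃ κ : T → Crd m n, ContMDiffAt (𝓡 m) 𝓘(ℝ, Crd m n) ∞ κ e.proj.1 ∧
      κ e.proj.1 = extChartAt (IJ m n) e e ∧
      ∀ᶠ y : E m n T M in nhds e,
        ((extChartAt (IJ m n) e).symm (κ y.proj.1)).proj.1 = y.proj.1 := by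
  let z := extChartAt (IJ m n) e e
  let χ := _root_.chartAt (EuclideanSpace ℝ (Fin m)) e.proj.1
  let κ : T → Crd m n := fun t => ((χ t, z.1.2), z.2)
  have hκe : κ e.proj.1 = z := by
    have h : (ChartPair.chartAt e).coord e = z :=
      ChartPair.coord_chartAt e e (ChartPair.mem_dom_chartAt e)
    have h2 : χ e.proj.1 = z.1.1 := congrArg (fun w : Crd m n => w.1.1) h
    simp only [κ, h2]
  have hχ : ContMDiffAt (𝓡 m) (𝓡 m) ∞ χ e.proj.1 :=
    contMDiffAt_of_mem_maximalAtlas (IsManifold.chart_mem_maximalAtlas _) (mem_chart_source _ _)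
  have hκ : ContMDiffAt (𝓡 m) 𝓘(ℝ, Crd m n) ∞ κ e.proj.1 :=
    (hχ.prodMk_space contMDiffAt_const).prodMk_space contMDiffAt_const
  refine ⟨κ, hκ, hκe, ?_⟩
  have hp : ContinuousAt (fun y : E m n T M => y.proj.1) e :=
    continuous_fst.continuousAt.comp (FiberBundle.continuous_proj _ _).continuousAt
  have hκy : ContinuousAt (fun y : E m n T M => κ y.proj.1) e :=
    ContinuousAt.comp (f := fun y : E m n T M => y.proj.1) hκ.continuousAt hp
  have htar : ∀ᶠ y : E m n T M in nhds e, κ y.proj.1 ∈ (extChartAt (IJ m n) e).target := by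
    refine hκy.eventually ?_
    beta_reduce
    rw [hκe]
    exact extChartAt_target_mem_nhds e
  have hs : ContinuousAt (fun y : E m n T M => (extChartAt (IJ m n) e).symm (κ y.proj.1)) e := by
    refine ContinuousAt.comp (g := (extChartAt (IJ m n) e).symm) ?_ hκy
    rw [hκe]
    exact continuousAt_extChartAt_symm e
  have hdom : ∀ᶠ y : E m n T M in nhds e,
      (extChartAt (IJ m n) e).symm (κ y.proj.1) ∈ (ChartPair.chartAt e).dom := by
    refine hs.eventually ?_
    beta_reduce
    rw [hκe, extChartAt_to_inv]
    exact (ChartPair.isOpen_dom _).mem_nhds (ChartPair.mem_dom_chartAt e)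
  filter_upwards [htar, hdom, (ChartPair.isOpen_dom _).mem_nhds (ChartPair.mem_dom_chartAt e)]
    with y h1 h2 h3
  have h4 := ChartPair.coord_chartAt e _ h2
  rw [(extChartAt (IJ m n) e).right_inv h1] at h4
  -- Both points of `T` lie in the domain of the chart `χ` and have the same coordinates there.
  exact χ.injOn h2.1 h3.1 (congrArg (fun w : Crd m n => w.1.1) h4)

/-- Composing `f` with a local section over `T` exhibits it near `e` as a smooth function `g` of the
coordinates `t^a` alone, so its differential factors through the forms `dt^a`. -/
theorem dir_of_temporal (c : ChartPair m n T M) {e : E m n T M} (he : e ∈ c.dom)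
    {f : E m n T M → ℝ} (hf : ContMDiffAt (IJ m n) 𝓘(ℝ, ℝ) ∞ f e)
    (hT : ∀ y y' : E m n T M, y.proj.1 = y'.proj.1 → f y = f y')
    {v : TangentSpace (IJ m n) e} (hv : ∀ a, dir (c.fn (tI a)) e v = 0) : dir f e v = 0 := by
  obtain ⟨κ, hκ, hκe, hsec⟩ := exists_local_section e
  let u : E m n T M → EuclideanSpace ℝ (Fin m) := fun y => (c.coord y).1.1
  let g : EuclideanSpace ℝ (Fin m) → ℝ :=
    fun w => f ((extChartAt (IJ m n) e).symm (κ (c.φ.symm w)))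
  have hu : ContMDiffAt (IJ m n) (𝓡 m) ∞ u e :=
    (contDiffAt_fst.fst).contMDiffAt.comp e (c.contMDiffAt_coord he)
  have hue : c.φ.symm (u e) = e.proj.1 := c.φ.left_inv he.1
  have hg : ContMDiffAt (𝓡 m) 𝓘(ℝ, ℝ) ∞ g (u e) := by
    have h1 : ContMDiffAt (𝓡 m) (𝓡 m) ∞ c.φ.symm (u e) :=
      contMDiffAt_symm_of_mem_maximalAtlas c.φ_mem (c.φ.map_source he.1)
    have h2 : ContMDiffAt (𝓡 m) 𝓘(ℝ, Crd m n) ∞ (fun w => κ (c.φ.symm w)) (u e) :=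
      ContMDiffAt.comp (g := κ) (u e) (by rw [hue]; exact hκ) h1
    have h3 : ContMDiffAt 𝓘(ℝ, Crd m n) (IJ m n) ∞ (extChartAt (IJ m n) e).symm
        (κ (c.φ.symm (u e))) := by
      rw [hue, hκe]
      exact (contMDiffOn_extChartAt_symm e).contMDiffAt (extChartAt_target_mem_nhds e)
    have h4 := ContMDiffAt.comp (u e) h3 h2
    refine ContMDiffAt.comp (g := f) (u e) ?_ h4
    rw [hue, hκe, extChartAt_to_inv]
    exact hf
  have hfg : f =ᶠ[nhds e] g ∘ u := by
    filter_upwards [hsec, c.isOpen_dom.mem_nhds he] with y hy hy'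
    refine hT _ _ ?_
    have : c.φ.symm (u y) = y.proj.1 := c.φ.left_inv hy'.1
    rw [this]
    exact hy.symm
  have hduv : mfderiv (IJ m n) (𝓡 m) u e v = (0 : EuclideanSpace ℝ (Fin m)) := by
    refine PiLp.ext fun a => ?_
    refine Eq.trans ?_ (hv a)
    have : c.fn (tI a) = (EuclideanSpace.proj a : EuclideanSpace ℝ (Fin m) →L[ℝ] ℝ) ∘ u := rfl
    rw [dir, this, mfderiv_comp (I' := 𝓡 m) e
      (EuclideanSpace.proj a : EuclideanSpace ℝ (Fin m) →L[ℝ] ℝ).differentiableAt.mdifferentiableAt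
      (hu.mdifferentiableAt (by simp)), mfderiv_eq_fderiv, ContinuousLinearMap.fderiv]
    rfl
  rw [dir, hfg.mfderiv_eq, mfderiv_comp (I' := 𝓡 m) e (hg.mdifferentiableAt (by simp))
      (hu.mdifferentiableAt (by simp))]
  refine (congrArg (mfderiv (𝓡 m) 𝓘(ℝ, ℝ) g (u e)) hduv).trans ?_
  exact map_zero _

end DualJet

/-! ### Pointwise algebra: the thirty identities from the vanishing components. -/

namespace DualJet

variable {m n : ℕ}

/-- The type of an index: temporal, spatial or vertical. -/
def kind : Idx m n → Fin 3
  | Sum.inl _ => 0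
  | Sum.inr (Sum.inl _) => 1
  | Sum.inr (Sum.inr _) => 2

/-- The values at a point of the torsion, the curvature and their local covariant derivatives,
for an `h`-normal connection of Cartan type, and the Bianchi identities between them. -/
structure BianchiData (tor : Idx m n → Idx m n → Idx m n → ℝ)
    (dTor cur : Idx m n → Idx m n → Idx m n → Idx m n → ℝ)
    (dCur : Idx m n → Idx m n → Idx m n → Idx m n → Idx m n → ℝ)
    (cv : Fin n → Fin n → Fin m → Fin n → ℝ) (dCv : Fin n → Fin n → Fin m → Fin n → Idx m n → ℝ)
    (chi : Fin m → Fin m → Fin m → Fin m → ℝ)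
    (dChi : Fin m → Fin m → Fin m → Fin m → Idx m n → ℝ) : Prop where
  tor_antisymm : ∀ F B C, tor F B C = -tor F C B
  dTor_antisymm : ∀ F B C G, dTor F B C G = -dTor F C B G
  cur_antisymm : ∀ F A B C, cur F A B C = -cur F A C B
  dCur_antisymm : ∀ F A B C G, dCur F A B C G = -dCur F A C B G
  tor_t : ∀ d B C, tor (tI d) B C = 0
  tor_x_tt : ∀ l a b, tor (xI l) (tI a) (tI b) = 0
  tor_x_tv : ∀ l a f r, tor (xI l) (tI a) (vI f r) = 0
  tor_x_xx : ∀ l i j, tor (xI l) (xI i) (xI j) = 0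
  tor_x_vv : ∀ l f r g s, tor (xI l) (vI f r) (vI g s) = 0
  tor_x_xv : ∀ l k f r, tor (xI l) (xI k) (vI f r) = cv l k f r
  dTor_t : ∀ d B C G, dTor (tI d) B C G = 0
  dTor_x_tt : ∀ l a b G, dTor (xI l) (tI a) (tI b) G = 0
  dTor_x_tv : ∀ l a f r G, dTor (xI l) (tI a) (vI f r) G = 0
  dTor_x_xx : ∀ l i j G, dTor (xI l) (xI i) (xI j) G = 0
  dTor_x_vv : ∀ l f r g s G, dTor (xI l) (vI f r) (vI g s) G = 0
  dTor_x_xv : ∀ l k f r G, dTor (xI l) (xI k) (vI f r) G = dCv l k f r G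
  cur_eq_zero : ∀ F A B C, kind F ≠ kind A → cur F A B C = 0
  cur_tt_x : ∀ d a B i, cur (tI d) (tI a) B (xI i) = 0
  cur_tt_v : ∀ d a B f r, cur (tI d) (tI a) B (vI f r) = 0
  cur_tt_tt : ∀ d a b g, cur (tI d) (tI a) (tI b) (tI g) = chi d a b g
  dCur_tt_x : ∀ d a B i G, dCur (tI d) (tI a) B (xI i) G = 0
  dCur_tt_v : ∀ d a B f r G, dCur (tI d) (tI a) B (vI f r) G = 0
  dCur_tt_tt : ∀ d a b g G, dCur (tI d) (tI a) (tI b) (tI g) G = dChi d a b g G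
  first : ∀ F A B C,
    (cur F A B C - dTor F A B C - ∑ K, tor K A B * tor F C K) +
      (cur F B C A - dTor F B C A - ∑ K, tor K B C * tor F A K) +
      (cur F C A B - dTor F C A B - ∑ K, tor K C A * tor F B K) = 0
  second : ∀ F E A B C,
    (dCur F E A B C + ∑ K, tor K A B * cur F E C K) +
      (dCur F E B C A + ∑ K, tor K B C * cur F E A K) +
      (dCur F E C A B + ∑ K, tor K C A * cur F E B K) = 0

namespace BianchiData

variable {tor : Idx m n → Idx m n → Idx m n → ℝ}
    {dTor cur : Idx m n → Idx m n → Idx m n → Idx m n → ℝ}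
    {dCur : Idx m n → Idx m n → Idx m n → Idx m n → Idx m n → ℝ}
    {cv : Fin n → Fin n → Fin m → Fin n → ℝ} {dCv : Fin n → Fin n → Fin m → Fin n → Idx m n → ℝ}
    {chi : Fin m → Fin m → Fin m → Fin m → ℝ}
    {dChi : Fin m → Fin m → Fin m → Fin m → Idx m n → ℝ}
    (hB : BianchiData tor dTor cur dCur cv dCv chi dChi)
include hB

/-- This and the next rules sort form indices of different types into the order temporal, spatial,
vertical. Being restricted to types in the wrong order, they can be used by `simp` without looping,
unlike plain antisymmetry. -/
theorem tor_xt (F : Idx m n) (i : Fin n) (a : Fin m) :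
    tor F (xI i) (tI a) = -tor F (tI a) (xI i) := hB.tor_antisymm _ _ _

theorem tor_vt (F : Idx m n) (f : Fin m) (r : Fin n) (a : Fin m) :
    tor F (vI f r) (tI a) = -tor F (tI a) (vI f r) := hB.tor_antisymm _ _ _

theorem tor_vx (F : Idx m n) (f : Fin m) (r : Fin n) (i : Fin n) :
    tor F (vI f r) (xI i) = -tor F (xI i) (vI f r) := hB.tor_antisymm _ _ _

theorem dTor_xt (F : Idx m n) (i : Fin n) (a : Fin m) (G : Idx m n) :
    dTor F (xI i) (tI a) G = -dTor F (tI a) (xI i) G := hB.dTor_antisymm _ _ _ _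

theorem dTor_vt (F : Idx m n) (f : Fin m) (r : Fin n) (a : Fin m) (G : Idx m n) :
    dTor F (vI f r) (tI a) G = -dTor F (tI a) (vI f r) G := hB.dTor_antisymm _ _ _ _

theorem dTor_vx (F : Idx m n) (f : Fin m) (r : Fin n) (i : Fin n) (G : Idx m n) :
    dTor F (vI f r) (xI i) G = -dTor F (xI i) (vI f r) G := hB.dTor_antisymm _ _ _ _

theorem cur_xt (F E : Idx m n) (i : Fin n) (a : Fin m) :
    cur F E (xI i) (tI a) = -cur F E (tI a) (xI i) := hB.cur_antisymm _ _ _ _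

theorem cur_vt (F E : Idx m n) (f : Fin m) (r : Fin n) (a : Fin m) :
    cur F E (vI f r) (tI a) = -cur F E (tI a) (vI f r) := hB.cur_antisymm _ _ _ _

theorem cur_vx (F E : Idx m n) (f : Fin m) (r : Fin n) (i : Fin n) :
    cur F E (vI f r) (xI i) = -cur F E (xI i) (vI f r) := hB.cur_antisymm _ _ _ _

theorem dCur_xt (F E : Idx m n) (i : Fin n) (a : Fin m) (G : Idx m n) :
    dCur F E (xI i) (tI a) G = -dCur F E (tI a) (xI i) G := hB.dCur_antisymm _ _ _ _ _

theorem dCur_vt (F E : Idx m n) (f : Fin m) (r : Fin n) (a : Fin m) (G : Idx m n) :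
    dCur F E (vI f r) (tI a) G = -dCur F E (tI a) (vI f r) G := hB.dCur_antisymm _ _ _ _ _

theorem dCur_vx (F E : Idx m n) (f : Fin m) (r : Fin n) (i : Fin n) (G : Idx m n) :
    dCur F E (vI f r) (xI i) G = -dCur F E (xI i) (vI f r) G := hB.dCur_antisymm _ _ _ _ _

theorem cur_x_t (d : Fin m) (i : Fin n) (B C : Idx m n) : cur (xI i) (tI d) B C = 0 :=
  hB.cur_eq_zero _ _ _ _ (by simp [kind])

theorem cur_x_v (f : Fin m) (i j : Fin n) (B C : Idx m n) : cur (xI i) (vI f j) B C = 0 :=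
  hB.cur_eq_zero _ _ _ _ (by simp [kind])

theorem cur_v_t (d f : Fin m) (i : Fin n) (B C : Idx m n) : cur (vI f i) (tI d) B C = 0 :=
  hB.cur_eq_zero _ _ _ _ (by simp [kind])

theorem cur_v_x (f : Fin m) (i j : Fin n) (B C : Idx m n) : cur (vI f i) (xI j) B C = 0 :=
  hB.cur_eq_zero _ _ _ _ (by simp [kind])

/-! ### Consequences of the first Bianchi identity, by the types of the indices -/

/-- Here as in the following lemmas the types of the free indices are fixed, the sum over `K` falls
into its temporal, spatial and vertical blocks, and the rules of `BianchiData` remove the blocks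
that vanish. In this case every torsion term disappears. -/
theorem first_t_ttt (a b g d : Fin m) :
    cyc (fun a b g => chi d a b g) a b g = 0 := by
  have h := hB.first (tI d) (tI a) (tI b) (tI g)
  simp only [cyc, hB.tor_t, hB.dTor_t, hB.cur_tt_tt, hB.tor_antisymm _ (tI g) (tI a), zero_mul, mul_neg,
    neg_zero, Finset.sum_const_zero, mul_comm] at h ⊢
  linear_combination h

/-- The spatial block of the sum gives the products of two mixed torsions, the vertical block the
contraction of `cv` with the vertical torsion. -/
theorem first_x_xtt (a b : Fin m) (k l : Fin n) :
    alt (fun a b => (∑ r, tor (xI l) (tI a) (xI r) * tor (xI r) (tI b) (xI k))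
      - dTor (xI l) (tI a) (xI k) (tI b)) a b
    = cur (xI l) (xI k) (tI a) (tI b)
      - ∑ f, ∑ r, cv l k f r * tor (vI f r) (tI a) (tI b) := by
  have h := hB.first (xI l) (xI k) (tI a) (tI b)
  simp only [alt, Fintype.sum_sum_type, Fintype.sum_prod_type, hB.tor_t, hB.tor_x_tt, hB.tor_x_tv,
    hB.tor_x_xx, hB.tor_x_xv, hB.dTor_x_tt, hB.cur_x_t, hB.tor_xt, hB.dTor_xt, mul_zero,
    zero_mul, neg_mul, mul_neg, neg_zero, Finset.sum_const_zero, Finset.sum_neg_distrib,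
    mul_comm] at h ⊢
  linear_combination -h

theorem first_x_txx (a : Fin m) (j k l : Fin n) :
    alt (fun j k => (∑ f, ∑ r, cv l k f r * tor (vI f r) (tI a) (xI j))
      + cur (xI l) (xI j) (tI a) (xI k) + dTor (xI l) (tI a) (xI j) (xI k)) j k = 0 := by
  have h := hB.first (xI l) (tI a) (xI j) (xI k)
  simp only [alt, Fintype.sum_sum_type, Fintype.sum_prod_type, hB.tor_t, hB.tor_x_tt, hB.tor_x_tv,
    hB.tor_x_xx, hB.tor_x_xv, hB.dTor_x_xx, hB.cur_x_t, hB.tor_xt, hB.dTor_xt, hB.cur_xt,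
    mul_zero, zero_mul, neg_mul, mul_neg, neg_zero, Finset.sum_const_zero,
    Finset.sum_neg_distrib, mul_comm] at h ⊢
  linear_combination -h

theorem first_x_xxx (i j k l : Fin n) :
    cyc (fun i j k => (∑ f, ∑ r, cv l k f r * tor (vI f r) (xI i) (xI j))
      - cur (xI l) (xI i) (xI j) (xI k)) i j k = 0 := by
  have h := hB.first (xI l) (xI i) (xI j) (xI k)
  simp only [cyc, Fintype.sum_sum_type, Fintype.sum_prod_type, hB.tor_t, hB.tor_x_xx, hB.tor_x_xv,
    hB.dTor_x_xx, hB.tor_xt, hB.tor_antisymm _ (xI k) (xI i),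
    hB.cur_antisymm _ _ (xI k) (xI i), mul_zero, zero_mul, neg_mul, mul_neg, neg_zero,
    Finset.sum_const_zero, Finset.sum_neg_distrib, mul_comm] at h ⊢
  linear_combination -h

theorem first_v_ttt (a b g d : Fin m) (l : Fin n) :
    cyc (fun a b g => dTor (vI d l) (tI a) (tI b) (tI g)
      + ∑ f, ∑ r, tor (vI d l) (tI g) (vI f r) * tor (vI f r) (tI a) (tI b)) a b g = 0 := by
  have h := hB.first (vI d l) (tI a) (tI b) (tI g)
  simp only [cyc, Fintype.sum_sum_type, Fintype.sum_prod_type, hB.tor_t, hB.tor_x_tt, hB.cur_v_t,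
    hB.tor_antisymm _ (tI g) (tI a), hB.dTor_antisymm _ (tI g) (tI a) _, zero_mul, neg_mul,
    mul_neg, Finset.sum_const_zero, Finset.sum_neg_distrib, mul_comm] at h ⊢
  linear_combination -h

theorem first_v_ttx (a b d : Fin m) (k l : Fin n) :
    alt (fun a b => dTor (vI d l) (tI a) (xI k) (tI b)
      + (∑ f, ∑ r, tor (vI d l) (tI b) (vI f r) * tor (vI f r) (tI a) (xI k))
      + ∑ r, tor (vI d l) (tI b) (xI r) * tor (xI r) (tI a) (xI k)) a b
    = dTor (vI d l) (tI a) (tI b) (xI k)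
      + ∑ f, ∑ r, tor (vI d l) (xI k) (vI f r) * tor (vI f r) (tI a) (tI b) := by
  have h := hB.first (vI d l) (tI a) (tI b) (xI k)
  simp only [alt, Fintype.sum_sum_type, Fintype.sum_prod_type, hB.tor_t, hB.tor_x_tt, hB.cur_v_t,
    hB.cur_v_x, hB.tor_xt, hB.dTor_xt, zero_mul, neg_mul, mul_neg, neg_zero,
    Finset.sum_const_zero, Finset.sum_neg_distrib, mul_comm] at h ⊢
  linear_combination h

theorem first_v_txx (a d : Fin m) (j k l : Fin n) :
    alt (fun j k => dTor (vI d l) (tI a) (xI j) (xI k)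
      + (∑ f, ∑ r, tor (vI d l) (xI k) (vI f r) * tor (vI f r) (tI a) (xI j))
      + ∑ r, tor (vI d l) (xI k) (xI r) * tor (xI r) (tI a) (xI j)) j k
    = -dTor (vI d l) (xI j) (xI k) (tI a)
      - ∑ f, ∑ r, tor (vI d l) (tI a) (vI f r) * tor (vI f r) (xI j) (xI k) := by
  have h := hB.first (vI d l) (tI a) (xI j) (xI k)
  simp only [alt, Fintype.sum_sum_type, Fintype.sum_prod_type, hB.tor_t, hB.tor_x_xx, hB.cur_v_t,
    hB.cur_v_x, hB.tor_xt, hB.dTor_xt, zero_mul, neg_mul, mul_neg, neg_zero,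
    Finset.sum_const_zero, Finset.sum_neg_distrib, mul_comm] at h ⊢
  linear_combination -h

theorem first_v_xxx (d : Fin m) (i j k l : Fin n) :
    cyc (fun i j k => dTor (vI d l) (xI i) (xI j) (xI k)
      + ∑ f, ∑ r, tor (vI d l) (xI k) (vI f r) * tor (vI f r) (xI i) (xI j)) i j k = 0 := by
  have h := hB.first (vI d l) (xI i) (xI j) (xI k)
  simp only [cyc, Fintype.sum_sum_type, Fintype.sum_prod_type, hB.tor_t, hB.tor_x_xx, hB.cur_v_x,
    hB.tor_xt, hB.tor_antisymm _ (xI k) (xI i), hB.dTor_antisymm _ (xI k) (xI i) _, zero_mul,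
    neg_mul, mul_neg, neg_zero, Finset.sum_const_zero, Finset.sum_neg_distrib, mul_comm] at h ⊢
  linear_combination -h

/-- With three form indices of different types no two of the cyclic terms are exchanged by a
symmetry, so nothing combines into an alternate sum. -/
theorem first_x_xtv (a g : Fin m) (k l p : Fin n) :
    dTor (xI l) (tI a) (xI k) (vI g p) - (∑ r, cv l r g p * tor (xI r) (tI a) (xI k))
      + cur (xI l) (xI k) (tI a) (vI g p) + dCv l k g p (tI a)
      - (∑ f, ∑ r, cv l k f r * tor (vI f r) (tI a) (vI g p))
      + ∑ r, cv r k g p * tor (xI l) (tI a) (xI r) = 0 := by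
  have h := hB.first (xI l) (xI k) (tI a) (vI g p)
  simp only [Fintype.sum_sum_type, Fintype.sum_prod_type, hB.tor_t, hB.tor_x_tt, hB.tor_x_tv,
    hB.tor_x_xx, hB.tor_x_vv, hB.tor_x_xv, hB.dTor_x_tv, hB.dTor_x_xv, hB.cur_x_t, hB.cur_x_v,
    hB.tor_xt, hB.tor_vt, hB.tor_vx, hB.dTor_xt, hB.dTor_vx, mul_zero, zero_mul, neg_mul,
    mul_neg, neg_zero, Finset.sum_const_zero, Finset.sum_neg_distrib, mul_comm] at h ⊢
  linear_combination h

theorem first_x_xxv (g : Fin m) (j k l p : Fin n) :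
    alt (fun j k => dCv l j g p (xI k)
      + (∑ f, ∑ r, cv l k f r * tor (vI f r) (xI j) (vI g p))
      + cur (xI l) (xI j) (xI k) (vI g p)) j k = 0 := by
  have h := hB.first (xI l) (xI j) (xI k) (vI g p)
  simp only [alt, Fintype.sum_sum_type, Fintype.sum_prod_type, hB.tor_t, hB.tor_x_tv, hB.tor_x_xx,
    hB.tor_x_vv, hB.tor_x_xv, hB.dTor_x_xx, hB.dTor_x_xv, hB.cur_x_v, hB.tor_xt, hB.tor_vt,
    hB.tor_vx, hB.dTor_vx, hB.cur_vx, mul_zero, zero_mul, mul_neg, neg_zero,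
    Finset.sum_const_zero, Finset.sum_neg_distrib, mul_comm] at h ⊢
  linear_combination h

/-- The sign kept inside `(-cur ...)`, here and below, is the sign convention of the vertical
curvature d-tensors. -/
theorem first_v_ttv (a b d g : Fin m) (l p : Fin n) :
    alt (fun a b => dTor (vI d l) (tI a) (vI g p) (tI b)
      + ∑ f, ∑ r, tor (vI d l) (tI b) (vI f r) * tor (vI f r) (tI a) (vI g p)) a b
    = dTor (vI d l) (tI a) (tI b) (vI g p) + (-cur (vI d l) (vI g p) (tI a) (tI b))
      + ∑ f, ∑ r, tor (vI d l) (vI g p) (vI f r) * tor (vI f r) (tI a) (tI b) := by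
  have h := hB.first (vI d l) (tI a) (tI b) (vI g p)
  simp only [alt, Fintype.sum_sum_type, Fintype.sum_prod_type, hB.tor_t, hB.tor_x_tt, hB.tor_x_tv,
    hB.cur_v_t, hB.tor_vt, hB.tor_vx, hB.dTor_vt, zero_mul, mul_neg, neg_zero,
    Finset.sum_const_zero, Finset.sum_neg_distrib, mul_comm] at h ⊢
  linear_combination h

/-- The alternation exchanges indices of different types, hence runs over `Idx m n`. The two spatial
sums stay outside it. -/
theorem first_v_txv (a d g : Fin m) (k l p : Fin n) :
    alt (fun A K => dTor (vI d l) A (vI g p) K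
      + ∑ f, ∑ r, tor (vI d l) K (vI f r) * tor (vI f r) A (vI g p)) (tI a) (xI k)
    = dTor (vI d l) (tI a) (xI k) (vI g p) + (-cur (vI d l) (vI g p) (tI a) (xI k))
      + (∑ f, ∑ r, tor (vI d l) (vI g p) (vI f r) * tor (vI f r) (tI a) (xI k))
      + (∑ r, tor (vI d l) (tI a) (xI r) * cv r k g p)
      - ∑ r, tor (xI r) (tI a) (xI k) * tor (vI d l) (xI r) (vI g p) := by
  have h := hB.first (vI d l) (tI a) (xI k) (vI g p)
  simp only [alt, Fintype.sum_sum_type, Fintype.sum_prod_type, hB.tor_t, hB.tor_x_tv, hB.tor_x_xv,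
    hB.cur_v_t, hB.cur_v_x, hB.tor_xt, hB.tor_vt, hB.tor_vx, hB.dTor_vt, zero_mul, mul_neg,
    neg_zero, Finset.sum_const_zero, Finset.sum_neg_distrib, mul_comm] at h ⊢
  linear_combination h

theorem first_v_xxv (d g : Fin m) (j k l p : Fin n) :
    alt (fun j k => dTor (vI d l) (xI j) (vI g p) (xI k)
      + (∑ f, ∑ r, tor (vI d l) (xI k) (vI f r) * tor (vI f r) (xI j) (vI g p))
      + ∑ r, tor (vI d l) (xI k) (xI r) * cv r j g p) j k
    = dTor (vI d l) (xI j) (xI k) (vI g p) + (-cur (vI d l) (vI g p) (xI j) (xI k))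
      + ∑ f, ∑ r, tor (vI d l) (vI g p) (vI f r) * tor (vI f r) (xI j) (xI k) := by
  have h := hB.first (vI d l) (xI j) (xI k) (vI g p)
  simp only [alt, Fintype.sum_sum_type, Fintype.sum_prod_type, hB.tor_t, hB.tor_x_xx, hB.tor_x_xv,
    hB.cur_v_x, hB.tor_xt, hB.tor_vt, hB.tor_vx, hB.dTor_vx, zero_mul, mul_neg, neg_zero,
    Finset.sum_const_zero, Finset.sum_neg_distrib, mul_comm] at h ⊢
  linear_combination h

theorem first_x_xvv (b g : Fin m) (i j k l : Fin n) :
    alt (fun B K : Fin m × Fin n => dCv l i B.1 B.2 (vI K.1 K.2)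
      + ∑ r, cv r i K.1 K.2 * cv l r B.1 B.2) (b, j) (g, k)
    = cur (xI l) (xI i) (vI b j) (vI g k)
      - ∑ f, ∑ r, cv l i f r * tor (vI f r) (vI b j) (vI g k) := by
  have h := hB.first (xI l) (xI i) (vI b j) (vI g k)
  simp only [alt, Fintype.sum_sum_type, Fintype.sum_prod_type, hB.tor_t, hB.tor_x_tv, hB.tor_x_xx,
    hB.tor_x_vv, hB.tor_x_xv, hB.dTor_x_vv, hB.dTor_x_xv, hB.cur_x_v, hB.tor_xt, hB.tor_vt,
    hB.tor_vx, hB.dTor_vx, mul_zero, zero_mul, mul_neg, neg_zero, Finset.sum_const_zero,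
    Finset.sum_neg_distrib, mul_comm] at h ⊢
  linear_combination -h

theorem first_v_tvv (a b g d : Fin m) (j k l : Fin n) :
    alt (fun B K : Fin m × Fin n => dTor (vI d l) (tI a) (vI B.1 B.2) (vI K.1 K.2)
      + (∑ f, ∑ r, tor (vI f r) (tI a) (vI B.1 B.2) * tor (vI d l) (vI K.1 K.2) (vI f r))
      - (-cur (vI d l) (vI B.1 B.2) (tI a) (vI K.1 K.2))) (b, j) (g, k)
    = -dTor (vI d l) (vI b j) (vI g k) (tI a)
      - ∑ f, ∑ r, tor (vI f r) (vI b j) (vI g k) * tor (vI d l) (tI a) (vI f r) := by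
  have h := hB.first (vI d l) (tI a) (vI b j) (vI g k)
  simp only [alt, Fintype.sum_sum_type, Fintype.sum_prod_type, hB.tor_t, hB.tor_x_tv, hB.tor_x_vv,
    hB.cur_v_t, hB.tor_vt, hB.tor_vx, hB.dTor_vt, hB.cur_vt, zero_mul, neg_mul, mul_neg,
    neg_zero, Finset.sum_const_zero, Finset.sum_neg_distrib, mul_comm] at h ⊢
  linear_combination -h

theorem first_v_xvv (b g d : Fin m) (i j k l : Fin n) :
    alt (fun B K : Fin m × Fin n => dTor (vI d l) (xI i) (vI B.1 B.2) (vI K.1 K.2)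
      + (∑ f, ∑ r, tor (vI f r) (xI i) (vI B.1 B.2) * tor (vI d l) (vI K.1 K.2) (vI f r))
      - (-cur (vI d l) (vI B.1 B.2) (xI i) (vI K.1 K.2))
      - ∑ r, cv r i B.1 B.2 * tor (vI d l) (xI r) (vI K.1 K.2)) (b, j) (g, k)
    = -dTor (vI d l) (vI b j) (vI g k) (xI i)
      - ∑ f, ∑ r, tor (vI f r) (vI b j) (vI g k) * tor (vI d l) (xI i) (vI f r) := by
  have h := hB.first (vI d l) (xI i) (vI b j) (vI g k)
  simp only [alt, Fintype.sum_sum_type, Fintype.sum_prod_type, hB.tor_t, hB.tor_x_vv, hB.tor_x_xv,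
    hB.cur_v_x, hB.tor_xt, hB.tor_vt, hB.tor_vx, hB.dTor_vx, hB.cur_vx, zero_mul, neg_mul,
    mul_neg, neg_zero, Finset.sum_const_zero, Finset.sum_neg_distrib, mul_comm] at h ⊢
  linear_combination -h

theorem first_v_vvv (a b g d : Fin m) (i j k l : Fin n) :
    cyc (fun A B K : Fin m × Fin n => dTor (vI d l) (vI A.1 A.2) (vI B.1 B.2) (vI K.1 K.2)
      + (∑ f, ∑ r, tor (vI f r) (vI A.1 A.2) (vI B.1 B.2) *
      tor (vI d l) (vI K.1 K.2) (vI f r))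
      + (-cur (vI d l) (vI A.1 A.2) (vI B.1 B.2) (vI K.1 K.2))) (a, i) (b, j) (g, k) = 0 := by
  have h := hB.first (vI d l) (vI a i) (vI b j) (vI g k)
  simp only [cyc, Fintype.sum_sum_type, Fintype.sum_prod_type, hB.tor_t, hB.tor_x_vv, hB.tor_vt,
    hB.tor_vx, hB.tor_antisymm _ (vI g k) (vI a i), hB.dTor_antisymm _ (vI g k) (vI a i) _,
    hB.cur_antisymm _ _ (vI g k) (vI a i), zero_mul, neg_mul, mul_neg, neg_neg, neg_zero,
    Finset.sum_const_zero, Finset.sum_neg_distrib, mul_comm] at h ⊢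
  linear_combination -h

/-! ### Consequences of the second Bianchi identity, by the types of the indices -/

/-- A torsion correction would need a temporal summation index for its curvature factor not to
vanish, but then its torsion factor is zero. -/
theorem second_t_ttt (a b g d q : Fin m) :
    cyc (fun a b g => dChi d q a b (tI g)) a b g = 0 := by
  have h := hB.second (tI d) (tI q) (tI a) (tI b) (tI g)
  simp only [cyc, Fintype.sum_sum_type, hB.tor_t, hB.tor_x_tt, hB.cur_tt_x, hB.cur_tt_v, hB.cur_tt_tt,
    hB.dCur_tt_tt, hB.tor_antisymm _ (tI g) (tI a), mul_zero, zero_mul, neg_mul,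
    Finset.sum_const_zero, Finset.sum_neg_distrib, mul_comm] at h ⊢
  linear_combination h

/-- The temporal curvature block vanishes, with its covariant derivatives, as soon as one form index
is spatial or vertical. So a single term of the cyclic sum survives; the same happens in
`second_t_ttv`. -/
theorem second_t_ttx (a b d q : Fin m) (k : Fin n) :
    dChi d q a b (xI k) = 0 := by
  have h := hB.second (tI d) (tI q) (tI a) (tI b) (xI k)
  simp only [Fintype.sum_sum_type, hB.tor_t, hB.tor_x_tt, hB.cur_tt_x, hB.cur_tt_v, hB.cur_tt_tt,
    hB.dCur_tt_x, hB.dCur_tt_tt, hB.tor_xt, hB.cur_xt, hB.dCur_xt, mul_zero, zero_mul, mul_neg,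
    neg_zero, Finset.sum_const_zero, Finset.sum_neg_distrib, mul_comm] at h ⊢
  linear_combination h

theorem second_t_ttv (a b g d q : Fin m) (k : Fin n) :
    dChi d q a b (vI g k) = 0 := by
  have h := hB.second (tI d) (tI q) (tI a) (tI b) (vI g k)
  simp only [Fintype.sum_sum_type, hB.tor_t, hB.tor_x_tt, hB.tor_x_tv, hB.cur_tt_x, hB.cur_tt_v,
    hB.cur_tt_tt, hB.dCur_tt_v, hB.dCur_tt_tt, hB.tor_vt, hB.cur_vt, hB.dCur_vt, mul_zero,
    zero_mul, mul_neg, neg_zero, Finset.sum_const_zero, Finset.sum_neg_distrib, mul_comm] at h ⊢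
  linear_combination h

/-- Temporal pairs have no spatial torsion, so only the vertical torsion feeds the correction. -/
theorem second_x_ttt (a b g : Fin m) (l p : Fin n) :
    cyc (fun a b g => dCur (xI l) (xI p) (tI a) (tI b) (tI g)
      + ∑ f, ∑ r, tor (vI f r) (tI a) (tI b) * cur (xI l) (xI p) (tI g) (vI f r)) a b g = 0 := by
  have h := hB.second (xI l) (xI p) (tI a) (tI b) (tI g)
  simp only [cyc, Fintype.sum_sum_type, Fintype.sum_prod_type, hB.tor_t, hB.tor_x_tt,
    hB.tor_antisymm _ (tI g) (tI a), hB.dCur_antisymm _ _ (tI g) (tI a) _, zero_mul, neg_mul,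
    mul_neg, Finset.sum_const_zero, Finset.sum_neg_distrib, mul_comm] at h ⊢
  linear_combination h

theorem second_x_ttx (a b : Fin m) (k l p : Fin n) :
    alt (fun a b => dCur (xI l) (xI p) (tI a) (xI k) (tI b)
      + (∑ f, ∑ r, tor (vI f r) (tI a) (xI k) * cur (xI l) (xI p) (tI b) (vI f r))
      + ∑ r, tor (xI r) (tI a) (xI k) * cur (xI l) (xI p) (tI b) (xI r)) a b
    = dCur (xI l) (xI p) (tI a) (tI b) (xI k)
      + ∑ f, ∑ r, tor (vI f r) (tI a) (tI b) * cur (xI l) (xI p) (xI k) (vI f r) := by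
  have h := hB.second (xI l) (xI p) (tI a) (tI b) (xI k)
  simp only [alt, Fintype.sum_sum_type, Fintype.sum_prod_type, hB.tor_t, hB.tor_x_tt, hB.tor_xt,
    hB.cur_xt, hB.dCur_xt, zero_mul, neg_mul, mul_neg, neg_zero, Finset.sum_const_zero,
    Finset.sum_neg_distrib] at h ⊢
  linear_combination -h

theorem second_x_txx (a : Fin m) (j k l p : Fin n) :
    alt (fun j k => dCur (xI l) (xI p) (tI a) (xI j) (xI k)
      + (∑ f, ∑ r, tor (vI f r) (tI a) (xI j) * cur (xI l) (xI p) (xI k) (vI f r))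
      + ∑ r, tor (xI r) (tI a) (xI j) * cur (xI l) (xI p) (xI k) (xI r)) j k
    = -dCur (xI l) (xI p) (xI j) (xI k) (tI a)
      - ∑ f, ∑ r, tor (vI f r) (xI j) (xI k) * cur (xI l) (xI p) (tI a) (vI f r) := by
  have h := hB.second (xI l) (xI p) (tI a) (xI j) (xI k)
  simp only [alt, Fintype.sum_sum_type, Fintype.sum_prod_type, hB.tor_t, hB.tor_x_xx, hB.tor_xt,
    hB.cur_xt, hB.dCur_xt, zero_mul, neg_mul, mul_neg, neg_zero, Finset.sum_const_zero,
    Finset.sum_neg_distrib] at h ⊢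
  linear_combination h

theorem second_x_xxx (i j k l p : Fin n) :
    cyc (fun i j k => dCur (xI l) (xI p) (xI i) (xI j) (xI k)
      + ∑ f, ∑ r, tor (vI f r) (xI i) (xI j) * cur (xI l) (xI p) (xI k) (vI f r)) i j k = 0 := by
  have h := hB.second (xI l) (xI p) (xI i) (xI j) (xI k)
  simp only [cyc, Fintype.sum_sum_type, Fintype.sum_prod_type, hB.tor_t, hB.tor_x_xx, hB.cur_xt,
    hB.tor_antisymm _ (xI k) (xI i), hB.dCur_antisymm _ _ (xI k) (xI i) _, zero_mul, neg_mul,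
    mul_neg, neg_zero, Finset.sum_const_zero, Finset.sum_neg_distrib, mul_comm] at h ⊢
  linear_combination h

theorem second_x_ttv (a b g : Fin m) (i l p : Fin n) :
    alt (fun a b => dCur (xI l) (xI i) (tI a) (vI g p) (tI b)
      + ∑ f, ∑ r, tor (vI f r) (tI a) (vI g p) * cur (xI l) (xI i) (tI b) (vI f r)) a b
    = dCur (xI l) (xI i) (tI a) (tI b) (vI g p)
      + ∑ f, ∑ r, tor (vI f r) (tI a) (tI b) * cur (xI l) (xI i) (vI g p) (vI f r) := by
  have h := hB.second (xI l) (xI i) (tI a) (tI b) (vI g p)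
  simp only [alt, Fintype.sum_sum_type, Fintype.sum_prod_type, hB.tor_t, hB.tor_x_tt, hB.tor_x_tv,
    hB.tor_vt, hB.cur_vt, hB.cur_vx, hB.dCur_vt, zero_mul, mul_neg, neg_zero,
    Finset.sum_const_zero, Finset.sum_neg_distrib, mul_comm] at h ⊢
  linear_combination -h

theorem second_x_txv (a g : Fin m) (i k l p : Fin n) :
    alt (fun A K => dCur (xI l) (xI i) A (vI g p) K
      + ∑ f, ∑ r, tor (vI f r) A (vI g p) * cur (xI l) (xI i) K (vI f r)) (tI a) (xI k)
    = dCur (xI l) (xI i) (tI a) (xI k) (vI g p)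
      + (∑ f, ∑ r, tor (vI f r) (tI a) (xI k) * cur (xI l) (xI i) (vI g p) (vI f r))
      + (∑ r, cv r k g p * cur (xI l) (xI i) (tI a) (xI r))
      - ∑ r, tor (xI r) (tI a) (xI k) * cur (xI l) (xI i) (xI r) (vI g p) := by
  have h := hB.second (xI l) (xI i) (tI a) (xI k) (vI g p)
  simp only [alt, Fintype.sum_sum_type, Fintype.sum_prod_type, hB.tor_t, hB.tor_x_tv, hB.tor_x_xv,
    hB.tor_vt, hB.cur_xt, hB.cur_vt, hB.cur_vx, hB.dCur_vt, zero_mul, mul_neg, neg_zero,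
    Finset.sum_const_zero, Finset.sum_neg_distrib, mul_comm] at h ⊢
  linear_combination -h

theorem second_x_xxv (g : Fin m) (i j k l p : Fin n) :
    alt (fun j k => dCur (xI l) (xI i) (xI j) (vI g p) (xI k)
      + (∑ f, ∑ r, tor (vI f r) (xI j) (vI g p) * cur (xI l) (xI i) (xI k) (vI f r))
      + ∑ r, cv r j g p * cur (xI l) (xI i) (xI k) (xI r)) j k
    = dCur (xI l) (xI i) (xI j) (xI k) (vI g p)
      + ∑ f, ∑ r, tor (vI f r) (xI j) (xI k) * cur (xI l) (xI i) (vI g p) (vI f r) := by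
  have h := hB.second (xI l) (xI i) (xI j) (xI k) (vI g p)
  simp only [alt, Fintype.sum_sum_type, Fintype.sum_prod_type, hB.tor_t, hB.tor_x_xx, hB.tor_x_xv,
    hB.tor_vx, hB.cur_xt, hB.cur_vt, hB.cur_vx, hB.dCur_vx, zero_mul, mul_neg, neg_zero,
    Finset.sum_const_zero, Finset.sum_neg_distrib, mul_comm] at h ⊢
  linear_combination -h

theorem second_x_tvv (a b g : Fin m) (j k l p : Fin n) :
    alt (fun B K : Fin m × Fin n => dCur (xI l) (xI p) (tI a) (vI B.1 B.2) (vI K.1 K.2)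
      + ∑ f, ∑ r, tor (vI f r) (tI a) (vI B.1 B.2) *
      cur (xI l) (xI p) (vI K.1 K.2) (vI f r)) (b, j) (g, k)
    = -dCur (xI l) (xI p) (vI b j) (vI g k) (tI a)
      - ∑ f, ∑ r, tor (vI f r) (vI b j) (vI g k) * cur (xI l) (xI p) (tI a) (vI f r) := by
  have h := hB.second (xI l) (xI p) (tI a) (vI b j) (vI g k)
  simp only [alt, Fintype.sum_sum_type, Fintype.sum_prod_type, hB.tor_t, hB.tor_x_tv, hB.tor_x_vv,
    hB.tor_vt, hB.cur_vt, hB.cur_vx, hB.dCur_vt, zero_mul, mul_neg, neg_zero,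
    Finset.sum_const_zero, Finset.sum_neg_distrib, mul_comm] at h ⊢
  linear_combination h

/-- The extra term with `cv` comes from the torsion of a spatial and a vertical direction, which has
the spatial component `cv`. -/
theorem second_x_xvv (b g : Fin m) (i j k l p : Fin n) :
    alt (fun B K : Fin m × Fin n => dCur (xI l) (xI p) (xI i) (vI B.1 B.2) (vI K.1 K.2)
      + (∑ f, ∑ r, tor (vI f r) (xI i) (vI B.1 B.2) *
      cur (xI l) (xI p) (vI K.1 K.2) (vI f r))
      - ∑ r, cv r i B.1 B.2 * cur (xI l) (xI p) (xI r) (vI K.1 K.2)) (b, j) (g, k)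
    = -dCur (xI l) (xI p) (vI b j) (vI g k) (xI i)
      - ∑ f, ∑ r, tor (vI f r) (vI b j) (vI g k) * cur (xI l) (xI p) (xI i) (vI f r) := by
  have h := hB.second (xI l) (xI p) (xI i) (vI b j) (vI g k)
  simp only [alt, Fintype.sum_sum_type, Fintype.sum_prod_type, hB.tor_t, hB.tor_x_vv, hB.tor_x_xv,
    hB.tor_vx, hB.cur_xt, hB.cur_vt, hB.cur_vx, hB.dCur_vx, zero_mul, mul_neg, neg_zero,
    Finset.sum_const_zero, Finset.sum_neg_distrib, mul_comm] at h ⊢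
  linear_combination h

theorem second_x_vvv (a b g : Fin m) (i j k l p : Fin n) :
    cyc (fun A B K : Fin m × Fin n =>
      dCur (xI l) (xI p) (vI A.1 A.2) (vI B.1 B.2) (vI K.1 K.2)
      + ∑ f, ∑ r, tor (vI f r) (vI A.1 A.2) (vI B.1 B.2) *
      cur (xI l) (xI p) (vI K.1 K.2) (vI f r)) (a, i) (b, j) (g, k) = 0 := by
  have h := hB.second (xI l) (xI p) (vI a i) (vI b j) (vI g k)
  simp only [cyc, Fintype.sum_sum_type, Fintype.sum_prod_type, hB.tor_t, hB.tor_x_vv, hB.cur_vt,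
    hB.cur_vx, hB.tor_antisymm _ (vI g k) (vI a i), hB.dCur_antisymm _ _ (vI g k) (vI a i) _,
    zero_mul, mul_neg, neg_zero, Finset.sum_const_zero, Finset.sum_neg_distrib, mul_comm] at h ⊢
  linear_combination h

end BianchiData

end DualJet

/-! ### Consequences of exact coframe members and of parallel distributions. -/

namespace SmoothFrame

variable {V : Type*} [NormedAddCommGroup V] [NormedSpace ℝ V] {H : Type*} [TopologicalSpace H]
  {I : ModelWithCorners ℝ V H} {X : Type*} [TopologicalSpace X] [ChartedSpace H X]
  [IsManifold I ∞ X] {ι : Type*} [Fintype ι] [DecidableEq ι] {U : Set X}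
  (P : SmoothFrame I ι U) {x : X} (hx : x ∈ U)
  (D : CovariantDerivative I V (TangentSpace I : X → Type _))
include hx

theorem der_eq_zero_of_const {f : X → ℝ} {r : ℝ} (hf : ∀ y ∈ U, f y = r) (A : ι) :
    P.der A f x = 0 :=
  (P.der_congr hx hf A).trans (dirDeriv_const r _)

/-- The hypothesis says that `df` is the `K`-th covector of the coframe. The frame derivatives of
`f` are then constant, and `[X_A, X_B] f = 0` isolates the `K`-th component of the bracket. -/
theorem struc_eq_zero_of_exact [CompleteSpace V] {f : X → ℝ}
    (hf : ∀ y ∈ U, ContMDiffAt I 𝓘(ℝ, ℝ) ∞ f y) {K : ι}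
    (hK : ∀ A, ∀ y ∈ U, P.der A f y = if K = A then 1 else 0) (A B : ι) :
    P.struc K A B x = 0 := by
  have h := P.der_comm hx hf A B
  rw [P.der_eq_zero_of_const hx (hK B), P.der_eq_zero_of_const hx (hK A)] at h
  simpa [hK _ x hx] using h.symm

/-- The projection onto the span of the `X_{g k}` annihilates `X_B` on all of `U`. If it commutes
with `D` in the given direction, it annihilates the derivative of `X_B` too. -/
theorem coeff_eq_zero_of_parallel {κ : Type*} [Fintype κ] [DecidableEq κ] {g : κ → ι}
    (hg : Function.Injective g) {B C : ι} (hB : ∀ k, g k ≠ B)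
    (hpar : D (fun y => ∑ k, P.covec (g k) y (P.vec B y) • P.vec (g k) y) x (P.vec C x) =
      ∑ k, P.covec (g k) x (D (P.vec B) x (P.vec C x)) • P.vec (g k) x) (k : κ) :
    P.coeff D (g k) B C x = 0 := by
  have h0 : ∀ y ∈ U, ∑ k, P.covec (g k) y (P.vec B y) • P.vec (g k) y =
      (0 : (x : X) → TangentSpace I x) y := fun y hy =>
    Finset.sum_eq_zero fun k _ => by rw [P.covec_vec _ _ y hy, if_neg (hB k), zero_smul]
  have hs : SmoothFieldAt I (fun y => ∑ k, P.covec (g k) y (P.vec B y) • P.vec (g k) y) x :=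
    ContMDiffAt.sum_section fun k _ => (P.smooth_vec (g k) x hx).fsmul
      (P.smooth_covec (g k) _ x hx (P.smooth_vec B x hx))
  have hz : SmoothFieldAt I (0 : (x : X) → TangentSpace I x) x :=
    (Bundle.contMDiff_zeroSection ℝ (TangentSpace I : X → Type _)).contMDiffAt
  rw [P.cov_congr hx D hs hz h0, D.zero] at hpar
  have h := congrArg (P.covec (g k) x) hpar
  rw [map_sum] at h
  simp only [map_smul, P.covec_vec _ _ x hx, hg.eq_iff, smul_eq_mul, mul_ite, mul_one, mul_zero,
    Finset.sum_ite_eq, Finset.mem_univ, if_true] at h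
  exact h.symm.trans (map_zero (P.covec (g k) x))

end SmoothFrame

/-! ### Vanishing components for connections of Cartan type. -/

namespace DualJet

variable {m n : ℕ} {T M : Type*}
  [TopologicalSpace T] [ChartedSpace (EuclideanSpace ℝ (Fin m)) T] [IsManifold (𝓡 m) ∞ T]
  [TopologicalSpace M] [ChartedSpace (EuclideanSpace ℝ (Fin n)) M] [IsManifold (𝓡 n) ∞ M]
  {h : TemporalMetric m T} {N : NonlinearConnection m n T M} {D : LinearConnection m n T M}
  {c : ChartPair m n T M} {e : E m n T M} (he : e ∈ c.dom)
include he

/-! ## Structure functions and connection components of an adapted frame -/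

theorem struc_tI (a : Fin m) (A B : Idx m n) : (adapted N c).struc (tI a) A B e = 0 :=
  (adapted N c).struc_eq_zero_of_exact he (fun _ hy => c.contMDiffAt_fn hy (tI a))
    (fun A _ hy => coframe_frame N c hy (tI a) A) A B

theorem struc_xI (i : Fin n) (A B : Idx m n) : (adapted N c).struc (xI i) A B e = 0 :=
  (adapted N c).struc_eq_zero_of_exact he (fun _ hy => c.contMDiffAt_fn hy (xI i))
    (fun A _ hy => coframe_frame N c hy (xI i) A) A B

theorem conn_eq_zero (hN : IsNLinear N D) {F B : Idx m n} (C : Idx m n) (h : kind F ≠ kind B) :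
    conn N D c F B C e = 0 := by
  have hd : DiffAt (frame N c B) e := (smoothFieldAt_frame N c he B).mdifferentiableAt
  rw [← adapted_coeff]
  rcases F with a | i | p
  · refine (adapted N c).coeff_eq_zero_of_parallel he D (B := B) (g := fun a : Fin m => tI a)
      Sum.inl_injective (fun k hk => by subst hk; exact h rfl) ?_ a
    simp only [adapted_covec]
    exact hN.parT c e he _ hd (frame N c C e)
  · refine (adapted N c).coeff_eq_zero_of_parallel he D (B := B) (g := fun i : Fin n => xI i)
      (Sum.inr_injective.comp Sum.inl_injective) (fun k hk => by subst hk; exact h rfl) ?_ i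
    simp only [adapted_covec]
    exact hN.parM c e he _ hd (frame N c C e)
  · refine (adapted N c).coeff_eq_zero_of_parallel he D (B := B)
      (g := fun p : Fin m × Fin n => vI p.1 p.2)
      (Sum.inr_injective.comp Sum.inr_injective) (fun k hk => by subst hk; exact h rfl) ?_ p
    simp only [adapted_covec, Fintype.sum_prod_type]
    exact hN.parV c e he _ hd (frame N c C e)

/-! ## Local covariant derivatives of block-diagonal connections -/

/-- A block-diagonal connection never mixes types, so the covariant derivative of a component only
sees the components of its own type. Knowing a d-tensor on one block of types throughout the domain
is therefore enough. -/
theorem covDeriv₂_congr (hN : IsNLinear N D) {S S' : Idx m n → Idx m n → Idx m n → E m n T M → ℝ}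
    {F B C : Idx m n} (hS : ∀ F' B' C', kind F' = kind F → kind B' = kind B → kind C' = kind C →
      ∀ y ∈ c.dom, S F' B' C' y = S' F' B' C' y) (G : Idx m n) :
    covDeriv₂ N D c S F B C G e = covDeriv₂ N D c S' F B C G e := by
  unfold covDeriv₂
  congr 1
  · congr 1
    · congr 1
      · exact (adapted N c).der_congr he (hS F B C rfl rfl rfl) G
      · refine Finset.sum_congr rfl fun K _ => ?_
        by_cases hK : kind F = kind K
        · rw [hS K B C hK.symm rfl rfl e he]
        · rw [conn_eq_zero he hN G hK, mul_zero, mul_zero]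
    · refine Finset.sum_congr rfl fun K _ => ?_
      by_cases hK : kind K = kind B
      · rw [hS F K C rfl hK rfl e he]
      · rw [conn_eq_zero he hN G hK, mul_zero, mul_zero]
  · refine Finset.sum_congr rfl fun K _ => ?_
    by_cases hK : kind K = kind C
    · rw [hS F B K rfl rfl hK e he]
    · rw [conn_eq_zero he hN G hK, mul_zero, mul_zero]

theorem covDeriv₃_congr (hN : IsNLinear N D)
    {S S' : Idx m n → Idx m n → Idx m n → Idx m n → E m n T M → ℝ}
    {F A B C : Idx m n} (hS : ∀ F' A' B' C', kind F' = kind F → kind A' = kind A →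
      kind B' = kind B → kind C' = kind C → ∀ y ∈ c.dom, S F' A' B' C' y = S' F' A' B' C' y)
    (G : Idx m n) : covDeriv₃ N D c S F A B C G e = covDeriv₃ N D c S' F A B C G e := by
  unfold covDeriv₃
  congr 1
  · congr 1
    · congr 1
      · congr 1
        · exact (adapted N c).der_congr he (hS F A B C rfl rfl rfl rfl) G
        · refine Finset.sum_congr rfl fun K _ => ?_
          by_cases hK : kind F = kind K
          · rw [hS K A B C hK.symm rfl rfl rfl e he]
          · rw [conn_eq_zero he hN G hK, mul_zero, mul_zero]
      · refine Finset.sum_congr rfl fun K _ => ?_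
        by_cases hK : kind K = kind A
        · rw [hS F K B C rfl hK rfl rfl e he]
        · rw [conn_eq_zero he hN G hK, mul_zero, mul_zero]
    · refine Finset.sum_congr rfl fun K _ => ?_
      by_cases hK : kind K = kind B
      · rw [hS F A K C rfl rfl hK rfl e he]
      · rw [conn_eq_zero he hN G hK, mul_zero, mul_zero]
  · refine Finset.sum_congr rfl fun K _ => ?_
    by_cases hK : kind K = kind C
    · rw [hS F A B K rfl rfl rfl hK e he]
    · rw [conn_eq_zero he hN G hK, mul_zero, mul_zero]

theorem covDeriv₂_eq_zero (hN : IsNLinear N D)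
    {S : Idx m n → Idx m n → Idx m n → E m n T M → ℝ}
    {F B C : Idx m n} (hS : ∀ F' B' C', kind F' = kind F → kind B' = kind B → kind C' = kind C →
      ∀ y ∈ c.dom, S F' B' C' y = 0) (G : Idx m n) : covDeriv₂ N D c S F B C G e = 0 := by
  rw [covDeriv₂_congr he hN (S' := fun _ _ _ _ => 0) hS]
  have : dir (fun _ : E m n T M => (0 : ℝ)) e (frame N c G e) = 0 := dirDeriv_const 0 _
  simp [covDeriv₂, this]

theorem covDeriv₃_eq_zero (hN : IsNLinear N D)
    {S : Idx m n → Idx m n → Idx m n → Idx m n → E m n T M → ℝ}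
    {F A B C : Idx m n} (hS : ∀ F' A' B' C', kind F' = kind F → kind A' = kind A →
      kind B' = kind B → kind C' = kind C → ∀ y ∈ c.dom, S F' A' B' C' y = 0)
    (G : Idx m n) : covDeriv₃ N D c S F A B C G e = 0 := by
  rw [covDeriv₃_congr he hN (S' := fun _ _ _ _ _ => 0) hS]
  have : dir (fun _ : E m n T M => (0 : ℝ)) e (frame N c G e) = 0 := dirDeriv_const 0 _
  simp [covDeriv₃, this]

theorem covDeriv₂_antisymm {S : Idx m n → Idx m n → Idx m n → E m n T M → ℝ}
    (hS : ∀ F B C, ∀ y ∈ c.dom, S F B C y = -S F C B y) (F B C G : Idx m n) :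
    covDeriv₂ N D c S F B C G e = -covDeriv₂ N D c S F C B G e := by
  have h1 : dir (S F B C) e (frame N c G e) = -dir (S F C B) e (frame N c G e) :=
    ((adapted N c).der_congr he (hS F B C) G).trans ((adapted N c).der_neg _ G)
  unfold covDeriv₂
  rw [h1]
  simp only [hS _ _ C e he, hS F B _ e he, neg_mul, Finset.sum_neg_distrib]
  ring

theorem covDeriv₃_antisymm {S : Idx m n → Idx m n → Idx m n → Idx m n → E m n T M → ℝ}
    (hS : ∀ F A B C, ∀ y ∈ c.dom, S F A B C y = -S F A C B y) (F A B C G : Idx m n) :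
    covDeriv₃ N D c S F A B C G e = -covDeriv₃ N D c S F A C B G e := by
  have h1 : dir (S F A B C) e (frame N c G e) = -dir (S F A C B) e (frame N c G e) :=
    ((adapted N c).der_congr he (hS F A B C) G).trans ((adapted N c).der_neg _ G)
  unfold covDeriv₃
  rw [h1]
  simp only [hS _ _ _ C e he, hS F A B _ e he, neg_mul, Finset.sum_neg_distrib]
  ring

/-! ## Torsion and curvature components -/

theorem torsion_eq (F B C : Idx m n) : torsion N D c F B C e =
    conn N D c F B C e - conn N D c F C B e - (adapted N c).struc F C B e := by
  have h := SmoothFrame.tor_eq (D := D) (P := adapted N c) he F B C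
  rwa [adapted_tor, adapted_coeff] at h

theorem torsion_antisymm (F B C : Idx m n) :
    torsion N D c F B C e = -torsion N D c F C B e := by
  rw [torsion_eq he, torsion_eq he F C B, (adapted N c).struc_antisymm F C B]
  ring

theorem curvature_eq (hD : IsSmooth D) (F A B C : Idx m n) : curvature N D c F A B C e =
    dir (conn N D c F A B) e (frame N c C e) - dir (conn N D c F A C) e (frame N c B e)
      + (∑ K, conn N D c K A B e * conn N D c F K C e)
      - (∑ K, conn N D c K A C e * conn N D c F K B e)
      - ∑ K, (adapted N c).struc K C B e * conn N D c F A K e := by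
  have h := SmoothFrame.curv_eq (adapted_smoothConn N c hD) he F A B C
  rwa [adapted_curv, adapted_coeff] at h

theorem curvature_antisymm (hD : IsSmooth D) (F A B C : Idx m n) :
    curvature N D c F A B C e = -curvature N D c F A C B e := by
  rw [curvature_eq he hD, curvature_eq he hD F A C B]
  simp only [(adapted N c).struc_antisymm _ C B, neg_mul, Finset.sum_neg_distrib]
  ring

/-- In each product of coefficients, an intermediate index cannot share its type with both `F` and
`A`, so one factor vanishes. -/
theorem curvature_eq_zero (hD : IsSmooth D) (hN : IsNLinear N D) {F A : Idx m n}
    (h : kind F ≠ kind A) (B C : Idx m n) : curvature N D c F A B C e = 0 := by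
  have hd : ∀ B C, dir (conn N D c F A B) e (frame N c C e) = 0 := fun B C =>
    (adapted N c).der_eq_zero_of_const he (fun y hy => conn_eq_zero hy hN B h) C
  have hs : ∀ B C, ∑ K, conn N D c K A B e * conn N D c F K C e = 0 := fun B C =>
    Finset.sum_eq_zero fun K _ => by
      by_cases hK : kind K = kind A
      · rw [conn_eq_zero he hN C (hK ▸ h), mul_zero]
      · rw [conn_eq_zero he hN B hK, zero_mul]
  rw [curvature_eq he hD, hd, hd, hs, hs]
  simp [conn_eq_zero he hN _ h]

omit he [IsManifold (𝓡 n) ∞ M] in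
theorem christoffel_symm (h : TemporalMetric m T) (c : ChartPair m n T M) (a b d : Fin m)
    (e : E m n T M) : christoffel h c a b d e = christoffel h c a d b e := by
  have hm : ∀ a b, metric h c a b = metric h c b a := fun a b => funext fun t => h.symm t _ _
  have hd : ∀ a b d t, metricDeriv h c a b d t = metricDeriv h c b a d t := fun a b d t => by
    unfold metricDeriv
    rw [hm]
  unfold christoffel
  refine congrArg _ (Finset.sum_congr rfl fun f _ => ?_)
  rw [hd b d f]
  ring

/-- The bracket term is zero because `dt^d` is exact. Of the connection terms only the Christoffel
symbols remain, and these are symmetric. -/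
theorem torsion_tI (hC : IsCartan N h D) (d : Fin m) (B C : Idx m n) :
    torsion N D c (tI d) B C e = 0 := by
  have z1 := fun i (C : Idx m n) =>
    conn_eq_zero he hC.toIsNLinear (F := tI d) (B := xI i) C (by simp [kind])
  have z2 := fun f i (C : Idx m n) =>
    conn_eq_zero he hC.toIsNLinear (F := tI d) (B := vI f i) C (by simp [kind])
  rw [torsion_eq he, struc_tI he, sub_zero, sub_eq_zero]
  rcases B with a | i | ⟨a, i⟩ <;> rcases C with b | j | ⟨b, j⟩ <;>
    simp only [z1, z2, hC.A_eq c e he, hC.H_eq c e he, hC.C_eq c e he]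
  exact christoffel_symm h c d a b e

theorem torsion_xI_of_kind (hC : IsCartan N h D) (l : Fin n) {B C : Idx m n} (hB : kind B ≠ 1)
    (hC' : kind C ≠ 1) : torsion N D c (xI l) B C e = 0 := by
  rw [torsion_eq he, struc_xI he,
    conn_eq_zero he hC.toIsNLinear C (F := xI l) (B := B) (Ne.symm hB),
    conn_eq_zero he hC.toIsNLinear B (F := xI l) (B := C) (Ne.symm hC')]
  ring

theorem torsion_xI_xI_xI (hC : IsCartan N h D) (l i j : Fin n) :
    torsion N D c (xI l) (xI i) (xI j) e = 0 := by
  rw [torsion_eq he, struc_xI he, hC.H_symm c e he]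
  ring

theorem torsion_xI_xI_vI (hC : IsCartan N h D) (l k : Fin n) (f : Fin m) (r : Fin n) :
    torsion N D c (xI l) (xI k) (vI f r) e = conn N D c (xI l) (xI k) (vI f r) e := by
  rw [torsion_eq he, struc_xI he,
    conn_eq_zero he hC.toIsNLinear (F := xI l) (B := vI f r) _ (by simp [kind])]
  ring

theorem contMDiffAt_conn (hD : IsSmooth D) (F B C : Idx m n) :
    ContMDiffAt (IJ m n) 𝓘(ℝ, ℝ) ∞ (conn N D c F B C) e := by
  have h := SmoothFrame.SmoothConn.coeff (adapted_smoothConn N c hD) he F B C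
  rwa [adapted_coeff] at h

/-- On the domain this coefficient equals a Christoffel symbol, a function of `t` alone, and spatial
and vertical frame fields are annihilated by all `dt^g`. Smoothness of the Christoffel symbol is
inherited from that of `D`. -/
theorem dir_conn_tI (hD : IsSmooth D) (hC : IsCartan N h D) (d a b : Fin m) {G : Idx m n}
    (hG : kind G ≠ 0) : dir (conn N D c (tI d) (tI a) (tI b)) e (frame N c G e) = 0 := by
  have hev : conn N D c (tI d) (tI a) (tI b) =ᶠ[nhds e] christoffel h c d a b :=
    Filter.eventuallyEq_of_mem (c.isOpen_dom.mem_nhds he) fun y hy => hC.A_eq c y hy d a b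
  refine (dirDeriv_congr hev _).trans (dir_of_temporal c he
    ((contMDiffAt_conn he hD _ _ _).congr_of_eventuallyEq hev.symm) ?_ fun g => ?_)
  · rintro ⟨y, v⟩ ⟨y', v'⟩ hy
    simp only [christoffel, show y.1 = y'.1 from hy]
  · refine (coframe_frame N c he (tI g) G).trans (if_neg ?_)
    rintro rfl
    exact hG rfl

theorem curvature_tI_tI (hD : IsSmooth D) (hC : IsCartan N h D) (d a : Fin m) (B C : Idx m n) :
    curvature N D c (tI d) (tI a) B C e = metricCurv N h c (tI d) (tI a) B C e := by
  have z1 : ∀ i, ∀ y ∈ c.dom, conn N D c (tI d) (tI a) (xI i) y = 0 :=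
    fun i y hy => hC.H_eq c y hy d a i
  have z2 : ∀ f i, ∀ y ∈ c.dom, conn N D c (tI d) (tI a) (vI f i) y = 0 :=
    fun f i y hy => hC.C_eq c y hy d a f i
  have d1 : ∀ i G, dir (conn N D c (tI d) (tI a) (xI i)) e (frame N c G e) = 0 := fun i G =>
    (adapted N c).der_eq_zero_of_const he (z1 i) G
  have d2 : ∀ f i G, dir (conn N D c (tI d) (tI a) (vI f i)) e (frame N c G e) = 0 := fun f i G =>
    (adapted N c).der_eq_zero_of_const he (z2 f i) G
  have d3 : ∀ b i, dir (conn N D c (tI d) (tI a) (tI b)) e (frame N c (xI i) e) = 0 :=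
    fun b i => dir_conn_tI he hD hC d a b (by simp [kind])
  have d4 : ∀ b f i, dir (conn N D c (tI d) (tI a) (tI b)) e (frame N c (vI f i) e) = 0 :=
    fun b f i => dir_conn_tI he hD hC d a b (by simp [kind])
  have d5 : ∀ b G, dir (conn N D c (tI d) (tI a) (tI b)) e (frame N c G e) =
      dir (christoffel h c d a b) e (frame N c G e) := fun b G =>
    (adapted N c).der_congr he (fun y hy => hC.A_eq c y hy d a b) G
  have z3 := fun i (C : Idx m n) =>
    conn_eq_zero he hC.toIsNLinear (F := xI i) (B := tI a) C (by simp [kind])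
  have z4 := fun f i (C : Idx m n) =>
    conn_eq_zero he hC.toIsNLinear (F := vI f i) (B := tI a) C (by simp [kind])
  rw [curvature_eq he hD]
  -- The bracket sum disappears: its temporal structure functions are zero, and the remaining ones
  -- multiply the coefficients killed by `z1` and `z2`.
  simp only [Fintype.sum_sum_type, struc_tI he, z1 _ e he, z2 _ _ e he,
    z3, z4, zero_mul, mul_zero, Finset.sum_const_zero, add_zero, sub_zero]
  rcases B with b | j | ⟨b, j⟩ <;> rcases C with g | k | ⟨g, k⟩ <;>
    simp only [d1, d2, d3, d4, hC.A_eq c e he, hC.H_eq c e he, hC.C_eq c e he, metricCurv,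
      zero_mul, mul_zero, Finset.sum_const_zero, add_zero, sub_zero, Pi.zero_apply]
  rw [d5, d5, Finset.sum_sub_distrib]
  ring

end DualJet

/-! ### Assembly of the local Bianchi data at a point. -/

namespace DualJet

variable {m n : ℕ} {T M : Type*}
  [TopologicalSpace T] [ChartedSpace (EuclideanSpace ℝ (Fin m)) T] [IsManifold (𝓡 m) ∞ T]
  [TopologicalSpace M] [ChartedSpace (EuclideanSpace ℝ (Fin n)) M] [IsManifold (𝓡 n) ∞ M]
  {h : TemporalMetric m T} {N : NonlinearConnection m n T M} {D : LinearConnection m n T M}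
  {c : ChartPair m n T M} {e : E m n T M} (he : e ∈ c.dom)

theorem kind_eq_zero {A : Idx m n} (h : kind A = 0) : ∃ a, A = tI a := by
  rcases A with a | i | p
  · exact ⟨a, rfl⟩
  · cases h
  · cases h

theorem kind_eq_one {A : Idx m n} (h : kind A = 1) : ∃ i, A = xI i := by
  rcases A with a | i | p
  · cases h
  · exact ⟨i, rfl⟩
  · cases h

theorem kind_eq_two {A : Idx m n} (h : kind A = 2) : ∃ a i, A = vI a i := by
  rcases A with a | i | p
  · cases h
  · cases h
  · exact ⟨p.1, p.2, rfl⟩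

include he

/-- The local Bianchi data of an `h`-normal `N`-linear connection of Cartan type. -/
theorem bianchiData (hD : IsSmooth D) (hC : IsCartan N h D) :
    BianchiData (fun F B C => torsion N D c F B C e)
      (fun F B C G => covDeriv₂ N D c (torsion N D c) F B C G e)
      (fun F A B C => curvature N D c F A B C e)
      (fun F A B C G => covDeriv₃ N D c (curvature N D c) F A B C G e)
      (fun l k f r => conn N D c (xI l) (xI k) (vI f r) e)
      (fun l k f r G => covDeriv₂ N D c (vertTensor N D c) (xI l) (xI k) (vI f r) G e)
      (fun d a b g => metricCurv N h c (tI d) (tI a) (tI b) (tI g) e)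
      (fun d a b g G => covDeriv₃ N D c (metricCurv N h c) (tI d) (tI a) (tI b) (tI g) G e) := by
  have hN := hC.toIsNLinear
  have hx : ∀ {B C : Idx m n}, kind B ≠ 1 → kind C ≠ 1 → ∀ l G,
      covDeriv₂ N D c (torsion N D c) (xI l) B C G e = 0 := by
    intro B C hB hC' l G
    refine covDeriv₂_eq_zero he hN (fun F' B' C' hF' hB' hC'' y hy => ?_) G
    obtain ⟨l', rfl⟩ := kind_eq_one hF'
    exact torsion_xI_of_kind hy hC l' (hB' ▸ hB) (hC'' ▸ hC')
  have ht : ∀ {B C : Idx m n}, kind C ≠ 0 → ∀ d a,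
      curvature N D c (tI d) (tI a) B C e = 0 := by
    intro B C hC' d a
    rw [curvature_tI_tI he hD hC]
    rcases B with b | j | p <;> rcases C with g | k | q <;> first | rfl | exact absurd rfl hC'
  have hdt : ∀ {C : Idx m n}, kind C ≠ 0 → ∀ d a B G,
      covDeriv₃ N D c (curvature N D c) (tI d) (tI a) B C G e = 0 := by
    -- Vanishing at a single point would not control a derivative; `covDeriv₃_eq_zero` uses the
    -- whole block on the whole domain.
    intro C hC' d a B G
    refine covDeriv₃_eq_zero he hN (fun F' A' B' C'' hF' hA' _ hC'' y hy => ?_) G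
    obtain ⟨d', rfl⟩ := kind_eq_zero hF'
    obtain ⟨a', rfl⟩ := kind_eq_zero hA'
    rw [curvature_tI_tI hy hD hC]
    rcases B' with b | j | p <;> rcases C'' with g | k | q <;>
      first | rfl | exact absurd hC''.symm hC'
  constructor
  · exact torsion_antisymm he
  · exact covDeriv₂_antisymm he fun F B C y hy => torsion_antisymm hy F B C
  · exact curvature_antisymm he hD
  · exact covDeriv₃_antisymm he fun F A B C y hy => curvature_antisymm hy hD F A B C
  · exact torsion_tI he hC
  · exact fun l a b => torsion_xI_of_kind he hC l (by simp [kind]) (by simp [kind])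
  · exact fun l a f r => torsion_xI_of_kind he hC l (by simp [kind]) (by simp [kind])
  · exact torsion_xI_xI_xI he hC
  · exact fun l f r g s => torsion_xI_of_kind he hC l (by simp [kind]) (by simp [kind])
  · exact torsion_xI_xI_vI he hC
  · intro d B C G
    refine covDeriv₂_eq_zero he hN (fun F' B' C' hF' _ _ y hy => ?_) G
    obtain ⟨d', rfl⟩ := kind_eq_zero hF'
    exact torsion_tI hy hC d' B' C'
  · exact fun l a b G => hx (by simp [kind]) (by simp [kind]) l G
  · exact fun l a f r G => hx (by simp [kind]) (by simp [kind]) l G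
  · intro l i j G
    refine covDeriv₂_eq_zero he hN (fun F' B' C' hF' hB' hC' y hy => ?_) G
    obtain ⟨l', rfl⟩ := kind_eq_one hF'
    obtain ⟨i', rfl⟩ := kind_eq_one hB'
    obtain ⟨j', rfl⟩ := kind_eq_one hC'
    exact torsion_xI_xI_xI hy hC l' i' j'
  · exact fun l f r g s G => hx (by simp [kind]) (by simp [kind]) l G
  · intro l k f r G
    refine covDeriv₂_congr he hN (fun F' B' C' hF' hB' hC' y hy => ?_) G
    obtain ⟨l', rfl⟩ := kind_eq_one hF'
    obtain ⟨k', rfl⟩ := kind_eq_one hB'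
    obtain ⟨f', r', rfl⟩ := kind_eq_two hC'
    exact torsion_xI_xI_vI hy hC l' k' f' r'
  · exact fun F A B C hFA => curvature_eq_zero he hD hN hFA B C
  · exact fun d a B i => ht (by simp [kind]) d a
  · exact fun d a B f r => ht (by simp [kind]) d a
  · exact fun d a b g => curvature_tI_tI he hD hC d a (tI b) (tI g)
  · exact fun d a B i G => hdt (by simp [kind]) d a B G
  · exact fun d a B f r G => hdt (by simp [kind]) d a B G
  · intro d a b g G
    refine covDeriv₃_congr he hN (fun F' A' B' C' hF' hA' _ _ y hy => ?_) G
    obtain ⟨d', rfl⟩ := kind_eq_zero hF'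
    obtain ⟨a', rfl⟩ := kind_eq_zero hA'
    exact curvature_tI_tI hy hD hC d' a' B' C'
  · intro F A B C
    have h := SmoothFrame.first_bianchi (adapted_smoothConn N c hD) he F A B C
    rwa [adapted_tor, adapted_curv, adapted_covD₂] at h
  · intro F E A B C
    have h := SmoothFrame.second_bianchi (adapted_smoothConn N c hD) he F E A B C
    rwa [adapted_tor, adapted_curv, adapted_covD₃] at h

end DualJet

end

/-! ### The thirty local Bianchi identities. -/

open DualJet in
theorem mainTheorem6 {m n : ℕ} {T M : Type*}
    [TopologicalSpace T] [ChartedSpace (EuclideanSpace ℝ (Fin m)) T] [IsManifold (𝓡 m) ∞ T]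
    [TopologicalSpace M] [ChartedSpace (EuclideanSpace ℝ (Fin n)) M] [IsManifold (𝓡 n) ∞ M]
    (h : TemporalMetric m T) (N : NonlinearConnection m n T M) (D : LinearConnection m n T M)
    (hD : IsSmooth D) (hCartan : IsCartan N h D)
    (c : ChartPair m n T M) (e : E m n T M) (he : e ∈ c.dom) :
    -- `Tor F B C` is `𝕋^F_{BC}`, `Cur F A B C` is `ℝ^F_{ABC}`, `CurV d l g p B C` is
    -- `R^{(d)(p)}_{(l)(g)BC}`, `Cv l k f r` is `C^{l(r)}_{k(f)}`, `Chi d a b g` is `χ^d_{abg}`;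
    -- the prefix `d` marks covariant derivatives, their last argument being the last index.
    let Tor := fun F B C => torsion N D c F B C e
    let dTor := fun F B C G => covDeriv₂ N D c (torsion N D c) F B C G e
    let Cur := fun F A B C => curvature N D c F A B C e
    let dCur := fun F A B C G => covDeriv₃ N D c (curvature N D c) F A B C G e
    let CurV := fun (d : Fin m) (l : Fin n) (g : Fin m) (p : Fin n) (B C : Idx m n) =>
      -curvature N D c (vI d l) (vI g p) B C e
    let Cv := fun (l k : Fin n) (f : Fin m) (r : Fin n) => conn N D c (xI l) (xI k) (vI f r) e
    let dCv := fun (l k : Fin n) (f : Fin m) (r : Fin n) (G : Idx m n) =>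
      covDeriv₂ N D c (vertTensor N D c) (xI l) (xI k) (vI f r) G e
    let Chi := fun (d a b g : Fin m) => metricCurv N h c (tI d) (tI a) (tI b) (tI g) e
    let dChi := fun (d a b g : Fin m) (G : Idx m n) =>
      covDeriv₃ N D c (metricCurv N h c) (tI d) (tI a) (tI b) (tI g) G e
    -- 1
    (∀ a b g d, cyc (fun a b g => Chi d a b g) a b g = 0) ∧
    -- 2
    (∀ a b k l,
      alt (fun a b => (∑ r, Tor (xI l) (tI a) (xI r) * Tor (xI r) (tI b) (xI k))
        - dTor (xI l) (tI a) (xI k) (tI b)) a b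
      = Cur (xI l) (xI k) (tI a) (tI b)
        - ∑ f, ∑ r, Cv l k f r * Tor (vI f r) (tI a) (tI b)) ∧
    -- 3
    (∀ a j k l,
      alt (fun j k => (∑ f, ∑ r, Cv l k f r * Tor (vI f r) (tI a) (xI j))
        + Cur (xI l) (xI j) (tI a) (xI k) + dTor (xI l) (tI a) (xI j) (xI k)) j k = 0) ∧
    -- 4
    (∀ i j k l,
      cyc (fun i j k => (∑ f, ∑ r, Cv l k f r * Tor (vI f r) (xI i) (xI j))
        - Cur (xI l) (xI i) (xI j) (xI k)) i j k = 0) ∧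
    -- 5
    (∀ a b g d l,
      cyc (fun a b g => dTor (vI d l) (tI a) (tI b) (tI g)
        + ∑ f, ∑ r, Tor (vI d l) (tI g) (vI f r) * Tor (vI f r) (tI a) (tI b)) a b g = 0) ∧
    -- 6
    (∀ a b d k l,
      alt (fun a b => dTor (vI d l) (tI a) (xI k) (tI b)
        + (∑ f, ∑ r, Tor (vI d l) (tI b) (vI f r) * Tor (vI f r) (tI a) (xI k))
        + ∑ r, Tor (vI d l) (tI b) (xI r) * Tor (xI r) (tI a) (xI k)) a b
      = dTor (vI d l) (tI a) (tI b) (xI k)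
        + ∑ f, ∑ r, Tor (vI d l) (xI k) (vI f r) * Tor (vI f r) (tI a) (tI b)) ∧
    -- 7
    (∀ a d j k l,
      alt (fun j k => dTor (vI d l) (tI a) (xI j) (xI k)
        + (∑ f, ∑ r, Tor (vI d l) (xI k) (vI f r) * Tor (vI f r) (tI a) (xI j))
        + ∑ r, Tor (vI d l) (xI k) (xI r) * Tor (xI r) (tI a) (xI j)) j k
      = -dTor (vI d l) (xI j) (xI k) (tI a)
        - ∑ f, ∑ r, Tor (vI d l) (tI a) (vI f r) * Tor (vI f r) (xI j) (xI k)) ∧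
    -- 8
    (∀ d i j k l,
      cyc (fun i j k => dTor (vI d l) (xI i) (xI j) (xI k)
        + ∑ f, ∑ r, Tor (vI d l) (xI k) (vI f r) * Tor (vI f r) (xI i) (xI j)) i j k = 0) ∧
    -- 9
    (∀ a g k l p,
      dTor (xI l) (tI a) (xI k) (vI g p) - (∑ r, Cv l r g p * Tor (xI r) (tI a) (xI k))
        + Cur (xI l) (xI k) (tI a) (vI g p) + dCv l k g p (tI a)
        - (∑ f, ∑ r, Cv l k f r * Tor (vI f r) (tI a) (vI g p))
        + ∑ r, Cv r k g p * Tor (xI l) (tI a) (xI r) = 0) ∧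
    -- 10
    (∀ g j k l p,
      alt (fun j k => dCv l j g p (xI k)
        + (∑ f, ∑ r, Cv l k f r * Tor (vI f r) (xI j) (vI g p))
        + Cur (xI l) (xI j) (xI k) (vI g p)) j k = 0) ∧
    -- 11
    (∀ a b d g l p,
      alt (fun a b => dTor (vI d l) (tI a) (vI g p) (tI b)
        + ∑ f, ∑ r, Tor (vI d l) (tI b) (vI f r) * Tor (vI f r) (tI a) (vI g p)) a b
      = dTor (vI d l) (tI a) (tI b) (vI g p) + CurV d l g p (tI a) (tI b)
        + ∑ f, ∑ r, Tor (vI d l) (vI g p) (vI f r) * Tor (vI f r) (tI a) (tI b)) ∧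
    -- 12
    (∀ a d g k l p,
      alt (fun A K => dTor (vI d l) A (vI g p) K
        + ∑ f, ∑ r, Tor (vI d l) K (vI f r) * Tor (vI f r) A (vI g p)) (tI a) (xI k)
      = dTor (vI d l) (tI a) (xI k) (vI g p) + CurV d l g p (tI a) (xI k)
        + (∑ f, ∑ r, Tor (vI d l) (vI g p) (vI f r) * Tor (vI f r) (tI a) (xI k))
        + (∑ r, Tor (vI d l) (tI a) (xI r) * Cv r k g p)
        - ∑ r, Tor (xI r) (tI a) (xI k) * Tor (vI d l) (xI r) (vI g p)) ∧
    -- 13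
    (∀ d g j k l p,
      alt (fun j k => dTor (vI d l) (xI j) (vI g p) (xI k)
        + (∑ f, ∑ r, Tor (vI d l) (xI k) (vI f r) * Tor (vI f r) (xI j) (vI g p))
        + ∑ r, Tor (vI d l) (xI k) (xI r) * Cv r j g p) j k
      = dTor (vI d l) (xI j) (xI k) (vI g p) + CurV d l g p (xI j) (xI k)
        + ∑ f, ∑ r, Tor (vI d l) (vI g p) (vI f r) * Tor (vI f r) (xI j) (xI k)) ∧
    -- 14
    (∀ b g i j k l,
      alt (fun B K : Fin m × Fin n => dCv l i B.1 B.2 (vI K.1 K.2)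
        + ∑ r, Cv r i K.1 K.2 * Cv l r B.1 B.2) (b, j) (g, k)
      = Cur (xI l) (xI i) (vI b j) (vI g k)
        - ∑ f, ∑ r, Cv l i f r * Tor (vI f r) (vI b j) (vI g k)) ∧
    -- 15
    (∀ a b g d j k l,
      alt (fun B K : Fin m × Fin n => dTor (vI d l) (tI a) (vI B.1 B.2) (vI K.1 K.2)
        + (∑ f, ∑ r, Tor (vI f r) (tI a) (vI B.1 B.2) * Tor (vI d l) (vI K.1 K.2) (vI f r))
        - CurV d l B.1 B.2 (tI a) (vI K.1 K.2)) (b, j) (g, k)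
      = -dTor (vI d l) (vI b j) (vI g k) (tI a)
        - ∑ f, ∑ r, Tor (vI f r) (vI b j) (vI g k) * Tor (vI d l) (tI a) (vI f r)) ∧
    -- 16
    (∀ b g d i j k l,
      alt (fun B K : Fin m × Fin n => dTor (vI d l) (xI i) (vI B.1 B.2) (vI K.1 K.2)
        + (∑ f, ∑ r, Tor (vI f r) (xI i) (vI B.1 B.2) * Tor (vI d l) (vI K.1 K.2) (vI f r))
        - CurV d l B.1 B.2 (xI i) (vI K.1 K.2)
        - ∑ r, Cv r i B.1 B.2 * Tor (vI d l) (xI r) (vI K.1 K.2)) (b, j) (g, k)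
      = -dTor (vI d l) (vI b j) (vI g k) (xI i)
        - ∑ f, ∑ r, Tor (vI f r) (vI b j) (vI g k) * Tor (vI d l) (xI i) (vI f r)) ∧
    -- 17
    (∀ a b g d i j k l,
      cyc (fun A B K : Fin m × Fin n => dTor (vI d l) (vI A.1 A.2) (vI B.1 B.2) (vI K.1 K.2)
        + (∑ f, ∑ r, Tor (vI f r) (vI A.1 A.2) (vI B.1 B.2) *
            Tor (vI d l) (vI K.1 K.2) (vI f r))
        + CurV d l A.1 A.2 (vI B.1 B.2) (vI K.1 K.2)) (a, i) (b, j) (g, k) = 0) ∧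
    -- 18
    (∀ a b g d q, cyc (fun a b g => dChi d q a b (tI g)) a b g = 0) ∧
    -- 19
    (∀ a b d q k, dChi d q a b (xI k) = 0) ∧
    -- 20
    (∀ a b g d q k, dChi d q a b (vI g k) = 0) ∧
    -- 21
    (∀ a b g l p,
      cyc (fun a b g => dCur (xI l) (xI p) (tI a) (tI b) (tI g)
        + ∑ f, ∑ r, Tor (vI f r) (tI a) (tI b) * Cur (xI l) (xI p) (tI g) (vI f r)) a b g = 0) ∧
    -- 22
    (∀ a b k l p,
      alt (fun a b => dCur (xI l) (xI p) (tI a) (xI k) (tI b)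
        + (∑ f, ∑ r, Tor (vI f r) (tI a) (xI k) * Cur (xI l) (xI p) (tI b) (vI f r))
        + ∑ r, Tor (xI r) (tI a) (xI k) * Cur (xI l) (xI p) (tI b) (xI r)) a b
      = dCur (xI l) (xI p) (tI a) (tI b) (xI k)
        + ∑ f, ∑ r, Tor (vI f r) (tI a) (tI b) * Cur (xI l) (xI p) (xI k) (vI f r)) ∧
    -- 23
    (∀ a j k l p,
      alt (fun j k => dCur (xI l) (xI p) (tI a) (xI j) (xI k)
        + (∑ f, ∑ r, Tor (vI f r) (tI a) (xI j) * Cur (xI l) (xI p) (xI k) (vI f r))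
        + ∑ r, Tor (xI r) (tI a) (xI j) * Cur (xI l) (xI p) (xI k) (xI r)) j k
      = -dCur (xI l) (xI p) (xI j) (xI k) (tI a)
        - ∑ f, ∑ r, Tor (vI f r) (xI j) (xI k) * Cur (xI l) (xI p) (tI a) (vI f r)) ∧
    -- 24
    (∀ i j k l p,
      cyc (fun i j k => dCur (xI l) (xI p) (xI i) (xI j) (xI k)
        + ∑ f, ∑ r, Tor (vI f r) (xI i) (xI j) * Cur (xI l) (xI p) (xI k) (vI f r)) i j k = 0) ∧
    -- 25
    (∀ a b g i l p,
      alt (fun a b => dCur (xI l) (xI i) (tI a) (vI g p) (tI b)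
        + ∑ f, ∑ r, Tor (vI f r) (tI a) (vI g p) * Cur (xI l) (xI i) (tI b) (vI f r)) a b
      = dCur (xI l) (xI i) (tI a) (tI b) (vI g p)
        + ∑ f, ∑ r, Tor (vI f r) (tI a) (tI b) * Cur (xI l) (xI i) (vI g p) (vI f r)) ∧
    -- 26
    (∀ a g i k l p,
      alt (fun A K => dCur (xI l) (xI i) A (vI g p) K
        + ∑ f, ∑ r, Tor (vI f r) A (vI g p) * Cur (xI l) (xI i) K (vI f r)) (tI a) (xI k)
      = dCur (xI l) (xI i) (tI a) (xI k) (vI g p)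
        + (∑ f, ∑ r, Tor (vI f r) (tI a) (xI k) * Cur (xI l) (xI i) (vI g p) (vI f r))
        + (∑ r, Cv r k g p * Cur (xI l) (xI i) (tI a) (xI r))
        - ∑ r, Tor (xI r) (tI a) (xI k) * Cur (xI l) (xI i) (xI r) (vI g p)) ∧
    -- 27
    (∀ g i j k l p,
      alt (fun j k => dCur (xI l) (xI i) (xI j) (vI g p) (xI k)
        + (∑ f, ∑ r, Tor (vI f r) (xI j) (vI g p) * Cur (xI l) (xI i) (xI k) (vI f r))
        + ∑ r, Cv r j g p * Cur (xI l) (xI i) (xI k) (xI r)) j k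
      = dCur (xI l) (xI i) (xI j) (xI k) (vI g p)
        + ∑ f, ∑ r, Tor (vI f r) (xI j) (xI k) * Cur (xI l) (xI i) (vI g p) (vI f r)) ∧
    -- 28
    (∀ a b g j k l p,
      alt (fun B K : Fin m × Fin n => dCur (xI l) (xI p) (tI a) (vI B.1 B.2) (vI K.1 K.2)
        + ∑ f, ∑ r, Tor (vI f r) (tI a) (vI B.1 B.2) *
            Cur (xI l) (xI p) (vI K.1 K.2) (vI f r)) (b, j) (g, k)
      = -dCur (xI l) (xI p) (vI b j) (vI g k) (tI a)
        - ∑ f, ∑ r, Tor (vI f r) (vI b j) (vI g k) * Cur (xI l) (xI p) (tI a) (vI f r)) ∧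
    -- 29
    (∀ b g i j k l p,
      alt (fun B K : Fin m × Fin n => dCur (xI l) (xI p) (xI i) (vI B.1 B.2) (vI K.1 K.2)
        + (∑ f, ∑ r, Tor (vI f r) (xI i) (vI B.1 B.2) *
            Cur (xI l) (xI p) (vI K.1 K.2) (vI f r))
        - ∑ r, Cv r i B.1 B.2 * Cur (xI l) (xI p) (xI r) (vI K.1 K.2)) (b, j) (g, k)
      = -dCur (xI l) (xI p) (vI b j) (vI g k) (xI i)
        - ∑ f, ∑ r, Tor (vI f r) (vI b j) (vI g k) * Cur (xI l) (xI p) (xI i) (vI f r)) ∧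
    -- 30
    (∀ a b g i j k l p,
      cyc (fun A B K : Fin m × Fin n =>
        dCur (xI l) (xI p) (vI A.1 A.2) (vI B.1 B.2) (vI K.1 K.2)
        + ∑ f, ∑ r, Tor (vI f r) (vI A.1 A.2) (vI B.1 B.2) *
            Cur (xI l) (xI p) (vI K.1 K.2) (vI f r)) (a, i) (b, j) (g, k) = 0) := by
  intros
  have hB := bianchiData he hD hCartan
  exact ⟨hB.first_t_ttt, hB.first_x_xtt, hB.first_x_txx, hB.first_x_xxx, hB.first_v_ttt,
    hB.first_v_ttx, hB.first_v_txx, hB.first_v_xxx, hB.first_x_xtv, hB.first_x_xxv,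
    hB.first_v_ttv, hB.first_v_txv, hB.first_v_xxv, hB.first_x_xvv, hB.first_v_tvv,
    hB.first_v_xvv, hB.first_v_vvv, hB.second_t_ttt, hB.second_t_ttx, hB.second_t_ttv,
    hB.second_x_ttt, hB.second_x_ttx, hB.second_x_txx, hB.second_x_xxx, hB.second_x_ttv,
    hB.second_x_txv, hB.second_x_xxv, hB.second_x_tvv, hB.second_x_xvv, hB.second_x_vvv⟩
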